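/- Let $\mathbb K\in\{\mathbb R,\mathbb C\}$. Let $\mathfrak g$ be the $\mathbb Z_2\times\mathbb Z_2$-graded color superalgebra with basis $A_\pm,N$ of degree $(0,0)$, $b_\pm$ of degree $(1,0)$, $a_\pm$ of degree $(0,1)$, $F$ of degree $(1,1)$, with bracket satisfying $[\![X,Y]\!]=-(-1)^{\alpha\cdot\beta}[\![Y,X]\!]$ for $\deg X=\alpha$, $\deg Y=\beta$, and non-vanishing brackets (commutators $[\,,]$ if $\alpha\cdot\beta$ is even, anticommutators $\{\,,\}$ if it is odd) $$[A_-,A_+]=4N,\ [A_\mp,N]=\pm2A_\mp,\ [N,a_\pm]=\pm a_\pm,\ [N,b_\pm]=\pm b_\pm,\ [A_\mp,a_\pm]=\pm2a_\mp,\ [A_\mp,b_\pm]=\pm2b_\mp,$$ $$\{a_\pm,a_\pm\}=\{b_\pm,b_\pm\}=2A_\pm,\ \{a_-,a_+\}=\{b_-,b_+\}=2N,\ [b_-,a_+]=F,\ [b_+,a_-]=-F,\ \{b_\pm,F\}=2a_\pm,\ \{a_\pm,F\}=2b_\pm.$$ Let $\zeta$ be a graded Grassmann number of degree $(1,1)$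 with $\zeta^2=1$ (elements of degrees $\alpha,\beta$ with at least one of them a Grassmann number satisfy $uv=(-1)^{\alpha\cdot\beta}vu$), and put $c_\pm=\frac1{\sqrt2}(a_-\pm b_-\zeta)$, $d_\pm=\frac1{\sqrt2}(a_+\pm\zeta b_+)$, $\tilde F=\frac12\zeta F$. (0) Brackets and right action. The elements $A_\pm,N,\tilde F$ (even) and $c_\pm,d_\pm$ (odd) satisfy the relations of an ordinary Lie superalgebra over $\mathbb K$ with non-vanishing brackets, up to order, $[A_-,A_+]=4N$, $[A_\mp,N]=\pm2A_\mp$, $[N,c_\pm]=-c_\pm$, $[N,d_\pm]=d_\pm$, $[A_-,d_\pm]=2c_\mp$, $[A_+,c_\pm]=-2d_\mp$, $\{c_+,c_-\}=2A_-$, $\{d_+,d_-\}=2A_+$, $\{c_\pm,d_\pm\}=2(N\mp\tilde F)$, $[\tilde F,c_\pm]=\mp c_\pm$, $[\tilde F,d_\pm]=\pm d_\pm$. Let $\mathfrak g_+=\langle A_+,d_\pm\rangle$ and $\mathfrak g_-=\langle A_-,c_\pm\rangle$. Consider functions $\varphi(x,\psi_+,\psi_-)=\sum_{i,j,k\in\{0,1\}}\varphi_{ijk}(x)\,\zeta^i\psi_+^j\psi_-^k$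 with $\varphi_{ijk}\in C^\infty(\mathbb R,\mathbb K)$ and $\psi_\pm$ graded Grassmann variables of degree $(0,1)$ (so $\psi_\pm^2=0$); derivatives with respect to Grassmann variables are graded left derivatives. Such $\varphi$ is regarded, for $h,f\in\mathbb K$, as a function on $g_+=\exp(xA_+)\exp(\psi_+d_+)\exp(\psi_-d_-)$, extended by $\varphi(g\,e^{H}g_-)=e^{\Lambda(H)}\varphi(g)$ for $H\in\langle N,\tilde F\rangle$, $g_-\in\exp\mathfrak g_-$, where $\Lambda(N)=h$, $\Lambda(\tilde F)=f$. On these functions let $\pi_R(X)\varphi(g)=\frac{d}{d\tau}\varphi(ge^{\tau X})|_{\tau=0}$ and $\pi_L^{h,f}(X)\varphi(g)=\frac{d}{d\tau}\varphi(e^{-\tau X}g)|_{\tau=0}$, where $\tau$ is a graded parameter with $\deg\tau=\deg X$; equivalently, $\pi_L^{h,f}(X)$ is obtained from $e^{-\tau X}g_+=g_+e^{-\tau\,\mathrm{Ad}(g_+^{-1})X}$. Every element $V$ of $\mathfrak g$ with Grassmann function coefficients is of the form $V=\xi\,g_+^{-1}\partial_xg_++\eta_+\,g_+^{-1}\partial_{\psi_+}g_++\eta_-\,g_+^{-1}\partial_{\psi_-}g_++uN+w\tilde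 F+Y$ with $Y$ in the span of $\mathfrak g_-$, and then $\pi_R(V)\varphi=\xi\partial_x\varphi+\eta_+\partial_{\psi_+}\varphi+\eta_-\partial_{\psi_-}\varphi+hu\varphi+fw\varphi$; and $$\pi_R(A_+)=\partial_x,\quad \pi_R(d_+)=\partial_{\psi_+}+2\psi_-\partial_x,\quad \pi_R(d_-)=\partial_{\psi_-},\quad \pi_R(N)=h,\quad \pi_R(\tilde F)=f,\quad \pi_R(\mathfrak g_-)=0.$$ The operators $\pi_R(A_+),\pi_R(d_\pm)$ define a homomorphism $\pi_R$ from $U(\mathfrak g_+)$ to differential operators. Let $M(h,f)$ be the Verma module of this superalgebra generated by $|h,f\rangle$ with $c_\pm|h,f\rangle=0$, $N|h,f\rangle=h|h,f\rangle$, $\tilde F|h,f\rangle=f|h,f\rangle$. A singular vector is a weight vector for $(N,\tilde F)$ that is annihilated by $\mathfrak g_-$ and is not a multiple of $|h,f\rangle$. (1)–(3) Invariant equations. Let $(h,f)$, $\mathcal P\in U(\mathfrak g_+)$, the operator $E$ of degree $\delta$ and the weight $(h',f')$ be one of the following: 1. $h=-f$, $\mathcal P=d_-$, $E=\partial_{\psi_-}$,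 $\delta=(0,1)$, $(h',f')=(h+1,f-1)$; 2. $h=f$, $\mathcal P=d_+$, $E=\partial_{\psi_+}+2\psi_-\partial_x$, $\delta=(0,1)$, $(h',f')=(h+1,f+1)$; 3. $h=-n$ and $f\ne n$ for an integer $n\ge1$, $\mathcal P=A_+^n+\frac n{f-n}A_+^{n-1}d_+d_-$, $E=\bigl[\partial_x+\frac n{f-n}(\partial_{\psi_+}+2\psi_-\partial_x)\partial_{\psi_-}\bigr]\partial_x^{\,n-1}$, $\delta=(0,0)$, $(h',f')=(h+2n,f)$. Then $\mathcal P|h,f\rangle$ is a singular vector of $M(h,f)$ of weight $(h',f')$; $\pi_R(\mathcal P)=E$; for each basis vector $X$ of $\mathfrak g$ above, $E\,\pi_L^{h,f}(X)=(-1)^{\delta\cdot\deg X}\pi_L^{h',f'}(X)\,E$; and the equation $E\varphi=0$ is invariant under the color supergroup generated by $\mathfrak g$, in the sense that the algebra of operators generated by all $\pi_L^{h,f}(X)$, $X\in\mathfrak g$, and by left multiplication by $\zeta$ maps solutions of $E\varphi=0$ to solutions. (4) Other variables. Let $\psi,\theta$ be graded Grassmann variables of degrees $(0,1)$ and $(1,0)$.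 The substitution $\psi_\pm=\frac1{\sqrt2}(\psi\pm\zeta\theta)$ is a bijection from functions of $(x,\psi_+,\psi_-)$ onto functions of $(x,\psi,\theta)$ (with coefficients again involving $\zeta$), and under it the three equations $E\varphi=0$ are equivalent, respectively, to $$(\partial_\psi+\zeta\partial_\theta)\varphi=0,\qquad \bigl[\partial_\psi-\zeta\partial_\theta+2(\psi-\zeta\theta)\partial_x\bigr]\varphi=0,$$ $$\Bigl[\partial_x+\tfrac n{f-n}\bigl(\psi\partial_\psi+\theta\partial_\theta-\zeta(\psi\partial_\theta+\theta\partial_\psi)\bigr)\partial_x-\tfrac{n\zeta}{f-n}\partial_\psi\partial_\theta\Bigr]\partial_x^{\,n-1}\varphi=0.$$ -/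

import Mathlib

open scoped ContDiff

noncomputable section

namespace ColorSuper

/-! ### The grading group and commutation signs -/

/-- The grading group `ℤ₂ × ℤ₂`. -/
abbrev Grade : Type := ZMod 2 × ZMod 2

/-- The commutation sign `(-1)^(α·β)`, where `α·β = α₁β₁ + α₂β₂`. -/
def csign (α β : Grade) : ℤ :=
  (-1) ^ (α.1.val * β.1.val + α.2.val * β.2.val)

/-- Completion of a table of brackets `t X Y = ∑ Z, t X Y Z • Z`, in which every unordered pair
is listed at most once, by the rule `⟦X, Y⟧ = -(-1)^(deg X · deg Y) ⟦Y, X⟧`. -/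
def completeTable {G : Type} [DecidableEq G] (deg : G → Grade) (t : G → G → G → ℤ)
    (X Y Z : G) : ℤ :=
  if X = Y then t X X Z else t X Y Z - csign (deg X) (deg Y) * t Y X Z

/-! ### The color superalgebra `𝔤` -/

/-- The basis `A₋, A₊, N, b₋, b₊, a₋, a₊, F` of `𝔤`. -/
inductive Gen : Type
  | Am | Ap | N | bm | bp | am | ap | F
  deriving DecidableEq

instance : Fintype Gen :=
  ⟨{.Am, .Ap, .N, .bm, .bp, .am, .ap, .F}, fun X => by cases X <;> decide⟩

/-- The degrees of the basis vectors of `𝔤`. -/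
def Gen.deg : Gen → Grade
  | .Am => (0, 0) | .Ap => (0, 0) | .N => (0, 0)
  | .bm => (1, 0) | .bp => (1, 0)
  | .am => (0, 1) | .ap => (0, 1)
  | .F => (1, 1)

/-- The non-vanishing defining relations of `𝔤`, each listed for one order of its arguments. -/
def Gen.table : Gen → Gen → Gen → ℤ
  | .Am, .Ap, .N => 4
  | .Am, .N, .Am => 2
  | .Ap, .N, .Ap => -2
  | .Am, .bp, .bm => 2
  | .Ap, .bm, .bp => -2
  | .N, .bm, .bm => -1
  | .N, .bp, .bp => 1
  | .Am, .ap, .am => 2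
  | .Ap, .am, .ap => -2
  | .N, .am, .am => -1
  | .N, .ap, .ap => 1
  | .bm, .bm, .Am => 2
  | .bm, .bp, .N => 2
  | .bp, .bp, .Ap => 2
  | .bm, .ap, .F => 1
  | .bp, .am, .F => -1
  | .bm, .F, .am => 2
  | .bp, .F, .ap => 2
  | .am, .am, .Am => 2
  | .am, .ap, .N => 2
  | .ap, .ap, .Ap => 2
  | .am, .F, .bm => 2
  | .ap, .F, .bp => 2
  | _, _, _ => 0

/-- Structure constants of `𝔤`: `⟦X, Y⟧ = ∑ Z, Gen.sc X Y Z • Z`. -/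
def Gen.sc : Gen → Gen → Gen → ℤ := completeTable Gen.deg Gen.table

/-! ### Functions of `x` and of graded Grassmann variables -/

/-- The algebra of smooth functions `ℝ → 𝕜`, as a subalgebra of all functions. -/
def smoothSubalgebra (𝕜 : Type*) [RCLike 𝕜] : Subalgebra 𝕜 (ℝ → 𝕜) where
  carrier := {g | ContDiff ℝ ∞ g}
  mul_mem' {a b} ha hb := by
    have ha' : ContDiff ℝ ∞ a := ha
    have hb' : ContDiff ℝ ∞ b := hb
    exact ha'.mul hb'
  add_mem' {a b} ha hb := by
    have ha' : ContDiff ℝ ∞ a := ha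
    have hb' : ContDiff ℝ ∞ b := hb
    exact ha'.add hb'
  algebraMap_mem' c := (contDiff_const : ContDiff ℝ ∞ fun _ : ℝ => c)

/-- Smooth functions of the real variable `x` with values in `𝕜`. -/
def Smooth (𝕜 : Type*) [RCLike 𝕜] : Type _ := smoothSubalgebra 𝕜

namespace Smooth

variable {𝕜 : Type*} [RCLike 𝕜]

instance : CommRing (Smooth 𝕜) := inferInstanceAs (CommRing (smoothSubalgebra 𝕜))

instance : Algebra 𝕜 (Smooth 𝕜) := inferInstanceAs (Algebra 𝕜 (smoothSubalgebra 𝕜))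

/-- The underlying function. -/
def toFun (g : Smooth 𝕜) : ℝ → 𝕜 := Subtype.val (p := fun k => k ∈ smoothSubalgebra 𝕜) g

lemma contDiff (g : Smooth 𝕜) : ContDiff ℝ ∞ g.toFun :=
  Subtype.property (p := fun k => k ∈ smoothSubalgebra 𝕜) g

/-- A smooth function as an element of `Smooth 𝕜`. -/
def mk (g : ℝ → 𝕜) (hg : ContDiff ℝ ∞ g) : Smooth 𝕜 :=
  (⟨g, hg⟩ : {k : ℝ → 𝕜 // k ∈ smoothSubalgebra 𝕜})

lemma ext {g k : Smooth 𝕜} (h : ∀ x, g.toFun x = k.toFun x) : g = k := Subtype.ext (funext h)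

@[simp] lemma toFun_mk (g : ℝ → 𝕜) (hg : ContDiff ℝ ∞ g) : (mk g hg).toFun = g := rfl

lemma toFun_add (g k : Smooth 𝕜) : (g + k).toFun = g.toFun + k.toFun := rfl

lemma toFun_mul (g k : Smooth 𝕜) : (g * k).toFun = g.toFun * k.toFun := rfl

lemma toFun_smul (c : 𝕜) (g : Smooth 𝕜) : (c • g).toFun = c • g.toFun := rfl

lemma differentiable (g : Smooth 𝕜) : Differentiable ℝ g.toFun :=
  (contDiff_infty_iff_deriv.1 g.contDiff).1

variable (𝕜) in
/-- The derivative with respect to `x`. -/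
def D : Smooth 𝕜 →ₗ[𝕜] Smooth 𝕜 where
  toFun g := mk (deriv g.toFun) (contDiff_infty_iff_deriv.1 g.contDiff).2
  map_add' g k := ext fun x => deriv_add (g.differentiable x) (k.differentiable x)
  map_smul' c g := ext fun x => deriv_const_smul c (g.differentiable x)

variable (𝕜) in
/-- The coordinate function `x`. -/
def x : Smooth 𝕜 := mk (fun x => (x : 𝕜)) ((RCLike.ofRealCLM (K := 𝕜)).contDiff (n := ∞))

end Smooth

/-- Exponents `(i, j, k)` of the monomials `ζ^i η₁^j η₂^k`. -/
abbrev Mon : Type := Fin 2 × Fin 2 × Fin 2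

/-- Degree of `ζ^i η₁^j η₂^k`, where `ζ, η₁, η₂` have degrees `(1,1), α, β`. -/
def mdeg (α β : Grade) (I : Mon) : Grade :=
  (I.1 : ℕ) • ((1, 1) : Grade) + (I.2.1 : ℕ) • α + (I.2.2 : ℕ) • β

/-- The coefficient of `ζ^K.1 η₁^K.2.1 η₂^K.2.2` in the product of the monomials with exponents
`I` and `J`: it is computed from `ζ² = 1`, `η₁² = η₂² = 0`, `η₁ ζ = (-1)^(α·(1,1)) ζ η₁`,
`η₂ ζ = (-1)^(β·(1,1)) ζ η₂` and `η₂ η₁ = (-1)^(α·β) η₁ η₂`. -/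
def mcoef (α β : Grade) (I J K : Mon) : ℤ :=
  if K.1 = I.1 + J.1 ∧ (K.2.1 : ℕ) = I.2.1 + J.2.1 ∧ (K.2.2 : ℕ) = I.2.2 + J.2.2 then
    csign α (1, 1) ^ ((I.2.1 : ℕ) * J.1) * csign β (1, 1) ^ ((I.2.2 : ℕ) * J.1) *
      csign α β ^ ((I.2.2 : ℕ) * J.2.1)
  else 0

/-- Functions `φ = ∑ ζ^i η₁^j η₂^k φ_{ijk}(x)` of a real variable `x` and of two graded
Grassmann variables `η₁`, `η₂` of degrees `α`, `β ∈ {(0,1), (1,0)}`, with coefficients that may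
involve the graded Grassmann number `ζ` of degree `(1,1)` with `ζ² = 1`.
The function is stored as the family of its components `φ_{ijk}`. -/
def SFn (𝕜 : Type*) [RCLike 𝕜] (_α _β : Grade) : Type _ := Mon → Smooth 𝕜

namespace SFn

variable {𝕜 : Type*} [RCLike 𝕜] {α β : Grade}

instance : AddCommGroup (SFn 𝕜 α β) := inferInstanceAs (AddCommGroup (Mon → Smooth 𝕜))

instance : Module 𝕜 (SFn 𝕜 α β) := inferInstanceAs (Module 𝕜 (Mon → Smooth 𝕜))

/-- Multiplication by an ordinary function of `x`. -/
instance : Module (Smooth 𝕜) (SFn 𝕜 α β) := inferInstanceAs (Module (Smooth 𝕜) (Mon → Smooth 𝕜))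

/-- The color-commutative product. -/
instance : Mul (SFn 𝕜 α β) :=
  ⟨fun u v K => ∑ I, ∑ J, mcoef α β I J K • (u I * v J)⟩

lemma mul_apply (u v : SFn 𝕜 α β) (K : Mon) :
    (u * v) K = ∑ I, ∑ J, mcoef α β I J K • (u I * v J) := rfl

@[simp] lemma add_apply (u v : SFn 𝕜 α β) (K : Mon) : (u + v) K = u K + v K := rfl

@[simp] lemma smul_apply (c : 𝕜) (u : SFn 𝕜 α β) (K : Mon) : (c • u) K = c • u K := rfl

@[simp] lemma zero_apply (K : Mon) : (0 : SFn 𝕜 α β) K = 0 := rfl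

@[simp] lemma sub_apply (u v : SFn 𝕜 α β) (K : Mon) : (u - v) K = u K - v K := rfl

@[simp] lemma neg_apply (u : SFn 𝕜 α β) (K : Mon) : (-u) K = -u K := rfl

/-- The monomial with exponents `I`. -/
def mono (I : Mon) : SFn 𝕜 α β := fun J => if J = I then 1 else 0

instance : One (SFn 𝕜 α β) := ⟨mono (0, 0, 0)⟩

/-- The graded Grassmann number `ζ`. -/
def zeta : SFn 𝕜 α β := mono (1, 0, 0)

/-- The variable `η₁`. -/
def eta1 : SFn 𝕜 α β := mono (0, 1, 0)

/-- The variable `η₂`. -/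
def eta2 : SFn 𝕜 α β := mono (0, 0, 1)

/-- The variable `x`. -/
def coordX : SFn 𝕜 α β := Smooth.x 𝕜 • (1 : SFn 𝕜 α β)

/-- The sign automorphism `u ↦ (-1)^(γ · deg u) u`. -/
def twist (γ : Grade) (u : SFn 𝕜 α β) : SFn 𝕜 α β := fun I => csign γ (mdeg α β I) • u I

/-- The operator of left multiplication by `u`. -/
def mulL (u : SFn 𝕜 α β) : Module.End 𝕜 (SFn 𝕜 α β) where
  toFun v := u * v
  map_add' v w := by
    funext K
    simp only [mul_apply, add_apply, mul_add, smul_add, Finset.sum_add_distrib]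
  map_smul' c v := by
    funext K
    simp only [mul_apply, smul_apply, mul_smul_comm, Finset.smul_sum, RingHom.id_apply]
    refine Finset.sum_congr rfl fun I _ => Finset.sum_congr rfl fun J _ => ?_
    exact smul_comm _ _ _

/-- `∂/∂x` as a map. -/
def dxFun (u : SFn 𝕜 α β) : SFn 𝕜 α β := fun I => Smooth.D 𝕜 (u I)

lemma dxFun_apply (u : SFn 𝕜 α β) (I : Mon) : dxFun u I = Smooth.D 𝕜 (u I) := rfl

/-- `∂/∂x`. -/
def dx : Module.End 𝕜 (SFn 𝕜 α β) where
  toFun := dxFun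
  map_add' u v := by funext I; simp only [dxFun_apply, add_apply, map_add]
  map_smul' c u := by
    funext I; simp only [dxFun_apply, smul_apply, map_smul, RingHom.id_apply]

/-- The left derivative `∂/∂η₁`, of degree `α`, as a map:
`∂(ζ^i η₁ η₂^k) = (-1)^(α · deg ζ^i) ζ^i η₂^k` and `∂(ζ^i η₂^k) = 0`. -/
def d1Fun (u : SFn 𝕜 α β) : SFn 𝕜 α β := fun I =>
  if I.2.1 = 0 then csign α (mdeg α β (I.1, 0, 0)) • u (I.1, 1, I.2.2) else 0

lemma d1Fun_apply (u : SFn 𝕜 α β) (I : Mon) : d1Fun u I =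
    if I.2.1 = 0 then csign α (mdeg α β (I.1, 0, 0)) • u (I.1, 1, I.2.2) else 0 := rfl

/-- The left derivative `∂/∂η₁`. -/
def d1 : Module.End 𝕜 (SFn 𝕜 α β) where
  toFun := d1Fun
  map_add' u v := by
    funext I
    simp only [d1Fun_apply, add_apply]
    split_ifs <;> simp only [smul_add, add_zero]
  map_smul' c u := by
    funext I
    simp only [d1Fun_apply, smul_apply, RingHom.id_apply]
    split_ifs
    · exact smul_comm _ _ _
    · exact (smul_zero c).symm

/-- The left derivative `∂/∂η₂`, of degree `β`, as a map:
`∂(ζ^i η₁^j η₂) = (-1)^(β · deg (ζ^i η₁^j)) ζ^i η₁^j` and `∂(ζ^i η₁^j) = 0`. -/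
def d2Fun (u : SFn 𝕜 α β) : SFn 𝕜 α β := fun I =>
  if I.2.2 = 0 then csign β (mdeg α β (I.1, I.2.1, 0)) • u (I.1, I.2.1, 1) else 0

lemma d2Fun_apply (u : SFn 𝕜 α β) (I : Mon) : d2Fun u I =
    if I.2.2 = 0 then csign β (mdeg α β (I.1, I.2.1, 0)) • u (I.1, I.2.1, 1) else 0 := rfl

/-- The left derivative `∂/∂η₂`. -/
def d2 : Module.End 𝕜 (SFn 𝕜 α β) where
  toFun := d2Fun
  map_add' u v := by
    funext I
    simp only [d2Fun_apply, add_apply]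
    split_ifs <;> simp only [smul_add, add_zero]
  map_smul' c u := by
    funext I
    simp only [d2Fun_apply, smul_apply, RingHom.id_apply]
    split_ifs
    · exact smul_comm _ _ _
    · exact (smul_zero c).symm

end SFn

/-- Functions `φ(x, ψ₊, ψ₋)`, with `ψ₊` (first) and `ψ₋` (second) of degree `(0,1)`. -/
abbrev OPM (𝕜 : Type*) [RCLike 𝕜] : Type _ := SFn 𝕜 (0, 1) (0, 1)

/-- Functions `φ(x, ψ, θ)`, with `ψ` (first) of degree `(0,1)` and `θ` (second) of
degree `(1,0)`. -/
abbrev OPT (𝕜 : Type*) [RCLike 𝕜] : Type _ := SFn 𝕜 (0, 1) (1, 0)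

/-- The scalar `1/√2`. -/
def invSqrtTwo (𝕜 : Type*) [RCLike 𝕜] : 𝕜 := ((Real.sqrt 2 : ℝ) : 𝕜)⁻¹

/-! ### `𝔤` with Grassmann coefficients -/

section Group

variable (𝕜 : Type*) [RCLike 𝕜]

/-- The color tensor product of the algebra of functions of `x, ψ₊, ψ₋` (and `ζ`) with `𝔤`;
`V` stands for `∑ X, V X ⊗ X`. -/
abbrev Ext : Type _ := Gen → OPM 𝕜

variable {𝕜}

/-- The element `u X` of `Ext`. -/
def Ext.mk (u : OPM 𝕜) (X : Gen) : Ext 𝕜 := Pi.single X u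

/-- Left multiplication by a function. -/
def Ext.lmul (u : OPM 𝕜) (V : Ext 𝕜) : Ext 𝕜 := fun X => u * V X

/-- Right multiplication by a function: `X u = (-1)^(deg X · deg u) u X`. -/
def Ext.rmul (V : Ext 𝕜) (u : OPM 𝕜) : Ext 𝕜 := fun X => V X * SFn.twist X.deg u

/-- The graded bracket `⟦u X, v Y⟧ = (-1)^(deg X · deg v) u v ⟦X, Y⟧`. -/
def Ext.bracket (U V : Ext 𝕜) : Ext 𝕜 :=
  fun Z => ∑ X, ∑ Y, Gen.sc X Y Z • (U X * SFn.twist X.deg (V Y))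

/-- The inclusion of `𝔤` (coordinates in the basis `Gen`) into `Ext`. -/
def Ext.ofAlg (X : Gen → 𝕜) : Ext 𝕜 := fun Z => X Z • (1 : OPM 𝕜)

open SFn Ext

/-- `c₊ = (a₋ + b₋ ζ)/√2`. -/
def cPlus : Ext 𝕜 := invSqrtTwo 𝕜 • (mk 1 .am + rmul (mk 1 .bm) zeta)

/-- `c₋ = (a₋ - b₋ ζ)/√2`. -/
def cMinus : Ext 𝕜 := invSqrtTwo 𝕜 • (mk 1 .am - rmul (mk 1 .bm) zeta)

/-- `d₊ = (a₊ + ζ b₊)/√2`. -/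
def dPlus : Ext 𝕜 := invSqrtTwo 𝕜 • (mk 1 .ap + mk zeta .bp)

/-- `d₋ = (a₊ - ζ b₊)/√2`. -/
def dMinus : Ext 𝕜 := invSqrtTwo 𝕜 • (mk 1 .ap - mk zeta .bp)

/-- `F̃ = ζ F/2`. -/
def Ftilde : Ext 𝕜 := (2⁻¹ : 𝕜) • mk zeta .F

/-- `Ad(exp Z) V = ∑ k, (ad Z)^k V / k!`, for nilpotent `ad Z` (the sum is then finite). -/
def expAd (Z V : Ext 𝕜) : Ext 𝕜 :=
  ∑ᶠ k : ℕ, ((k.factorial : 𝕜)⁻¹) • ((bracket Z)^[k] V)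

/-- `Ad(g₊⁻¹)` for `g₊ = exp(x A₊) exp(ψ₊ d₊) exp(ψ₋ d₋)`. -/
def adInv (V : Ext 𝕜) : Ext 𝕜 :=
  expAd (-lmul eta2 dMinus) (expAd (-lmul eta1 dPlus) (expAd (-mk coordX .Ap) V))

/-- `g₊⁻¹ ∂g₊/∂x` for `g₊ = exp(x A₊) exp(ψ₊ d₊) exp(ψ₋ d₋)`
(the last two factors commute with `A₊`). -/
def mcX : Ext 𝕜 := expAd (-lmul eta2 dMinus) (expAd (-lmul eta1 dPlus) (mk 1 .Ap))

/-- `g₊⁻¹ ∂g₊/∂ψ₊ = Ad(exp(-ψ₋ d₋)) d₊`. -/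
def mcPlus : Ext 𝕜 := expAd (-lmul eta2 dMinus) dPlus

/-- `g₊⁻¹ ∂g₊/∂ψ₋ = d₋`. -/
def mcMinus : Ext 𝕜 := dMinus

/-! First order coordinates `ξ, η₊, η₋, u, w` of `V` in `Ext`, defined by
`V = ξ (g₊⁻¹ ∂g₊/∂x) + η₊ (g₊⁻¹ ∂g₊/∂ψ₊) + η₋ (g₊⁻¹ ∂g₊/∂ψ₋) + u N + w F̃ + Y`,
where `Y` is a combination of `A₋, c₊, c₋`. To first order in `τ` this says
`g₊(x, ψ₊, ψ₋) exp(τ V) =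
  g₊(x + τ ξ, ψ₊ + τ η₊, ψ₋ + τ η₋) exp(τ (u N + w F̃)) exp(τ Y)`. -/

/-- The component along `∂/∂ψ₊`. -/
def coordPlus (V : Ext 𝕜) : OPM 𝕜 := invSqrtTwo 𝕜 • (V .ap + V .bp * zeta)

/-- The component along `∂/∂ψ₋`. -/
def coordMinus (V : Ext 𝕜) : OPM 𝕜 := invSqrtTwo 𝕜 • (V .ap - V .bp * zeta)

/-- The component along `∂/∂x`. -/
def coordXi (V : Ext 𝕜) : OPM 𝕜 := V .Ap + (2 : 𝕜) • (coordPlus V * eta2)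

/-- The component along `N`. -/
def coordN (V : Ext 𝕜) : OPM 𝕜 := V .N

/-- The component along `F̃`. -/
def coordF (V : Ext 𝕜) : OPM 𝕜 := (2 : 𝕜) • (V .F * zeta)

/-- The right action `φ ↦ d/dτ φ(g₊ exp(τ V))` at `τ = 0` on functions with
`φ(g g₀ g₋) = exp(Λ(H)) φ(g)` for `g₀ = exp H`, where `Λ(N) = h` and `Λ(F̃) = f`; the
result is restricted to `𝒢₊`, i.e. written as a function of `x, ψ₊, ψ₋`. -/
def rightAct (h f : 𝕜) (V : Ext 𝕜) : Module.End 𝕜 (OPM 𝕜) :=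
  mulL (coordXi V) * dx + mulL (coordPlus V) * d1 + mulL (coordMinus V) * d2
    + h • mulL (coordN V) + f • mulL (coordF V)

/-- The left action `π_L(X) φ(g₊) = d/dτ φ(exp(-τ X) g₊)` at `τ = 0` of `X ∈ 𝔤` on the same
functions, computed from `exp(-τ X) g₊ = g₊ exp(-τ Ad(g₊⁻¹) X)`. -/
def leftAct (h f : 𝕜) (X : Gen → 𝕜) : Module.End 𝕜 (OPM 𝕜) :=
  rightAct h f (-adInv (ofAlg X))

end Group

/-! ### Enveloping algebras -/

/-- The relations `X Y = (-1)^(deg X · deg Y) Y X + ⟦X, Y⟧`. -/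
inductive EnvRel (𝕜 : Type*) [RCLike 𝕜] {G : Type} [Fintype G] (deg : G → Grade)
    (sc : G → G → G → ℤ) : FreeAlgebra 𝕜 G → FreeAlgebra 𝕜 G → Prop
  | rel (X Y : G) : EnvRel 𝕜 deg sc (FreeAlgebra.ι 𝕜 X * FreeAlgebra.ι 𝕜 Y)
      ((csign (deg X) (deg Y) : 𝕜) • (FreeAlgebra.ι 𝕜 Y * FreeAlgebra.ι 𝕜 X)
        + ∑ Z, (sc X Y Z : 𝕜) • FreeAlgebra.ι 𝕜 Z)

/-- The universal enveloping algebra over `𝕜` of the graded superalgebra with basis `G`, degrees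
`deg` and structure constants `sc`. -/
def Env (𝕜 : Type*) [RCLike 𝕜] {G : Type} [Fintype G] (deg : G → Grade)
    (sc : G → G → G → ℤ) : Type _ := RingQuot (EnvRel 𝕜 deg sc)

namespace Env

variable (𝕜 : Type*) [RCLike 𝕜] {G : Type} [Fintype G] (deg : G → Grade) (sc : G → G → G → ℤ)

instance : Ring (Env 𝕜 deg sc) := inferInstanceAs (Ring (RingQuot (EnvRel 𝕜 deg sc)))

instance : Algebra 𝕜 (Env 𝕜 deg sc) :=
  inferInstanceAs (Algebra 𝕜 (RingQuot (EnvRel 𝕜 deg sc)))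

/-- The quotient map from the free algebra. -/
def mkHom : FreeAlgebra 𝕜 G →ₐ[𝕜] Env 𝕜 deg sc := RingQuot.mkAlgHom 𝕜 (EnvRel 𝕜 deg sc)

/-- The generator `X` of the enveloping algebra. -/
def gen (X : G) : Env 𝕜 deg sc := mkHom 𝕜 deg sc (FreeAlgebra.ι 𝕜 X)

lemma gen_mul_gen (X Y : G) :
    gen 𝕜 deg sc X * gen 𝕜 deg sc Y =
      (csign (deg X) (deg Y) : 𝕜) • (gen 𝕜 deg sc Y * gen 𝕜 deg sc X)
        + ∑ Z, (sc X Y Z : 𝕜) • gen 𝕜 deg sc Z := by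
  have h : mkHom 𝕜 deg sc _ = mkHom 𝕜 deg sc _ :=
    RingQuot.mkAlgHom_rel 𝕜 (EnvRel.rel (𝕜 := 𝕜) (deg := deg) (sc := sc) X Y)
  simp only [map_mul, map_add, map_sum, map_smul] at h
  exact h

variable {𝕜 deg sc}

/-- The universal property of the enveloping algebra. -/
def lift {B : Type*} [Ring B] [Algebra 𝕜 B] (m : G → B)
    (hm : ∀ X Y, m X * m Y =
      (csign (deg X) (deg Y) : 𝕜) • (m Y * m X) + ∑ Z, (sc X Y Z : 𝕜) • m Z) :
    Env 𝕜 deg sc →ₐ[𝕜] B :=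
  RingQuot.liftAlgHom 𝕜 ⟨FreeAlgebra.lift 𝕜 m, by
    rintro _ _ ⟨X, Y⟩
    simpa only [map_mul, map_add, map_sum, map_smul, FreeAlgebra.lift_ι_apply] using hm X Y⟩

lemma lift_gen {B : Type*} [Ring B] [Algebra 𝕜 B] (m : G → B)
    (hm : ∀ X Y, m X * m Y =
      (csign (deg X) (deg Y) : 𝕜) • (m Y * m X) + ∑ Z, (sc X Y Z : 𝕜) • m Z) (X : G) :
    lift m hm (gen 𝕜 deg sc X) = m X := by
  change RingQuot.liftAlgHom 𝕜 _ (RingQuot.mkAlgHom 𝕜 _ _) = _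
  rw [RingQuot.liftAlgHom_mkAlgHom_apply, FreeAlgebra.lift_ι_apply]

end Env

/-! ### The superalgebra with basis `A₋, A₊, N, F̃, c₊, c₋, d₊, d₋` and its Verma modules -/

/-- The new basis of `𝔤`. -/
inductive SGen : Type
  | Am | Ap | N | Ft | cp | cm | dp | dm
  deriving DecidableEq

instance : Fintype SGen :=
  ⟨{.Am, .Ap, .N, .Ft, .cp, .cm, .dp, .dm}, fun X => by cases X <;> decide⟩

/-- Degrees in the new basis. -/
def SGen.deg : SGen → Grade
  | .Am => (0, 0) | .Ap => (0, 0) | .N => (0, 0) | .Ft => (0, 0)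
  | .cp => (0, 1) | .cm => (0, 1) | .dp => (0, 1) | .dm => (0, 1)

/-- The non-vanishing brackets of the new basis, each listed for one order of its arguments. -/
def SGen.table : SGen → SGen → SGen → ℤ
  | .Am, .Ap, .N => 4
  | .Am, .N, .Am => 2
  | .Ap, .N, .Ap => -2
  | .N, .cp, .cp => -1
  | .N, .cm, .cm => -1
  | .N, .dp, .dp => 1
  | .N, .dm, .dm => 1
  | .Am, .dp, .cm => 2
  | .Am, .dm, .cp => 2
  | .Ap, .cp, .dm => -2
  | .Ap, .cm, .dp => -2
  | .cp, .cm, .Am => 2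
  | .dp, .dm, .Ap => 2
  | .cp, .dp, .N => 2
  | .cp, .dp, .Ft => -2
  | .cm, .dm, .N => 2
  | .cm, .dm, .Ft => 2
  | .Ft, .cp, .cp => -1
  | .Ft, .cm, .cm => 1
  | .Ft, .dp, .dp => 1
  | .Ft, .dm, .dm => -1
  | _, _, _ => 0

/-- Structure constants in the new basis. -/
def SGen.sc : SGen → SGen → SGen → ℤ := completeTable SGen.deg SGen.table

/-- The new basis vectors as elements of `𝔤` with Grassmann coefficients. -/
def SGen.toExt {𝕜 : Type*} [RCLike 𝕜] : SGen → Ext 𝕜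
  | .Am => Ext.mk 1 .Am | .Ap => Ext.mk 1 .Ap | .N => Ext.mk 1 .N | .Ft => Ftilde
  | .cp => cPlus | .cm => cMinus | .dp => dPlus | .dm => dMinus

/-- The basis `A₊, d₊, d₋` of `𝔤₊`. -/
inductive PGen : Type
  | Ap | dp | dm
  deriving DecidableEq

instance : Fintype PGen :=
  ⟨{.Ap, .dp, .dm}, fun X => by cases X <;> decide⟩

/-- The inclusion of the basis of `𝔤₊` into the one of `𝔤`. -/
def PGen.toS : PGen → SGen
  | .Ap => .Ap | .dp => .dp | .dm => .dm

/-- Degrees of the basis of `𝔤₊`. -/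
def PGen.deg (X : PGen) : Grade := X.toS.deg

/-- Structure constants of `𝔤₊`. -/
def PGen.sc (X Y Z : PGen) : ℤ := SGen.sc X.toS Y.toS Z.toS

section Verma

variable (𝕜 : Type*) [RCLike 𝕜]

/-- The enveloping algebra of the superalgebra in the new basis. -/
abbrev USuper : Type _ := Env 𝕜 SGen.deg SGen.sc

/-- The enveloping algebra `U(𝔤₊)`. -/
abbrev UPlus : Type _ := Env 𝕜 PGen.deg PGen.sc

/-- Generators of `USuper`. -/
abbrev sgen (X : SGen) : USuper 𝕜 := Env.gen 𝕜 SGen.deg SGen.sc X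

/-- Generators of `U(𝔤₊)`. -/
abbrev pgen (X : PGen) : UPlus 𝕜 := Env.gen 𝕜 PGen.deg PGen.sc X

/-- The natural homomorphism from `U(𝔤₊)` into the whole enveloping algebra. -/
def UPlus.incl : UPlus 𝕜 →ₐ[𝕜] USuper 𝕜 :=
  Env.lift (fun X => sgen 𝕜 X.toS) (by
    intro X Y
    have h := Env.gen_mul_gen 𝕜 SGen.deg SGen.sc X.toS Y.toS
    rw [sgen, sgen, h]
    congr 1
    have hz : ∀ X Y : PGen, ∀ Z : SGen, Z ∉ Finset.univ.image PGen.toS →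
        SGen.sc X.toS Y.toS Z = 0 := by decide
    have hinj : Function.Injective PGen.toS := by decide
    rw [← Finset.sum_subset (Finset.subset_univ (Finset.univ.image PGen.toS))
      (fun Z _ hZ => by rw [hz X Y Z hZ, Int.cast_zero, zero_smul]),
      Finset.sum_image (fun a _ b _ e => hinj e)]
    rfl)

variable {𝕜}

/-- The left ideal generated by `c₊, c₋, N - h, F̃ - f`. -/
def vermaIdeal (h f : 𝕜) : Submodule (USuper 𝕜) (USuper 𝕜) :=
  Submodule.span (USuper 𝕜) {sgen 𝕜 .cp, sgen 𝕜 .cm, sgen 𝕜 .N - algebraMap 𝕜 _ h,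
    sgen 𝕜 .Ft - algebraMap 𝕜 _ f}

/-- The Verma module `M(h, f)`. -/
abbrev Verma (h f : 𝕜) : Type _ := USuper 𝕜 ⧸ vermaIdeal h f

/-- The lowest weight vector `|h, f⟩`. -/
def Verma.vac (h f : 𝕜) : Verma h f := Submodule.Quotient.mk 1

/-- `v` is a singular vector of `M(h, f)` of weight `(h', f')`: it is not a multiple of `|h, f⟩`
(in particular it is not zero), it is a weight vector, and `𝔤₋` annihilates it. -/
def IsSingularVector (h f h' f' : 𝕜) (v : Verma h f) : Prop :=
  (∀ a : 𝕜, v ≠ algebraMap 𝕜 (USuper 𝕜) a • Verma.vac h f) ∧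
  sgen 𝕜 .N • v = algebraMap 𝕜 (USuper 𝕜) h' • v ∧
  sgen 𝕜 .Ft • v = algebraMap 𝕜 (USuper 𝕜) f' • v ∧
  sgen 𝕜 .Am • v = 0 ∧ sgen 𝕜 .cp • v = 0 ∧ sgen 𝕜 .cm • v = 0

end Verma

/-! ### Differential operators -/

open SFn

section Ops

variable {𝕜 : Type*} [RCLike 𝕜]

/-- `∂/∂ψ₊ + 2 ψ₋ ∂/∂x`. -/
def nabla : Module.End 𝕜 (OPM 𝕜) := d1 + (2 : 𝕜) • (mulL eta2 * dx)

lemma val_one2 : ZMod.val (1 : ZMod 2) = 1 := rfl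

lemma one_add_one2 : (1 : ZMod 2) + 1 = 0 := rfl

lemma eta2_mul_apply (u : OPM 𝕜) (I : Mon) : (eta2 * u : OPM 𝕜) I =
    if I.2.2 = 0 then 0
    else csign (0, 1) (mdeg (0, 1) (0, 1) (I.1, I.2.1, 0)) • u (I.1, I.2.1, 0) := by
  obtain ⟨i, j, k⟩ := I
  fin_cases i <;> fin_cases j <;> fin_cases k <;>
  simp [mul_apply, eta2, mono, Fintype.sum_prod_type, Fin.sum_univ_two, mcoef, csign, mdeg,
    val_one2, one_add_one2]

lemma nabla_apply (u : OPM 𝕜) (I : Mon) :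
    nabla u I = d1Fun u I + (2 : 𝕜) • (eta2 * dxFun u : OPM 𝕜) I := rfl

lemma nabla_nabla (u : OPM 𝕜) : nabla (nabla u) = 0 := by
  funext ⟨i, j, k⟩
  simp only [nabla_apply, dxFun_apply, d1Fun_apply, eta2_mul_apply]
  fin_cases i <;> fin_cases j <;> fin_cases k <;>
  simp [csign, mdeg, val_one2, one_add_one2]

lemma d2_d2 (u : OPM 𝕜) : d2 (d2 u) = 0 := by
  funext ⟨i, j, k⟩
  change d2Fun (d2Fun u) _ = 0
  simp only [d2Fun_apply]
  fin_cases i <;> fin_cases j <;> fin_cases k <;>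
  simp [csign, mdeg, val_one2, one_add_one2]

lemma d2_nabla (u : OPM 𝕜) : d2 (nabla u) + nabla (d2 u) = (2 : 𝕜) • dx u := by
  funext ⟨i, j, k⟩
  change d2Fun (nabla u) _ + nabla (d2Fun u) _ = (2 : 𝕜) • dxFun u _
  simp only [d2Fun_apply, nabla_apply, dxFun_apply, d1Fun_apply, eta2_mul_apply]
  fin_cases i <;> fin_cases j <;> fin_cases k <;>
  simp [csign, mdeg, val_one2, one_add_one2]

lemma d2_dx (u : OPM 𝕜) : d2 (dx u) = dx (d2 u) := by
  funext ⟨i, j, k⟩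
  change d2Fun (dxFun u) _ = dxFun (d2Fun u) _
  simp only [d2Fun_apply, dxFun_apply]
  fin_cases i <;> fin_cases j <;> fin_cases k <;>
  simp [csign, mdeg, val_one2, one_add_one2]

lemma nabla_dx (u : OPM 𝕜) : nabla (dx u) = dx (nabla u) := by
  funext ⟨i, j, k⟩
  change nabla (dxFun u) _ = dxFun (nabla u) _
  simp only [nabla_apply, dxFun_apply, d1Fun_apply, eta2_mul_apply]
  fin_cases i <;> fin_cases j <;> fin_cases k <;>
  simp [csign, mdeg, val_one2, one_add_one2]

/-- The right action of the basis of `𝔤₊`. -/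
def PGen.op : PGen → Module.End 𝕜 (OPM 𝕜)
  | .Ap => dx | .dp => nabla | .dm => d2

variable (𝕜) in
/-- The right action of `U(𝔤₊)` by differential operators. -/
def piR : UPlus 𝕜 →ₐ[𝕜] Module.End 𝕜 (OPM 𝕜) :=
  Env.lift PGen.op (by
    have hs : ∀ X Y : PGen, ∑ Z, (PGen.sc X Y Z : 𝕜) • (PGen.op Z : Module.End 𝕜 (OPM 𝕜)) =
        (PGen.sc X Y .Ap : 𝕜) • dx + ((PGen.sc X Y .dp : 𝕜) • nabla
          + (PGen.sc X Y .dm : 𝕜) • d2) := by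
      intro X Y
      have hu : (Finset.univ : Finset PGen) = {.Ap, .dp, .dm} := rfl
      rw [hu, Finset.sum_insert (by decide), Finset.sum_insert (by decide), Finset.sum_singleton]
      rfl
    intro X Y
    rw [hs]
    refine LinearMap.ext fun u => ?_
    have h1 := nabla_nabla u
    have h2 := d2_d2 u
    have h3 := d2_nabla u
    have h4 := d2_dx u
    have h5 := nabla_dx u
    cases X <;> cases Y <;>
    simp [PGen.op, PGen.sc, PGen.deg, PGen.toS, SGen.sc, SGen.deg, SGen.table, completeTable,
      csign, val_one2, h1, h2, h4, h5, ← h3])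

/-- The operator `[∂ₓ + n/(f-n) (∂/∂ψ₊ + 2 ψ₋ ∂ₓ) ∂/∂ψ₋] (∂ₓ)^(n-1)`. -/
def levelOp (n : ℕ) (f : 𝕜) : Module.End 𝕜 (OPM 𝕜) :=
  (dx + ((n : 𝕜) / (f - n)) • (nabla * d2)) * dx ^ (n - 1)

/-- The element `A₊^n + n/(f-n) A₊^(n-1) d₊ d₋` of `U(𝔤₊)`. -/
def levelElt (n : ℕ) (f : 𝕜) : UPlus 𝕜 :=
  pgen 𝕜 .Ap ^ n + ((n : 𝕜) / (f - n)) • (pgen 𝕜 .Ap ^ (n - 1) * pgen 𝕜 .dp * pgen 𝕜 .dm)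

/-! The operators in the variables `x, ψ, θ`. -/

/-- `∂/∂ψ + ζ ∂/∂θ`. -/
def minusOpT : Module.End 𝕜 (OPT 𝕜) := d1 + mulL zeta * d2

/-- `∂/∂ψ - ζ ∂/∂θ + 2 (ψ - ζ θ) ∂/∂x`. -/
def plusOpT : Module.End 𝕜 (OPT 𝕜) :=
  d1 - mulL zeta * d2 + (2 : 𝕜) • (mulL (eta1 - zeta * eta2) * dx)

/-- `[∂ₓ + n/(f-n) (ψ ∂_ψ + θ ∂_θ - ζ (ψ ∂_θ + θ ∂_ψ)) ∂ₓ - nζ/(f-n) ∂_ψ ∂_θ] (∂ₓ)^(n-1)`. -/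
def levelOpT (n : ℕ) (f : 𝕜) : Module.End 𝕜 (OPT 𝕜) :=
  (dx
    + ((n : 𝕜) / (f - n)) • ((mulL eta1 * d1 + mulL eta2 * d2
        - mulL zeta * (mulL eta1 * d2 + mulL eta2 * d1)) * dx)
    - ((n : 𝕜) / (f - n)) • (mulL zeta * (d1 * d2))) * dx ^ (n - 1)

/-- `ψ₊ = (ψ + ζ θ)/√2`. -/
def psiPlusT : OPT 𝕜 := invSqrtTwo 𝕜 • (eta1 + zeta * eta2)

/-- `ψ₋ = (ψ - ζ θ)/√2`. -/
def psiMinusT : OPT 𝕜 := invSqrtTwo 𝕜 • (eta1 - zeta * eta2)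

/-- The change of variables: `∑ φ_{ijk}(x) ζ^i ψ₊^j ψ₋^k` rewritten in `x, ψ, θ` by
`ψ₊ = (ψ + ζ θ)/√2` and `ψ₋ = (ψ - ζ θ)/√2`. -/
def changeVars (φ : OPM 𝕜) : OPT 𝕜 :=
  ∑ I : Mon, φ I • ((if I.1 = 0 then 1 else zeta) *
    ((if I.2.1 = 0 then 1 else psiPlusT) * (if I.2.2 = 0 then 1 else psiMinusT)) : OPT 𝕜)

/-! ### Invariance -/

/-- `E`, an operator of degree `δ`, intertwines the left actions of `𝔤` with parameters `(h, f)`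
and `(h', f')`. -/
def Intertwines (δ : Grade) (E : Module.End 𝕜 (OPM 𝕜)) (h f h' f' : 𝕜) : Prop :=
  ∀ (X : Gen) (φ : OPM 𝕜), E (leftAct h f (Pi.single X 1) φ) =
    (csign δ X.deg : 𝕜) • leftAct h' f' (Pi.single X 1) (E φ)

/-- The equation `E φ = 0` is invariant under the color supergroup generated by `𝔤`, acting by
the left action with parameters `(h, f)`: all transformations obtained from the operators
`π_L(X)`, `X ∈ 𝔤`, and from multiplication by `ζ` by taking linear combinations and products
map solutions to solutions. -/
def IsInvariantEquation (h f : 𝕜) (E : Module.End 𝕜 (OPM 𝕜)) : Prop :=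
  ∀ T ∈ Algebra.adjoin 𝕜 (insert (mulL zeta) (Set.range (leftAct h f))),
    ∀ φ : OPM 𝕜, E φ = 0 → E (T φ) = 0

end Ops

end ColorSuper

end

open ColorSuper

noncomputable section

namespace ColorSuper

set_option linter.unusedSimpArgs false

namespace Smooth

variable {𝕜 : Type*} [RCLike 𝕜]

/-! Conceptually, left and right translations commute. If `𝒫|h,f⟩` is annihilated by `𝔤₋` and has
weight `(h',f')`, then `π_R(𝒫)φ` has the right covariance attached to `(h',f')` whenever `φ` has the
one attached to `(h,f)`. Hence `E = π_R(𝒫)` intertwines the two left actions, up to the sign for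
moving an operator of degree `δ` past `X`, and its kernel is stable.

The intertwining is not deduced from this principle but verified, independently of the Verma module.
A function is a family of eight smooth components, one for each monomial in `ζ` and the two
Grassmann variables (`ofComp`), and every product, derivative and sign twist has a closed formula in
components. The three exponentials in `Ad(g₊⁻¹)` terminate after at most two brackets, so
`adInv_ofAlg` and the coordinates give each `π_L(X)` explicitly (`leftAct_Am`, ..., `leftAct_F`).
The identities `E π_L(X) = ± π_L'(X) E` then amount to comparing scalars in front of derivatives of
components (`intertwines_d2`, `intertwines_nabla`, `intertwines_levelOp`). For the third family the
Leibniz rule carries `∂ₓ^(n-1)` past `x` and `x²`, and the fraction `q = n/(f-n)` enters only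
through `q (f-n) = n`. Invariance follows because the operators preserving `ker E` form a subalgebra
(`isInvariantEquation_of_intertwines`).

On the Verma side, the lowest weight conditions come from the commutation relations in an arbitrary
representation (`isLowest_dm`, `isLowest_dp`, `isLowest_level`). That the vector is not a multiple
of `|h,f⟩` cannot be read off from relations alone. It is detected in a concrete representation on
four copies of `𝕜[X]`, whose relations are checked in `VermaModel.act_mul_act`; this replaces the
Poincaré–Birkhoff–Witt theorem.

In the variables `ψ, θ` the operators are the transported ones, the first two up to the factor `√2`;
this is the chain rule, again checked in components. -/

lemma D_mul (g k : Smooth 𝕜) : D 𝕜 (g * k) = D 𝕜 g * k + g * D 𝕜 k :=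
  ext fun x => deriv_mul (g.differentiable x) (k.differentiable x)

lemma D_x : D 𝕜 (x 𝕜) = 1 := by
  refine ext fun y => ?_
  exact ((RCLike.ofRealCLM (K := 𝕜)).hasDerivAt (x := y)).deriv.trans (by
    simp only [RCLike.ofRealCLM_apply, RCLike.ofReal_one]; rfl)

end Smooth

/-! ### Functions as families of eight components. -/

namespace SFn

variable {𝕜 : Type*} [RCLike 𝕜] {α β : Grade}

/-- The function with given components, listed in the order
`000, 001, 010, 011, 100, 101, 110, 111`. -/
def ofComp (a b c d e f g k : Smooth 𝕜) : SFn 𝕜 α β := fun I =>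
  if I.1 = 0 then
    if I.2.1 = 0 then if I.2.2 = 0 then a else b else if I.2.2 = 0 then c else d
  else
    if I.2.1 = 0 then if I.2.2 = 0 then e else f else if I.2.2 = 0 then g else k

/-- Lets an arbitrary function be replaced by eight independent symbols, so that operator identities
become eight identities between smooth functions. -/
lemma eq_ofComp (u : SFn 𝕜 α β) : ∃ a b c d e f g k, u = ofComp a b c d e f g k := by
  refine ⟨u (0, 0, 0), u (0, 0, 1), u (0, 1, 0), u (0, 1, 1), u (1, 0, 0), u (1, 0, 1),
    u (1, 1, 0), u (1, 1, 1), ?_⟩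
  funext ⟨i, j, k⟩
  fin_cases i <;> fin_cases j <;> fin_cases k <;> rfl

lemma ofComp_inj {a b c d e f g k a' b' c' d' e' f' g' k' : Smooth 𝕜} :
    (ofComp a b c d e f g k : SFn 𝕜 α β) = ofComp a' b' c' d' e' f' g' k' ↔
      a = a' ∧ b = b' ∧ c = c' ∧ d = d' ∧ e = e' ∧ f = f' ∧ g = g' ∧ k = k' := by
  constructor
  · intro H
    exact ⟨congrFun H (0, 0, 0), congrFun H (0, 0, 1), congrFun H (0, 1, 0),
      congrFun H (0, 1, 1), congrFun H (1, 0, 0), congrFun H (1, 0, 1), congrFun H (1, 1, 0),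
      congrFun H (1, 1, 1)⟩
  · rintro ⟨rfl, rfl, rfl, rfl, rfl, rfl, rfl, rfl⟩
    rfl

section Linear

variable (a b c d e f g k a' b' c' d' e' f' g' k' : Smooth 𝕜)

lemma ofComp_add : (ofComp a b c d e f g k + ofComp a' b' c' d' e' f' g' k' : SFn 𝕜 α β) =
    ofComp (a + a') (b + b') (c + c') (d + d') (e + e') (f + f') (g + g') (k + k') := by
  funext ⟨i, j, l⟩
  fin_cases i <;> fin_cases j <;> fin_cases l <;> rfl

lemma ofComp_sub : (ofComp a b c d e f g k - ofComp a' b' c' d' e' f' g' k' : SFn 𝕜 α β) =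
    ofComp (a - a') (b - b') (c - c') (d - d') (e - e') (f - f') (g - g') (k - k') := by
  funext ⟨i, j, l⟩
  fin_cases i <;> fin_cases j <;> fin_cases l <;> rfl

lemma ofComp_neg : (-ofComp a b c d e f g k : SFn 𝕜 α β) =
    ofComp (-a) (-b) (-c) (-d) (-e) (-f) (-g) (-k) := by
  funext ⟨i, j, l⟩
  fin_cases i <;> fin_cases j <;> fin_cases l <;> rfl

lemma ofComp_smul (r : 𝕜) : (r • ofComp a b c d e f g k : SFn 𝕜 α β) =
    ofComp (r • a) (r • b) (r • c) (r • d) (r • e) (r • f) (r • g) (r • k) := by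
  funext ⟨i, j, l⟩
  fin_cases i <;> fin_cases j <;> fin_cases l <;> rfl

lemma ofComp_zsmul (r : ℤ) : (r • ofComp a b c d e f g k : SFn 𝕜 α β) =
    ofComp (r • a) (r • b) (r • c) (r • d) (r • e) (r • f) (r • g) (r • k) := by
  funext ⟨i, j, l⟩
  fin_cases i <;> fin_cases j <;> fin_cases l <;> rfl

lemma smooth_smul_ofComp (r : Smooth 𝕜) : (r • ofComp a b c d e f g k : SFn 𝕜 α β) =
    ofComp (r * a) (r * b) (r * c) (r * d) (r * e) (r * f) (r * g) (r * k) := by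
  funext ⟨i, j, l⟩
  fin_cases i <;> fin_cases j <;> fin_cases l <;> rfl

lemma dx_ofComp : dx (ofComp a b c d e f g k : SFn 𝕜 α β) =
    ofComp (Smooth.D 𝕜 a) (Smooth.D 𝕜 b) (Smooth.D 𝕜 c) (Smooth.D 𝕜 d) (Smooth.D 𝕜 e)
      (Smooth.D 𝕜 f) (Smooth.D 𝕜 g) (Smooth.D 𝕜 k) := by
  funext ⟨i, j, l⟩
  fin_cases i <;> fin_cases j <;> fin_cases l <;> rfl

end Linear

lemma zero_eq_ofComp : (0 : SFn 𝕜 α β) = ofComp 0 0 0 0 0 0 0 0 := by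
  funext ⟨i, j, l⟩
  fin_cases i <;> fin_cases j <;> fin_cases l <;> rfl

lemma one_eq_ofComp : (1 : SFn 𝕜 α β) = ofComp 1 0 0 0 0 0 0 0 := by
  funext ⟨i, j, l⟩
  fin_cases i <;> fin_cases j <;> fin_cases l <;> rfl

lemma zeta_eq_ofComp : (zeta : SFn 𝕜 α β) = ofComp 0 0 0 0 1 0 0 0 := by
  funext ⟨i, j, l⟩
  fin_cases i <;> fin_cases j <;> fin_cases l <;> rfl

lemma eta1_eq_ofComp : (eta1 : SFn 𝕜 α β) = ofComp 0 0 1 0 0 0 0 0 := by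
  funext ⟨i, j, l⟩
  fin_cases i <;> fin_cases j <;> fin_cases l <;> rfl

lemma eta2_eq_ofComp : (eta2 : SFn 𝕜 α β) = ofComp 0 1 0 0 0 0 0 0 := by
  funext ⟨i, j, l⟩
  fin_cases i <;> fin_cases j <;> fin_cases l <;> rfl

lemma coordX_eq_ofComp : (coordX : SFn 𝕜 α β) = ofComp (Smooth.x 𝕜) 0 0 0 0 0 0 0 := by
  rw [coordX, one_eq_ofComp, smooth_smul_ofComp, mul_one]
  simp only [mul_zero]

end SFn

/-! ### Products, Grassmann derivatives and sign twists in components. -/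

section OPM

variable {𝕜 : Type*} [RCLike 𝕜] (a b c d e f g k a' b' c' d' e' f' g' k' : Smooth 𝕜)

open SFn

set_option maxHeartbeats 2000000 in
lemma OPM.ofComp_mul : (ofComp a b c d e f g k * ofComp a' b' c' d' e' f' g' k' : OPM 𝕜) =
    ofComp (a * a' + e * e')
      (a * b' + b * a' + (e * f' - f * e'))
      (a * c' + c * a' + (e * g' - g * e'))
      (a * d' + d * a' - b * c' + c * b' + (e * k' + k * e' + f * g' - g * f'))
      (a * e' + e * a')
      (a * f' + e * b' + f * a' - b * e')
      (a * g' + e * c' + g * a' - c * e')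
      (a * k' + e * d' + k * a' + d * e' + g * b' - f * c' + b * g' - c * f') := by
  funext ⟨i, j, l⟩
  simp only [mul_apply, Fintype.sum_prod_type, Fin.sum_univ_two, ofComp, one_ne_zero, if_true,
    if_false]
  fin_cases i <;> fin_cases j <;> fin_cases l <;>
  simp [mcoef, csign, val_one2] <;> ring

lemma OPM.d1_ofComp : d1 (ofComp a b c d e f g k : OPM 𝕜) =
    ofComp c d 0 0 (-g) (-k) 0 0 := by
  funext ⟨i, j, l⟩
  change d1Fun _ _ = _
  simp only [d1Fun_apply]
  fin_cases i <;> fin_cases j <;> fin_cases l <;>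
  simp [ofComp, csign, mdeg, val_one2]

lemma OPM.d2_ofComp : d2 (ofComp a b c d e f g k : OPM 𝕜) =
    ofComp b 0 (-d) 0 (-f) 0 k 0 := by
  funext ⟨i, j, l⟩
  change d2Fun _ _ = _
  simp only [d2Fun_apply]
  fin_cases i <;> fin_cases j <;> fin_cases l <;>
  simp [ofComp, csign, mdeg, val_one2, one_add_one2]

lemma OPM.twist00_ofComp : twist (0, 0) (ofComp a b c d e f g k : OPM 𝕜) =
    ofComp a b c d e f g k := by
  funext ⟨i, j, l⟩
  fin_cases i <;> fin_cases j <;> fin_cases l <;>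
  simp [twist, ofComp, csign, mdeg, val_one2, one_add_one2]

lemma OPM.twist01_ofComp : twist (0, 1) (ofComp a b c d e f g k : OPM 𝕜) =
    ofComp a (-b) (-c) d (-e) f g (-k) := by
  funext ⟨i, j, l⟩
  fin_cases i <;> fin_cases j <;> fin_cases l <;>
  simp [twist, ofComp, csign, mdeg, val_one2, one_add_one2]

lemma OPM.twist10_ofComp : twist (1, 0) (ofComp a b c d e f g k : OPM 𝕜) =
    ofComp a b c d (-e) (-f) (-g) (-k) := by
  funext ⟨i, j, l⟩
  fin_cases i <;> fin_cases j <;> fin_cases l <;>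
  simp [twist, ofComp, csign, mdeg, val_one2, one_add_one2]

lemma OPM.twist11_ofComp : twist (1, 1) (ofComp a b c d e f g k : OPM 𝕜) =
    ofComp a (-b) (-c) d e (-f) (-g) k := by
  funext ⟨i, j, l⟩
  fin_cases i <;> fin_cases j <;> fin_cases l <;>
  simp [twist, ofComp, csign, mdeg, val_one2, one_add_one2]

-- The signs differ from those for `ψ₊, ψ₋`: the degrees of `ψ` and `θ` are orthogonal, so these
-- variables commute with each other, while both still anticommute with `ζ`.
set_option maxHeartbeats 2000000 in
lemma OPT.ofComp_mul : (ofComp a b c d e f g k * ofComp a' b' c' d' e' f' g' k' : OPT 𝕜) =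
    ofComp (a * a' + e * e')
      (a * b' + b * a' + (e * f' - f * e'))
      (a * c' + c * a' + (e * g' - g * e'))
      (a * d' + d * a' + b * c' + c * b' + (e * k' + k * e' - f * g' - g * f'))
      (a * e' + e * a')
      (a * f' + e * b' + f * a' - b * e')
      (a * g' + e * c' + g * a' - c * e')
      (a * k' + e * d' + k * a' + d * e' + g * b' + f * c' - b * g' - c * f') := by
  funext ⟨i, j, l⟩
  simp only [mul_apply, Fintype.sum_prod_type, Fin.sum_univ_two, ofComp, one_ne_zero, if_true,
    if_false]
  fin_cases i <;> fin_cases j <;> fin_cases l <;>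
  simp [mcoef, csign, val_one2] <;> ring

lemma OPT.d1_ofComp : d1 (ofComp a b c d e f g k : OPT 𝕜) =
    ofComp c d 0 0 (-g) (-k) 0 0 := by
  funext ⟨i, j, l⟩
  change d1Fun _ _ = _
  simp only [d1Fun_apply]
  fin_cases i <;> fin_cases j <;> fin_cases l <;>
  simp [ofComp, csign, mdeg, val_one2]

lemma OPT.d2_ofComp : d2 (ofComp a b c d e f g k : OPT 𝕜) =
    ofComp b 0 d 0 (-f) 0 (-k) 0 := by
  funext ⟨i, j, l⟩
  change d2Fun _ _ = _
  simp only [d2Fun_apply]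
  fin_cases i <;> fin_cases j <;> fin_cases l <;>
  simp [ofComp, csign, mdeg, val_one2, one_add_one2]

end OPM

/-! ### The bracket of `𝔤` with Grassmann coefficients, one output coefficient at a time. -/

lemma sum_gen {M : Type*} [AddCommMonoid M] (t : Gen → M) : ∑ X, t X =
    t .Am + (t .Ap + (t .N + (t .bm + (t .bp + (t .am + (t .ap + t .F)))))) := by
  have hu : (Finset.univ : Finset Gen) = {.Am, .Ap, .N, .bm, .bp, .am, .ap, .F} := rfl
  rw [hu, Finset.sum_insert (by decide), Finset.sum_insert (by decide),
    Finset.sum_insert (by decide), Finset.sum_insert (by decide), Finset.sum_insert (by decide),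
    Finset.sum_insert (by decide), Finset.sum_insert (by decide), Finset.sum_singleton]

section Bracket

variable {𝕜 : Type*} [RCLike 𝕜] (U V : Ext 𝕜)

open SFn Ext

lemma Ext.bracket_Am : bracket U V .Am =
    (2 : ℤ) • (U .Am * twist (0, 0) (V .N)) - (2 : ℤ) • (U .N * twist (0, 0) (V .Am))
      + (2 : ℤ) • (U .bm * twist (1, 0) (V .bm)) + (2 : ℤ) • (U .am * twist (0, 1) (V .am)) := by
  simp only [bracket, sum_gen]
  simp only [Gen.sc, completeTable, Gen.table, Gen.deg, csign, val_one2]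
  simp
  abel

lemma Ext.bracket_Ap : bracket U V .Ap =
    -(2 : ℤ) • (U .Ap * twist (0, 0) (V .N)) + (2 : ℤ) • (U .N * twist (0, 0) (V .Ap))
      + (2 : ℤ) • (U .bp * twist (1, 0) (V .bp)) + (2 : ℤ) • (U .ap * twist (0, 1) (V .ap)) := by
  simp only [bracket, sum_gen]
  simp only [Gen.sc, completeTable, Gen.table, Gen.deg, csign, val_one2]
  simp
  abel

lemma Ext.bracket_N : bracket U V .N =
    (4 : ℤ) • (U .Am * twist (0, 0) (V .Ap)) - (4 : ℤ) • (U .Ap * twist (0, 0) (V .Am))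
      + (2 : ℤ) • (U .bm * twist (1, 0) (V .bp)) + (2 : ℤ) • (U .bp * twist (1, 0) (V .bm))
      + (2 : ℤ) • (U .am * twist (0, 1) (V .ap)) + (2 : ℤ) • (U .ap * twist (0, 1) (V .am)) := by
  simp only [bracket, sum_gen]
  simp only [Gen.sc, completeTable, Gen.table, Gen.deg, csign, val_one2]
  simp
  abel

lemma Ext.bracket_bm : bracket U V .bm =
    (2 : ℤ) • (U .Am * twist (0, 0) (V .bp)) - U .N * twist (0, 0) (V .bm)
      + U .bm * twist (1, 0) (V .N) - (2 : ℤ) • (U .bp * twist (1, 0) (V .Am))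
      + (2 : ℤ) • (U .am * twist (0, 1) (V .F)) + (2 : ℤ) • (U .F * twist (1, 1) (V .am)) := by
  simp only [bracket, sum_gen]
  simp only [Gen.sc, completeTable, Gen.table, Gen.deg, csign, val_one2]
  simp
  abel

lemma Ext.bracket_bp : bracket U V .bp =
    -(2 : ℤ) • (U .Ap * twist (0, 0) (V .bm)) + U .N * twist (0, 0) (V .bp)
      + (2 : ℤ) • (U .bm * twist (1, 0) (V .Ap)) - U .bp * twist (1, 0) (V .N)
      + (2 : ℤ) • (U .ap * twist (0, 1) (V .F)) + (2 : ℤ) • (U .F * twist (1, 1) (V .ap)) := by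
  simp only [bracket, sum_gen]
  simp only [Gen.sc, completeTable, Gen.table, Gen.deg, csign, val_one2]
  simp
  abel

lemma Ext.bracket_am : bracket U V .am =
    (2 : ℤ) • (U .Am * twist (0, 0) (V .ap)) - U .N * twist (0, 0) (V .am)
      + (2 : ℤ) • (U .bm * twist (1, 0) (V .F)) + U .am * twist (0, 1) (V .N)
      - (2 : ℤ) • (U .ap * twist (0, 1) (V .Am)) + (2 : ℤ) • (U .F * twist (1, 1) (V .bm)) := by
  simp only [bracket, sum_gen]
  simp only [Gen.sc, completeTable, Gen.table, Gen.deg, csign, val_one2]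
  simp
  abel

lemma Ext.bracket_ap : bracket U V .ap =
    -(2 : ℤ) • (U .Ap * twist (0, 0) (V .am)) + U .N * twist (0, 0) (V .ap)
      + (2 : ℤ) • (U .bp * twist (1, 0) (V .F)) + (2 : ℤ) • (U .am * twist (0, 1) (V .Ap))
      - U .ap * twist (0, 1) (V .N) + (2 : ℤ) • (U .F * twist (1, 1) (V .bp)) := by
  simp only [bracket, sum_gen]
  simp only [Gen.sc, completeTable, Gen.table, Gen.deg, csign, val_one2]
  simp
  abel

lemma Ext.bracket_F : bracket U V .F =
    U .bm * twist (1, 0) (V .ap) - U .bp * twist (1, 0) (V .am) + U .am * twist (0, 1) (V .bp)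
      - U .ap * twist (0, 1) (V .bm) := by
  simp only [bracket, sum_gen]
  simp only [Gen.sc, completeTable, Gen.table, Gen.deg, csign, val_one2]
  simp
  abel

end Bracket

lemma sum_sgen {M : Type*} [AddCommMonoid M] (t : SGen → M) : ∑ X, t X =
    t .Am + (t .Ap + (t .N + (t .Ft + (t .cp + (t .cm + (t .dp + t .dm)))))) := by
  have hu : (Finset.univ : Finset SGen) = {.Am, .Ap, .N, .Ft, .cp, .cm, .dp, .dm} := rfl
  rw [hu, Finset.sum_insert (by decide), Finset.sum_insert (by decide),
    Finset.sum_insert (by decide), Finset.sum_insert (by decide), Finset.sum_insert (by decide),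
    Finset.sum_insert (by decide), Finset.sum_insert (by decide), Finset.sum_singleton]

namespace SFn

variable {𝕜 : Type*} [RCLike 𝕜] {α β : Grade}

protected lemma zero_mul (u : SFn 𝕜 α β) : 0 * u = 0 := by
  funext K
  simp [mul_apply]

protected lemma mul_zero (u : SFn 𝕜 α β) : u * 0 = 0 := by
  funext K
  simp [mul_apply]

lemma twist_zero (γ : Grade) : twist γ (0 : SFn 𝕜 α β) = 0 := by
  funext K
  simp [twist]

lemma ofComp_eq_zero {a b c d e f g k : Smooth 𝕜} : (ofComp a b c d e f g k : SFn 𝕜 α β) = 0 ↔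
    a = 0 ∧ b = 0 ∧ c = 0 ∧ d = 0 ∧ e = 0 ∧ f = 0 ∧ g = 0 ∧ k = 0 := by
  rw [zero_eq_ofComp, ofComp_inj]

end SFn

/-! ### The ordinary superalgebra spanned by `A₋, A₊, N, F̃, c₊, c₋, d₊, d₋`. -/

section Basis

variable {𝕜 : Type*} [RCLike 𝕜]

open SFn

variable (𝕜) in
/-- The scalar `1/√2` as a constant function. -/
def Smooth.r : Smooth 𝕜 := algebraMap 𝕜 (Smooth 𝕜) (invSqrtTwo 𝕜)

lemma invSqrtTwo_sq : invSqrtTwo 𝕜 * invSqrtTwo 𝕜 = 2⁻¹ := by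
  rw [invSqrtTwo, ← mul_inv, ← RCLike.ofReal_mul, Real.mul_self_sqrt (by norm_num)]
  rw [RCLike.ofReal_ofNat]

/-- All later constants are polynomials in `r = 1/√2`, and this is the only relation needed to
compare them. -/
lemma Smooth.two_mul_r_sq : 2 * Smooth.r 𝕜 ^ 2 = 1 := by
  rw [Smooth.r, ← map_pow, pow_two, invSqrtTwo_sq, ← map_ofNat (algebraMap 𝕜 (Smooth 𝕜)) 2,
    ← map_mul, mul_inv_cancel₀ two_ne_zero, map_one]

/-- The element of `Ext` with given coefficients. -/
def Ext.ofCoef (Am Ap N bm bp am ap F : OPM 𝕜) : Ext 𝕜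
  | .Am => Am | .Ap => Ap | .N => N | .bm => bm | .bp => bp | .am => am | .ap => ap | .F => F

open ColorSuper.Smooth (r)

/-- The sign of the `b₋` coefficient is reversed because coefficients are stored on the left and `b₋
ζ = -ζ b₋`. -/
lemma cPlus_eq : (cPlus : Ext 𝕜) = Ext.ofCoef 0 0 0 (ofComp 0 0 0 0 (-r 𝕜) 0 0 0) 0
    (ofComp (r 𝕜) 0 0 0 0 0 0 0) 0 0 := by
  funext Z
  cases Z <;> simp [cPlus, Ext.ofCoef, Ext.mk, Ext.rmul, Gen.deg, SFn.zero_mul, one_eq_ofComp,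
    zeta_eq_ofComp, OPM.twist10_ofComp, OPM.ofComp_mul, ofComp_smul, Algebra.smul_def, r]

lemma cMinus_eq : (cMinus : Ext 𝕜) = Ext.ofCoef 0 0 0 (ofComp 0 0 0 0 (r 𝕜) 0 0 0) 0
    (ofComp (r 𝕜) 0 0 0 0 0 0 0) 0 0 := by
  funext Z
  cases Z <;> simp [cMinus, Ext.ofCoef, Ext.mk, Ext.rmul, Gen.deg, SFn.zero_mul, one_eq_ofComp,
    zeta_eq_ofComp, OPM.twist10_ofComp, OPM.ofComp_mul, ofComp_smul, ofComp_neg,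
    Algebra.smul_def, r]

lemma dPlus_eq : (dPlus : Ext 𝕜) = Ext.ofCoef 0 0 0 0 (ofComp 0 0 0 0 (r 𝕜) 0 0 0)
    0 (ofComp (r 𝕜) 0 0 0 0 0 0 0) 0 := by
  funext Z
  cases Z <;> simp [dPlus, Ext.ofCoef, Ext.mk, one_eq_ofComp,
    zeta_eq_ofComp, ofComp_smul, Algebra.smul_def, r]

lemma dMinus_eq : (dMinus : Ext 𝕜) = Ext.ofCoef 0 0 0 0 (ofComp 0 0 0 0 (-r 𝕜) 0 0 0)
    0 (ofComp (r 𝕜) 0 0 0 0 0 0 0) 0 := by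
  funext Z
  cases Z <;> simp [dMinus, Ext.ofCoef, Ext.mk, one_eq_ofComp,
    zeta_eq_ofComp, ofComp_smul, ofComp_neg, Algebra.smul_def, r]

lemma Ftilde_eq : (Ftilde : Ext 𝕜) =
    Ext.ofCoef 0 0 0 0 0 0 0 (ofComp 0 0 0 0 (r 𝕜 * r 𝕜) 0 0 0) := by
  funext Z
  cases Z <;> simp [Ftilde, Ext.ofCoef, Ext.mk,
    zeta_eq_ofComp, ofComp_smul, Algebra.smul_def, r, ← invSqrtTwo_sq]

lemma mk_Am_eq (u : OPM 𝕜) : Ext.mk u .Am = Ext.ofCoef u 0 0 0 0 0 0 0 := by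
  funext Z
  cases Z <;> simp [Ext.ofCoef, Ext.mk]

lemma mk_Ap_eq (u : OPM 𝕜) : Ext.mk u .Ap = Ext.ofCoef 0 u 0 0 0 0 0 0 := by
  funext Z
  cases Z <;> simp [Ext.ofCoef, Ext.mk]

lemma mk_N_eq (u : OPM 𝕜) : Ext.mk u .N = Ext.ofCoef 0 0 u 0 0 0 0 0 := by
  funext Z
  cases Z <;> simp [Ext.ofCoef, Ext.mk]

/-- The element of `Ext` with given coefficients in the basis `SGen`. -/
def SGen.comb (a : SGen → Smooth 𝕜) : Ext 𝕜 := Ext.ofCoef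
  (ofComp (a .Am) 0 0 0 0 0 0 0) (ofComp (a .Ap) 0 0 0 0 0 0 0) (ofComp (a .N) 0 0 0 0 0 0 0)
  (ofComp 0 0 0 0 (r 𝕜 * (a .cm - a .cp)) 0 0 0) (ofComp 0 0 0 0 (r 𝕜 * (a .dp - a .dm)) 0 0 0)
  (ofComp (r 𝕜 * (a .cp + a .cm)) 0 0 0 0 0 0 0) (ofComp (r 𝕜 * (a .dp + a .dm)) 0 0 0 0 0 0 0)
  (ofComp 0 0 0 0 (r 𝕜 * r 𝕜 * a .Ft) 0 0 0)

lemma SGen.comb_single (X : SGen) : SGen.comb (Pi.single X 1) = (X.toExt : Ext 𝕜) := by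
  cases X <;>
  simp [SGen.comb, SGen.toExt, cPlus_eq, cMinus_eq, dPlus_eq, dMinus_eq, Ftilde_eq, mk_Am_eq,
    mk_Ap_eq, mk_N_eq, one_eq_ofComp, zero_eq_ofComp]

lemma SGen.sum_smul_toExt (c : SGen → 𝕜) : ∑ Z, c Z • (Z.toExt : Ext 𝕜) =
    SGen.comb fun Z => algebraMap 𝕜 (Smooth 𝕜) (c Z) := by
  rw [sum_sgen]
  funext W
  cases W <;>
  simp [SGen.comb, SGen.toExt, cPlus_eq, cMinus_eq, dPlus_eq, dMinus_eq, Ftilde_eq, mk_Am_eq,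
    mk_Ap_eq, mk_N_eq, one_eq_ofComp, ofComp_smul, ofComp_add, Ext.ofCoef, Algebra.smul_def,
    ofComp_inj] <;>
  ring

/-- The coefficients of the bracket of two linear combinations of the basis `SGen`. -/
def SGen.bracketCoef (a b : SGen → Smooth 𝕜) (Z : SGen) : Smooth 𝕜 :=
  ∑ X, ∑ Y, (SGen.sc X Y Z : Smooth 𝕜) * (a X * b Y)

lemma SGen.bracketCoef_single (X Y Z : SGen) :
    SGen.bracketCoef (Pi.single X (1 : Smooth 𝕜)) (Pi.single Y 1) Z = SGen.sc X Y Z := by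
  rw [SGen.bracketCoef, Finset.sum_eq_single X, Finset.sum_eq_single Y] <;>
  simp +contextual [Pi.single_apply]

section

variable (a b : SGen → Smooth 𝕜)

lemma SGen.bracketCoef_Am : SGen.bracketCoef a b .Am =
    2 * a .Am * b .N - 2 * a .N * b .Am + 2 * a .cp * b .cm + 2 * a .cm * b .cp := by
  simp only [bracketCoef, sum_sgen]
  simp only [sc, completeTable, table, deg, csign, val_one2]
  simp
  ring

lemma SGen.bracketCoef_Ap : SGen.bracketCoef a b .Ap =
    -2 * a .Ap * b .N + 2 * a .N * b .Ap + 2 * a .dp * b .dm + 2 * a .dm * b .dp := by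
  simp only [bracketCoef, sum_sgen]
  simp only [sc, completeTable, table, deg, csign, val_one2]
  simp
  ring

lemma SGen.bracketCoef_N : SGen.bracketCoef a b .N =
    4 * a .Am * b .Ap - 4 * a .Ap * b .Am + 2 * a .cp * b .dp + 2 * a .cm * b .dm
      + 2 * a .dp * b .cp + 2 * a .dm * b .cm := by
  simp only [bracketCoef, sum_sgen]
  simp only [sc, completeTable, table, deg, csign, val_one2]
  simp
  ring

lemma SGen.bracketCoef_Ft : SGen.bracketCoef a b .Ft =
    -2 * a .cp * b .dp + 2 * a .cm * b .dm - 2 * a .dp * b .cp + 2 * a .dm * b .cm := by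
  simp only [bracketCoef, sum_sgen]
  simp only [sc, completeTable, table, deg, csign, val_one2]
  simp
  ring

lemma SGen.bracketCoef_cp : SGen.bracketCoef a b .cp =
    2 * a .Am * b .dm - a .N * b .cp - a .Ft * b .cp + a .cp * b .N + a .cp * b .Ft
      - 2 * a .dm * b .Am := by
  simp only [bracketCoef, sum_sgen]
  simp only [sc, completeTable, table, deg, csign, val_one2]
  simp
  ring

lemma SGen.bracketCoef_cm : SGen.bracketCoef a b .cm =
    2 * a .Am * b .dp - a .N * b .cm + a .Ft * b .cm + a .cm * b .N - a .cm * b .Ft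
      - 2 * a .dp * b .Am := by
  simp only [bracketCoef, sum_sgen]
  simp only [sc, completeTable, table, deg, csign, val_one2]
  simp
  ring

lemma SGen.bracketCoef_dp : SGen.bracketCoef a b .dp =
    -2 * a .Ap * b .cm + a .N * b .dp + a .Ft * b .dp + 2 * a .cm * b .Ap - a .dp * b .N
      - a .dp * b .Ft := by
  simp only [bracketCoef, sum_sgen]
  simp only [sc, completeTable, table, deg, csign, val_one2]
  simp
  ring

lemma SGen.bracketCoef_dm : SGen.bracketCoef a b .dm =
    -2 * a .Ap * b .cp + a .N * b .dm - a .Ft * b .dm + 2 * a .cp * b .Ap - a .dm * b .N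
      + a .dm * b .Ft := by
  simp only [bracketCoef, sum_sgen]
  simp only [sc, completeTable, table, deg, csign, val_one2]
  simp
  ring

/-- Treating general coefficients at once replaces a separate verification for each pair of basis
vectors. Ordinary functions of `x` have degree zero, so the bracket is bilinear over them; `ζ² = 1`
and `2r² = 1` absorb the Grassmann numbers and the normalisations. -/
lemma SGen.bracket_comb :
    Ext.bracket (SGen.comb a) (SGen.comb b) = SGen.comb (SGen.bracketCoef a b) := by
  have hr := Smooth.two_mul_r_sq (𝕜 := 𝕜)
  funext Z
  cases Z <;>
  simp [Ext.bracket_Am, Ext.bracket_Ap, Ext.bracket_N, Ext.bracket_bm, Ext.bracket_bp,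
    Ext.bracket_am, Ext.bracket_ap, Ext.bracket_F, Ext.ofCoef, SGen.comb,
    OPM.twist00_ofComp, OPM.twist01_ofComp, OPM.twist10_ofComp,
    OPM.twist11_ofComp, OPM.ofComp_mul, ofComp_zsmul, ofComp_neg, ofComp_add,
    ofComp_sub, ofComp_inj, SGen.bracketCoef_Am, SGen.bracketCoef_Ap, SGen.bracketCoef_N,
    SGen.bracketCoef_Ft, SGen.bracketCoef_cp, SGen.bracketCoef_cm, SGen.bracketCoef_dp,
    SGen.bracketCoef_dm] <;>
  grind

end

lemma bracket_toExt (X Y : SGen) : Ext.bracket (X.toExt : Ext 𝕜) Y.toExt =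
    ∑ Z, (SGen.sc X Y Z : 𝕜) • (Z.toExt : Ext 𝕜) := by
  rw [← SGen.comb_single, ← SGen.comb_single, SGen.bracket_comb, SGen.sum_smul_toExt]
  congr 1
  funext Z
  rw [SGen.bracketCoef_single, map_intCast]

end Basis

/-! ### The adjoint action of `g₊⁻¹`. -/

section ExpAd

variable {𝕜 : Type*} [RCLike 𝕜]

open SFn

open ColorSuper.Smooth (r x)

lemma Ext.bracket_zero_right (Z : Ext 𝕜) : Ext.bracket Z 0 = 0 := by
  funext W
  simp [Ext.bracket, twist_zero, SFn.mul_zero]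

/-- Once the third iterated bracket vanishes so do all later ones, and the series is supported on
the exponents `0, 1, 2`. -/
lemma expAd_eq_of_bracket_eq {Z V W₁ W₂ : Ext 𝕜} (h₁ : Ext.bracket Z V = W₁)
    (h₂ : Ext.bracket Z W₁ = W₂) (h₃ : Ext.bracket Z W₂ = 0) :
    expAd Z V = V + W₁ + (2⁻¹ : 𝕜) • W₂ := by
  have hk : ∀ k, (Ext.bracket Z)^[k + 3] V = 0 := by
    intro k
    induction k with
    | zero => simp only [Function.iterate_succ_apply', Function.iterate_zero_apply, h₁, h₂, h₃]
    | succ k ih => rw [Nat.add_right_comm, Function.iterate_succ_apply', ih,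
        Ext.bracket_zero_right]
  rw [expAd, finsum_eq_sum_of_support_subset (s := Finset.range 3)]
  · simp [Finset.sum_range_succ, h₁, h₂]
  · intro k hks
    by_contra hlt
    obtain ⟨l, rfl⟩ := Nat.exists_eq_add_of_le (show 3 ≤ k by simpa using hlt)
    rw [Nat.add_comm, Function.mem_support, hk, smul_zero] at hks
    exact hks rfl

/-- Writing `1/2` as `r²` keeps the quadratic term of the exponential polynomial in `r`. -/
lemma Smooth.half_eq : algebraMap 𝕜 (Smooth 𝕜) 2⁻¹ = r 𝕜 ^ 2 := by
  rw [← invSqrtTwo_sq, map_mul, Smooth.r, pow_two]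

lemma neg_mk_coordX_Ap : -Ext.mk coordX .Ap =
    (Ext.ofCoef 0 (ofComp (-x 𝕜) 0 0 0 0 0 0 0) 0 0 0 0 0 0 : Ext 𝕜) := by
  rw [mk_Ap_eq]
  funext W
  cases W <;> simp [Ext.ofCoef, coordX_eq_ofComp, ofComp_neg]

lemma neg_lmul_eta1_dPlus : -Ext.lmul eta1 dPlus =
    (Ext.ofCoef 0 0 0 0 (ofComp 0 0 0 0 0 0 (r 𝕜) 0) 0 (ofComp 0 0 (-r 𝕜) 0 0 0 0 0) 0 :
      Ext 𝕜) := by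
  rw [dPlus_eq]
  funext W
  cases W <;> simp [Ext.ofCoef, Ext.lmul, eta1_eq_ofComp, ofComp_neg, OPM.ofComp_mul,
    SFn.mul_zero]

lemma neg_lmul_eta2_dMinus : -Ext.lmul eta2 dMinus =
    (Ext.ofCoef 0 0 0 0 (ofComp 0 0 0 0 0 (-r 𝕜) 0 0) 0 (ofComp 0 (-r 𝕜) 0 0 0 0 0 0) 0 :
      Ext 𝕜) := by
  rw [dMinus_eq]
  funext W
  cases W <;> simp [Ext.ofCoef, Ext.lmul, eta2_eq_ofComp, ofComp_neg, OPM.ofComp_mul,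
    SFn.mul_zero]

variable (a : Gen → Smooth 𝕜)

/-- Bracketing with `A₊` raises the `N`-weight by 2, and the weights of `𝔤` lie between `-2` and
`2`, so the third bracket vanishes. Only `A₋` survives two brackets, which produces the `x²` term.
-/
lemma expAd_coordX : expAd (-Ext.mk coordX .Ap)
    (Ext.ofCoef (ofComp (a .Am) 0 0 0 0 0 0 0) (ofComp (a .Ap) 0 0 0 0 0 0 0)
      (ofComp (a .N) 0 0 0 0 0 0 0) (ofComp (a .bm) 0 0 0 0 0 0 0) (ofComp (a .bp) 0 0 0 0 0 0 0)
      (ofComp (a .am) 0 0 0 0 0 0 0) (ofComp (a .ap) 0 0 0 0 0 0 0) (ofComp (a .F) 0 0 0 0 0 0 0)) =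
    Ext.ofCoef (ofComp (a .Am) 0 0 0 0 0 0 0)
      (ofComp (4 * x 𝕜 ^ 2 * a .Am + a .Ap + 2 * x 𝕜 * a .N) 0 0 0 0 0 0 0)
      (ofComp (4 * x 𝕜 * a .Am + a .N) 0 0 0 0 0 0 0) (ofComp (a .bm) 0 0 0 0 0 0 0)
      (ofComp (2 * x 𝕜 * a .bm + a .bp) 0 0 0 0 0 0 0) (ofComp (a .am) 0 0 0 0 0 0 0)
      (ofComp (2 * x 𝕜 * a .am + a .ap) 0 0 0 0 0 0 0) (ofComp (a .F) 0 0 0 0 0 0 0) := by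
  have hr := Smooth.two_mul_r_sq (𝕜 := 𝕜)
  rw [neg_mk_coordX_Ap, expAd_eq_of_bracket_eq (W₁ :=
      Ext.ofCoef 0 (ofComp (2 * x 𝕜 * a .N) 0 0 0 0 0 0 0)
        (ofComp (4 * x 𝕜 * a .Am) 0 0 0 0 0 0 0) 0 (ofComp (2 * x 𝕜 * a .bm) 0 0 0 0 0 0 0) 0
        (ofComp (2 * x 𝕜 * a .am) 0 0 0 0 0 0 0) 0) (W₂ :=
      Ext.ofCoef 0 (ofComp (8 * x 𝕜 ^ 2 * a .Am) 0 0 0 0 0 0 0) 0 0 0 0 0 0)]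
  · funext W
    cases W <;> simp [Ext.ofCoef, ofComp_add, ofComp_smul, ofComp_inj, Algebra.smul_def,
      Smooth.half_eq] <;> grind
  · funext W
    cases W <;> simp [Ext.bracket_Am, Ext.bracket_Ap, Ext.bracket_N, Ext.bracket_bm, Ext.bracket_bp,
      Ext.bracket_am, Ext.bracket_ap, Ext.bracket_F, Ext.ofCoef, SFn.zero_mul, SFn.mul_zero,
      twist_zero, OPM.twist00_ofComp, OPM.twist01_ofComp, OPM.twist10_ofComp,
      OPM.twist11_ofComp, OPM.ofComp_mul, ofComp_zsmul, ofComp_neg, ofComp_add,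
      ofComp_sub, ofComp_inj, ofComp_eq_zero] <;> grind
  · funext W
    cases W <;> simp [Ext.bracket_Am, Ext.bracket_Ap, Ext.bracket_N, Ext.bracket_bm, Ext.bracket_bp,
      Ext.bracket_am, Ext.bracket_ap, Ext.bracket_F, Ext.ofCoef, SFn.zero_mul, SFn.mul_zero,
      twist_zero, OPM.twist00_ofComp, OPM.twist01_ofComp, OPM.twist10_ofComp,
      OPM.twist11_ofComp, OPM.ofComp_mul, ofComp_zsmul, ofComp_neg, ofComp_add,
      ofComp_sub, ofComp_inj, ofComp_eq_zero] <;> grind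
  · funext W
    cases W <;> simp [Ext.bracket_Am, Ext.bracket_Ap, Ext.bracket_N, Ext.bracket_bm, Ext.bracket_bp,
      Ext.bracket_am, Ext.bracket_ap, Ext.bracket_F, Ext.ofCoef, SFn.zero_mul, SFn.mul_zero,
      twist_zero, OPM.twist00_ofComp, OPM.twist01_ofComp, OPM.twist10_ofComp,
      OPM.twist11_ofComp, OPM.ofComp_mul, ofComp_zsmul, ofComp_neg, ofComp_add,
      ofComp_sub, ofComp_inj, ofComp_eq_zero]

/-- The argument is the value found for the factor `exp(-x A₊)`. The exponent is a multiple of `ψ₊`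
and `ψ₊² = 0`, so only the linear term survives. -/
lemma expAd_dPlus : expAd (-Ext.lmul eta1 dPlus)
    (Ext.ofCoef (ofComp (a .Am) 0 0 0 0 0 0 0)
      (ofComp (4 * x 𝕜 ^ 2 * a .Am + a .Ap + 2 * x 𝕜 * a .N) 0 0 0 0 0 0 0)
      (ofComp (4 * x 𝕜 * a .Am + a .N) 0 0 0 0 0 0 0) (ofComp (a .bm) 0 0 0 0 0 0 0)
      (ofComp (2 * x 𝕜 * a .bm + a .bp) 0 0 0 0 0 0 0) (ofComp (a .am) 0 0 0 0 0 0 0)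
      (ofComp (2 * x 𝕜 * a .am + a .ap) 0 0 0 0 0 0 0) (ofComp (a .F) 0 0 0 0 0 0 0)) =
    Ext.ofCoef (ofComp (a .Am) 0 0 0 0 0 0 0)
      (ofComp (4 * x 𝕜 ^ 2 * a .Am + a .Ap + 2 * x 𝕜 * a .N) 0 (-4 * r 𝕜 * x 𝕜 * a .am - 2 * r 𝕜 *
        a .ap) 0 0 0 (4 * r 𝕜 * x 𝕜 * a .bm + 2 * r 𝕜 * a .bp) 0)
      (ofComp (4 * x 𝕜 * a .Am + a .N) 0 (-2 * r 𝕜 * a .am) 0 0 0 (2 * r 𝕜 * a .bm) 0)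
      (ofComp (a .bm) 0 0 0 0 0 (-2 * r 𝕜 * a .Am) 0)
      (ofComp (2 * x 𝕜 * a .bm + a .bp) 0 (-2 * r 𝕜 * a .F) 0 0 0 (-4 * r 𝕜 * x 𝕜 * a .Am - r 𝕜 *
        a .N) 0) (ofComp (a .am) 0 (2 * r 𝕜 * a .Am) 0 0 0 0 0)
      (ofComp (2 * x 𝕜 * a .am + a .ap) 0 (4 * r 𝕜 * x 𝕜 * a .Am + r 𝕜 * a .N) 0 0 0 (2 * r 𝕜 * a
        .F) 0) (ofComp (a .F) 0 (r 𝕜 * a .bm) 0 0 0 (-r 𝕜 * a .am) 0) := by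
  have hr := Smooth.two_mul_r_sq (𝕜 := 𝕜)
  rw [neg_lmul_eta1_dPlus, expAd_eq_of_bracket_eq (W₁ :=
      Ext.ofCoef 0
        (ofComp 0 0 (-4 * r 𝕜 * x 𝕜 * a .am - 2 * r 𝕜 * a .ap) 0 0 0 (4 * r 𝕜 * x 𝕜 * a .bm + 2 *
          r 𝕜 * a .bp) 0) (ofComp 0 0 (-2 * r 𝕜 * a .am) 0 0 0 (2 * r 𝕜 * a .bm) 0)
        (ofComp 0 0 0 0 0 0 (-2 * r 𝕜 * a .Am) 0)
        (ofComp 0 0 (-2 * r 𝕜 * a .F) 0 0 0 (-4 * r 𝕜 * x 𝕜 * a .Am - r 𝕜 * a .N) 0)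
        (ofComp 0 0 (2 * r 𝕜 * a .Am) 0 0 0 0 0)
        (ofComp 0 0 (4 * r 𝕜 * x 𝕜 * a .Am + r 𝕜 * a .N) 0 0 0 (2 * r 𝕜 * a .F) 0)
        (ofComp 0 0 (r 𝕜 * a .bm) 0 0 0 (-r 𝕜 * a .am) 0)) (W₂ := 0)]
  · funext W
    cases W <;> simp [Ext.ofCoef, ofComp_add, ofComp_smul, ofComp_inj, Algebra.smul_def,
      Smooth.half_eq]
  · funext W
    cases W <;> simp [Ext.bracket_Am, Ext.bracket_Ap, Ext.bracket_N, Ext.bracket_bm, Ext.bracket_bp,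
      Ext.bracket_am, Ext.bracket_ap, Ext.bracket_F, Ext.ofCoef, SFn.zero_mul, SFn.mul_zero,
      twist_zero, OPM.twist00_ofComp, OPM.twist01_ofComp, OPM.twist10_ofComp,
      OPM.twist11_ofComp, OPM.ofComp_mul, ofComp_zsmul, ofComp_neg, ofComp_add,
      ofComp_sub, ofComp_inj, ofComp_eq_zero] <;> grind
  · funext W
    cases W <;> simp [Ext.bracket_Am, Ext.bracket_Ap, Ext.bracket_N, Ext.bracket_bm, Ext.bracket_bp,
      Ext.bracket_am, Ext.bracket_ap, Ext.bracket_F, Ext.ofCoef, SFn.zero_mul, SFn.mul_zero,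
      twist_zero, OPM.twist00_ofComp, OPM.twist01_ofComp, OPM.twist10_ofComp,
      OPM.twist11_ofComp, OPM.ofComp_mul, ofComp_zsmul, ofComp_neg, ofComp_add,
      ofComp_sub, ofComp_inj, ofComp_eq_zero]
  · exact Ext.bracket_zero_right _

/-- The argument is the value found for the two preceding factors. Here `ψ₋² = 0` stops the series
after the linear term. -/
lemma expAd_dMinus : expAd (-Ext.lmul eta2 dMinus)
    (Ext.ofCoef (ofComp (a .Am) 0 0 0 0 0 0 0)
      (ofComp (4 * x 𝕜 ^ 2 * a .Am + a .Ap + 2 * x 𝕜 * a .N) 0 (-4 * r 𝕜 * x 𝕜 * a .am - 2 * r 𝕜 *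
        a .ap) 0 0 0 (4 * r 𝕜 * x 𝕜 * a .bm + 2 * r 𝕜 * a .bp) 0)
      (ofComp (4 * x 𝕜 * a .Am + a .N) 0 (-2 * r 𝕜 * a .am) 0 0 0 (2 * r 𝕜 * a .bm) 0)
      (ofComp (a .bm) 0 0 0 0 0 (-2 * r 𝕜 * a .Am) 0)
      (ofComp (2 * x 𝕜 * a .bm + a .bp) 0 (-2 * r 𝕜 * a .F) 0 0 0 (-4 * r 𝕜 * x 𝕜 * a .Am - r 𝕜 *
        a .N) 0) (ofComp (a .am) 0 (2 * r 𝕜 * a .Am) 0 0 0 0 0)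
      (ofComp (2 * x 𝕜 * a .am + a .ap) 0 (4 * r 𝕜 * x 𝕜 * a .Am + r 𝕜 * a .N) 0 0 0 (2 * r 𝕜 * a
        .F) 0) (ofComp (a .F) 0 (r 𝕜 * a .bm) 0 0 0 (-r 𝕜 * a .am) 0)) =
    Ext.ofCoef (ofComp (a .Am) 0 0 0 0 0 0 0)
      (ofComp (4 * x 𝕜 ^ 2 * a .Am + a .Ap + 2 * x 𝕜 * a .N) (-4 * r 𝕜 * x 𝕜 * a .am - 2 * r 𝕜 * a
        .ap) (-4 * r 𝕜 * x 𝕜 * a .am - 2 * r 𝕜 * a .ap) (-8 * x 𝕜 * a .Am - 2 * a .N) 0 (-4 * r 𝕜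
        * x 𝕜 * a .bm - 2 * r 𝕜 * a .bp) (4 * r 𝕜 * x 𝕜 * a .bm + 2 * r 𝕜 * a .bp) (-4 * a .F))
      (ofComp (4 * x 𝕜 * a .Am + a .N) (-2 * r 𝕜 * a .am) (-2 * r 𝕜 * a .am) (-4 * a .Am) 0 (-2 *
        r 𝕜 * a .bm) (2 * r 𝕜 * a .bm) 0)
      (ofComp (a .bm) 0 0 0 0 (2 * r 𝕜 * a .Am) (-2 * r 𝕜 * a .Am) 0)
      (ofComp (2 * x 𝕜 * a .bm + a .bp) (-2 * r 𝕜 * a .F) (-2 * r 𝕜 * a .F) (-2 * a .bm) 0 (4 *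
        r 𝕜 * x 𝕜 * a .Am + r 𝕜 * a .N) (-4 * r 𝕜 * x 𝕜 * a .Am - r 𝕜 * a .N) (2 * a .am))
      (ofComp (a .am) (2 * r 𝕜 * a .Am) (2 * r 𝕜 * a .Am) 0 0 0 0 0)
      (ofComp (2 * x 𝕜 * a .am + a .ap) (4 * r 𝕜 * x 𝕜 * a .Am + r 𝕜 * a .N) (4 * r 𝕜 * x 𝕜 * a
        .Am + r 𝕜 * a .N) (-2 * a .am) 0 (-2 * r 𝕜 * a .F) (2 * r 𝕜 * a .F) (2 * a .bm))
      (ofComp (a .F) (r 𝕜 * a .bm) (r 𝕜 * a .bm) 0 0 (r 𝕜 * a .am) (-r 𝕜 * a .am) (-2 * a .Am)) := by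
  have hr := Smooth.two_mul_r_sq (𝕜 := 𝕜)
  rw [neg_lmul_eta2_dMinus, expAd_eq_of_bracket_eq (W₁ :=
      Ext.ofCoef 0
        (ofComp 0 (-4 * r 𝕜 * x 𝕜 * a .am - 2 * r 𝕜 * a .ap) 0 (-8 * x 𝕜 * a .Am - 2 * a .N) 0 (-4
          * r 𝕜 * x 𝕜 * a .bm - 2 * r 𝕜 * a .bp) 0 (-4 * a .F))
        (ofComp 0 (-2 * r 𝕜 * a .am) 0 (-4 * a .Am) 0 (-2 * r 𝕜 * a .bm) 0 0)
        (ofComp 0 0 0 0 0 (2 * r 𝕜 * a .Am) 0 0)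
        (ofComp 0 (-2 * r 𝕜 * a .F) 0 (-2 * a .bm) 0 (4 * r 𝕜 * x 𝕜 * a .Am + r 𝕜 * a .N) 0 (2 * a
          .am)) (ofComp 0 (2 * r 𝕜 * a .Am) 0 0 0 0 0 0)
        (ofComp 0 (4 * r 𝕜 * x 𝕜 * a .Am + r 𝕜 * a .N) 0 (-2 * a .am) 0 (-2 * r 𝕜 * a .F) 0 (2 * a
          .bm)) (ofComp 0 (r 𝕜 * a .bm) 0 0 0 (r 𝕜 * a .am) 0 (-2 * a .Am))) (W₂ := 0)]
  · funext W
    cases W <;> simp [Ext.ofCoef, ofComp_add, ofComp_smul, ofComp_inj, Algebra.smul_def,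
      Smooth.half_eq]
  · funext W
    cases W <;> simp [Ext.bracket_Am, Ext.bracket_Ap, Ext.bracket_N, Ext.bracket_bm, Ext.bracket_bp,
      Ext.bracket_am, Ext.bracket_ap, Ext.bracket_F, Ext.ofCoef, SFn.zero_mul, SFn.mul_zero,
      twist_zero, OPM.twist00_ofComp, OPM.twist01_ofComp, OPM.twist10_ofComp,
      OPM.twist11_ofComp, OPM.ofComp_mul, ofComp_zsmul, ofComp_neg, ofComp_add,
      ofComp_sub, ofComp_inj, ofComp_eq_zero] <;> grind
  · funext W
    cases W <;> simp [Ext.bracket_Am, Ext.bracket_Ap, Ext.bracket_N, Ext.bracket_bm, Ext.bracket_bp,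
      Ext.bracket_am, Ext.bracket_ap, Ext.bracket_F, Ext.ofCoef, SFn.zero_mul, SFn.mul_zero,
      twist_zero, OPM.twist00_ofComp, OPM.twist01_ofComp, OPM.twist10_ofComp,
      OPM.twist11_ofComp, OPM.ofComp_mul, ofComp_zsmul, ofComp_neg, ofComp_add,
      ofComp_sub, ofComp_inj, ofComp_eq_zero]
  · exact Ext.bracket_zero_right _

/-- The constants `X Z` are hidden behind the letter `a`, so that later computations treat them as
opaque commuting symbols. -/
lemma adInv_ofAlg (X : Gen → 𝕜) (ha : a = fun Z => algebraMap 𝕜 (Smooth 𝕜) (X Z)) :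
    adInv (Ext.ofAlg X) =
    Ext.ofCoef (ofComp (a .Am) 0 0 0 0 0 0 0)
      (ofComp (4 * x 𝕜 ^ 2 * a .Am + a .Ap + 2 * x 𝕜 * a .N) (-4 * r 𝕜 * x 𝕜 * a .am - 2 * r 𝕜 * a
        .ap) (-4 * r 𝕜 * x 𝕜 * a .am - 2 * r 𝕜 * a .ap) (-8 * x 𝕜 * a .Am - 2 * a .N) 0 (-4 * r 𝕜
        * x 𝕜 * a .bm - 2 * r 𝕜 * a .bp) (4 * r 𝕜 * x 𝕜 * a .bm + 2 * r 𝕜 * a .bp) (-4 * a .F))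
      (ofComp (4 * x 𝕜 * a .Am + a .N) (-2 * r 𝕜 * a .am) (-2 * r 𝕜 * a .am) (-4 * a .Am) 0 (-2 *
        r 𝕜 * a .bm) (2 * r 𝕜 * a .bm) 0)
      (ofComp (a .bm) 0 0 0 0 (2 * r 𝕜 * a .Am) (-2 * r 𝕜 * a .Am) 0)
      (ofComp (2 * x 𝕜 * a .bm + a .bp) (-2 * r 𝕜 * a .F) (-2 * r 𝕜 * a .F) (-2 * a .bm) 0 (4 *
        r 𝕜 * x 𝕜 * a .Am + r 𝕜 * a .N) (-4 * r 𝕜 * x 𝕜 * a .Am - r 𝕜 * a .N) (2 * a .am))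
      (ofComp (a .am) (2 * r 𝕜 * a .Am) (2 * r 𝕜 * a .Am) 0 0 0 0 0)
      (ofComp (2 * x 𝕜 * a .am + a .ap) (4 * r 𝕜 * x 𝕜 * a .Am + r 𝕜 * a .N) (4 * r 𝕜 * x 𝕜 * a
        .Am + r 𝕜 * a .N) (-2 * a .am) 0 (-2 * r 𝕜 * a .F) (2 * r 𝕜 * a .F) (2 * a .bm))
      (ofComp (a .F) (r 𝕜 * a .bm) (r 𝕜 * a .bm) 0 0 (r 𝕜 * a .am) (-r 𝕜 * a .am) (-2 * a .Am)) := by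
  have h : Ext.ofAlg X = Ext.ofCoef (ofComp (a .Am) 0 0 0 0 0 0 0) (ofComp (a .Ap) 0 0 0 0 0 0 0)
      (ofComp (a .N) 0 0 0 0 0 0 0) (ofComp (a .bm) 0 0 0 0 0 0 0) (ofComp (a .bp) 0 0 0 0 0 0 0)
      (ofComp (a .am) 0 0 0 0 0 0 0) (ofComp (a .ap) 0 0 0 0 0 0 0)
      (ofComp (a .F) 0 0 0 0 0 0 0) := by
    subst ha
    funext W
    cases W <;> simp [Ext.ofAlg, Ext.ofCoef, one_eq_ofComp, ofComp_smul, Algebra.smul_def]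
  rw [adInv, h, expAd_coordX, expAd_dPlus, expAd_dMinus]

end ExpAd

/-! ### The Maurer–Cartan elements and the right action. -/

section RightAction

variable {𝕜 : Type*} [RCLike 𝕜]

open SFn

open ColorSuper.Smooth (r x D)

lemma mcX_eq : (mcX : Ext 𝕜) = Ext.ofCoef 0 (ofComp 1 0 0 0 0 0 0 0) 0 0 0 0 0 0 := by
  rw [mcX, expAd_eq_of_bracket_eq (Z := -Ext.lmul eta1 dPlus) (W₁ := 0) (W₂ := 0) _
    (Ext.bracket_zero_right _) (Ext.bracket_zero_right _), smul_zero, add_zero, add_zero,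
    expAd_eq_of_bracket_eq (W₁ := 0) (W₂ := 0) _
    (Ext.bracket_zero_right _) (Ext.bracket_zero_right _), smul_zero, add_zero, add_zero, mk_Ap_eq,
    one_eq_ofComp]
  · rw [mk_Ap_eq, neg_lmul_eta2_dMinus, one_eq_ofComp]
    funext W
    cases W <;> simp [Ext.bracket_Am, Ext.bracket_Ap, Ext.bracket_N, Ext.bracket_bm,
      Ext.bracket_bp, Ext.bracket_am, Ext.bracket_ap, Ext.bracket_F, Ext.ofCoef, SFn.zero_mul,
      SFn.mul_zero, twist_zero, OPM.twist00_ofComp, OPM.twist01_ofComp, OPM.twist10_ofComp,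
      OPM.twist11_ofComp, OPM.ofComp_mul, ofComp_zsmul, ofComp_neg, ofComp_add,
      ofComp_sub, ofComp_inj, ofComp_eq_zero]
  · rw [mk_Ap_eq, neg_lmul_eta1_dPlus, one_eq_ofComp]
    funext W
    cases W <;> simp [Ext.bracket_Am, Ext.bracket_Ap, Ext.bracket_N, Ext.bracket_bm,
      Ext.bracket_bp, Ext.bracket_am, Ext.bracket_ap, Ext.bracket_F, Ext.ofCoef, SFn.zero_mul,
      SFn.mul_zero, twist_zero, OPM.twist00_ofComp, OPM.twist01_ofComp, OPM.twist10_ofComp,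
      OPM.twist11_ofComp, OPM.ofComp_mul, ofComp_zsmul, ofComp_neg, ofComp_add,
      ofComp_sub, ofComp_inj, ofComp_eq_zero]

/-- `[-ψ₋ d₋, d₊] = -ψ₋ {d₋, d₊} = -2 ψ₋ A₊`, and the next bracket contains `ψ₋²`. -/
lemma mcPlus_eq : (mcPlus : Ext 𝕜) = Ext.ofCoef 0 (ofComp 0 (-2) 0 0 0 0 0 0) 0 0
    (ofComp 0 0 0 0 (r 𝕜) 0 0 0) 0 (ofComp (r 𝕜) 0 0 0 0 0 0 0) 0 := by
  have hr := Smooth.two_mul_r_sq (𝕜 := 𝕜)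
  rw [mcPlus, neg_lmul_eta2_dMinus, dPlus_eq, expAd_eq_of_bracket_eq
    (W₁ := Ext.ofCoef 0 (ofComp 0 (-2) 0 0 0 0 0 0) 0 0 0 0 0 0) (W₂ := 0) _ _
    (Ext.bracket_zero_right _), smul_zero, add_zero]
  · funext W
    cases W <;> simp [Ext.ofCoef]
  · funext W
    cases W <;> simp [Ext.bracket_Am, Ext.bracket_Ap, Ext.bracket_N, Ext.bracket_bm,
      Ext.bracket_bp, Ext.bracket_am, Ext.bracket_ap, Ext.bracket_F, Ext.ofCoef, SFn.zero_mul,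
      SFn.mul_zero, twist_zero, OPM.twist00_ofComp, OPM.twist01_ofComp, OPM.twist10_ofComp,
      OPM.twist11_ofComp, OPM.ofComp_mul, ofComp_zsmul, ofComp_neg, ofComp_add,
      ofComp_sub, ofComp_inj, ofComp_eq_zero]
    grind
  · funext W
    cases W <;> simp [Ext.bracket_Am, Ext.bracket_Ap, Ext.bracket_N, Ext.bracket_bm,
      Ext.bracket_bp, Ext.bracket_am, Ext.bracket_ap, Ext.bracket_F, Ext.ofCoef, SFn.zero_mul,
      SFn.mul_zero, twist_zero, OPM.twist00_ofComp, OPM.twist01_ofComp, OPM.twist10_ofComp,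
      OPM.twist11_ofComp, OPM.ofComp_mul, ofComp_zsmul, ofComp_neg, ofComp_add,
      ofComp_sub, ofComp_inj, ofComp_eq_zero]

/-- The excluded coefficients are those absorbed by the `𝔤₋` part. The correction `2 η₊ ψ₋` in
`coordXi` cancels the `-2 ψ₋ A₊` contained in `mcPlus`; separating `d₊` from `d₋` uses `ζ² = 1` and
`2r² = 1`. -/
lemma eq_add_of_coord (V : Ext 𝕜) (X : Gen) (h₁ : X ≠ .Am) (h₂ : X ≠ .am) (h₃ : X ≠ .bm) :
    V X = (Ext.lmul (coordXi V) mcX + Ext.lmul (coordPlus V) mcPlus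
        + Ext.lmul (coordMinus V) mcMinus + Ext.lmul (coordN V) (Ext.mk 1 .N)
        + Ext.lmul (coordF V) Ftilde) X := by
  have hr := Smooth.two_mul_r_sq (𝕜 := 𝕜)
  have h2 : algebraMap 𝕜 (Smooth 𝕜) 2 = 2 := map_ofNat _ 2
  have hs : algebraMap 𝕜 (Smooth 𝕜) (invSqrtTwo 𝕜) = r 𝕜 := rfl
  rw [mcMinus, mcX_eq, mcPlus_eq, dMinus_eq, mk_N_eq, Ftilde_eq]
  obtain ⟨a, b, c, d, e, f, g, k, hAp⟩ := eq_ofComp (V .Ap)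
  obtain ⟨a', b', c', d', e', f', g', k', hap⟩ := eq_ofComp (V .ap)
  obtain ⟨a₁, b₁, c₁, d₁, e₁, f₁, g₁, k₁, hbp⟩ := eq_ofComp (V .bp)
  obtain ⟨a₂, b₂, c₂, d₂, e₂, f₂, g₂, k₂, hN⟩ := eq_ofComp (V .N)
  obtain ⟨a₃, b₃, c₃, d₃, e₃, f₃, g₃, k₃, hF⟩ := eq_ofComp (V .F)
  cases X <;> first | contradiction |
  (simp [Ext.lmul, coordXi, coordPlus, coordMinus, coordN, coordF, hAp, hap, hbp, hN, hF, Ext.ofCoef,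
    OPM.ofComp_mul, ofComp_add, ofComp_sub, ofComp_smul, ofComp_inj, zeta_eq_ofComp,
    one_eq_ofComp, eta2_eq_ofComp, SFn.mul_zero, Algebra.smul_def, h2, hs]; try grind)

lemma OPM.nabla_ofComp (a b c d e f g k : Smooth 𝕜) : nabla (ofComp a b c d e f g k : OPM 𝕜) =
    ofComp c (d + (2 : 𝕜) • D 𝕜 a) 0 (-((2 : 𝕜) • D 𝕜 c)) (-g) (-k - (2 : 𝕜) • D 𝕜 e) 0
      ((2 : 𝕜) • D 𝕜 g) := by
  simp [nabla, mulL, OPM.d1_ofComp, dx_ofComp, OPM.ofComp_mul, eta2_eq_ofComp, ofComp_smul,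
    ofComp_add, ofComp_inj, sub_eq_add_neg]

lemma rightAct_apply (h f : 𝕜) (V : Ext 𝕜) (φ : OPM 𝕜) : rightAct h f V φ =
    coordXi V * dx φ + coordPlus V * d1 φ + coordMinus V * d2 φ + h • (coordN V * φ)
      + f • (coordF V * φ) := rfl

lemma rightAct_basis (h f : 𝕜) : rightAct h f (Ext.mk 1 .Ap) = SFn.dx ∧
    rightAct h f dPlus = nabla ∧ rightAct h f dMinus = SFn.d2 ∧
    rightAct h f (Ext.mk 1 .N) = h • (1 : Module.End 𝕜 (OPM 𝕜)) ∧
    rightAct h f Ftilde = f • (1 : Module.End 𝕜 (OPM 𝕜)) ∧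
    rightAct h f (Ext.mk 1 .Am) = 0 ∧ rightAct h f cPlus = 0 ∧ rightAct h f cMinus = 0 := by
  have hr := Smooth.two_mul_r_sq (𝕜 := 𝕜)
  have h2 : algebraMap 𝕜 (Smooth 𝕜) 2 = 2 := map_ofNat _ 2
  have hs : algebraMap 𝕜 (Smooth 𝕜) (invSqrtTwo 𝕜) = r 𝕜 := rfl
  rw [cPlus_eq, cMinus_eq, dPlus_eq, dMinus_eq, mk_N_eq, mk_Am_eq, mk_Ap_eq, Ftilde_eq,
    one_eq_ofComp]
  refine ⟨?_, ?_, ?_, ?_, ?_, ?_, ?_, ?_⟩ <;>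
  (refine LinearMap.ext fun φ => ?_
   obtain ⟨a, b, c, d, e, f, g, k, rfl⟩ := eq_ofComp φ
   simp [rightAct_apply, coordXi, coordPlus, coordMinus, coordN, coordF, Ext.ofCoef,
    OPM.ofComp_mul, ofComp_add, ofComp_sub, ofComp_smul, ofComp_inj, zeta_eq_ofComp,
    one_eq_ofComp, eta2_eq_ofComp, SFn.mul_zero, SFn.zero_mul, Algebra.smul_def, h2, hs,
    OPM.d1_ofComp, OPM.d2_ofComp, OPM.nabla_ofComp, dx_ofComp, zero_eq_ofComp]
   try grind)

/-! ### Coordinates of `-Ad(g₊⁻¹) X`, the coefficients of the left action. -/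

section Coord

variable (a : Gen → Smooth 𝕜) (X : Gen → 𝕜)

lemma coordXi_neg_adInv (ha : a = fun Z => algebraMap 𝕜 (Smooth 𝕜) (X Z)) :
    coordXi (-adInv (Ext.ofAlg X)) =
    ofComp (-4 * x 𝕜 ^ 2 * a .Am - a .Ap - 2 * x 𝕜 * a .N) 0 (4 * r 𝕜 * x 𝕜 * a .am + 2 * r 𝕜 * a
      .ap) 0 0 0 (-4 * r 𝕜 * x 𝕜 * a .bm - 2 * r 𝕜 * a .bp) 0 := by
  have hr := Smooth.two_mul_r_sq (𝕜 := 𝕜)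
  have h2 : algebraMap 𝕜 (Smooth 𝕜) 2 = 2 := map_ofNat _ 2
  have hs : algebraMap 𝕜 (Smooth 𝕜) (invSqrtTwo 𝕜) = r 𝕜 := rfl
  rw [adInv_ofAlg a X ha]
  simp [coordXi, coordPlus, coordMinus, coordN, coordF, Ext.ofCoef, ofComp_neg,
    OPM.ofComp_mul, ofComp_add, ofComp_sub, ofComp_smul, ofComp_inj, zeta_eq_ofComp,
    one_eq_ofComp, eta2_eq_ofComp, SFn.mul_zero, Algebra.smul_def, h2, hs]
  grind

lemma coordPlus_neg_adInv (ha : a = fun Z => algebraMap 𝕜 (Smooth 𝕜) (X Z)) :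
    coordPlus (-adInv (Ext.ofAlg X)) =
    ofComp (-2 * r 𝕜 * x 𝕜 * a .am - r 𝕜 * a .ap) 0 (-4 * x 𝕜 * a .Am - a .N) 0 (-2 * r 𝕜 * x 𝕜 *
      a .bm - r 𝕜 * a .bp) 0 (-2 * a .F) 0 := by
  have hr := Smooth.two_mul_r_sq (𝕜 := 𝕜)
  have h2 : algebraMap 𝕜 (Smooth 𝕜) 2 = 2 := map_ofNat _ 2
  have hs : algebraMap 𝕜 (Smooth 𝕜) (invSqrtTwo 𝕜) = r 𝕜 := rfl
  rw [adInv_ofAlg a X ha]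
  simp [coordXi, coordPlus, coordMinus, coordN, coordF, Ext.ofCoef, ofComp_neg,
    OPM.ofComp_mul, ofComp_add, ofComp_sub, ofComp_smul, ofComp_inj, zeta_eq_ofComp,
    one_eq_ofComp, eta2_eq_ofComp, SFn.mul_zero, Algebra.smul_def, h2, hs]
  grind

lemma coordMinus_neg_adInv (ha : a = fun Z => algebraMap 𝕜 (Smooth 𝕜) (X Z)) :
    coordMinus (-adInv (Ext.ofAlg X)) =
    ofComp (-2 * r 𝕜 * x 𝕜 * a .am - r 𝕜 * a .ap) (-4 * x 𝕜 * a .Am - a .N) 0 (4 * r 𝕜 * a .am) (2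
      * r 𝕜 * x 𝕜 * a .bm + r 𝕜 * a .bp) (2 * a .F) 0 (-4 * r 𝕜 * a .bm) := by
  have hr := Smooth.two_mul_r_sq (𝕜 := 𝕜)
  have h2 : algebraMap 𝕜 (Smooth 𝕜) 2 = 2 := map_ofNat _ 2
  have hs : algebraMap 𝕜 (Smooth 𝕜) (invSqrtTwo 𝕜) = r 𝕜 := rfl
  rw [adInv_ofAlg a X ha]
  simp [coordXi, coordPlus, coordMinus, coordN, coordF, Ext.ofCoef, ofComp_neg,
    OPM.ofComp_mul, ofComp_add, ofComp_sub, ofComp_smul, ofComp_inj, zeta_eq_ofComp,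
    one_eq_ofComp, eta2_eq_ofComp, SFn.mul_zero, Algebra.smul_def, h2, hs]
  grind

lemma coordN_neg_adInv (ha : a = fun Z => algebraMap 𝕜 (Smooth 𝕜) (X Z)) :
    coordN (-adInv (Ext.ofAlg X)) =
    ofComp (-4 * x 𝕜 * a .Am - a .N) (2 * r 𝕜 * a .am) (2 * r 𝕜 * a .am) (4 * a .Am) 0 (2 * r 𝕜 *
      a .bm) (-2 * r 𝕜 * a .bm) 0 := by
  have hr := Smooth.two_mul_r_sq (𝕜 := 𝕜)
  have h2 : algebraMap 𝕜 (Smooth 𝕜) 2 = 2 := map_ofNat _ 2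
  have hs : algebraMap 𝕜 (Smooth 𝕜) (invSqrtTwo 𝕜) = r 𝕜 := rfl
  rw [adInv_ofAlg a X ha]
  simp [coordXi, coordPlus, coordMinus, coordN, coordF, Ext.ofCoef, ofComp_neg,
    OPM.ofComp_mul, ofComp_add, ofComp_sub, ofComp_smul, ofComp_inj, zeta_eq_ofComp,
    one_eq_ofComp, eta2_eq_ofComp, SFn.mul_zero, Algebra.smul_def, h2, hs]
  grind

lemma coordF_neg_adInv (ha : a = fun Z => algebraMap 𝕜 (Smooth 𝕜) (X Z)) :
    coordF (-adInv (Ext.ofAlg X)) =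
    ofComp 0 (2 * r 𝕜 * a .am) (-2 * r 𝕜 * a .am) (4 * a .Am) (-2 * a .F) (2 * r 𝕜 * a .bm) (2 *
      r 𝕜 * a .bm) 0 := by
  have hr := Smooth.two_mul_r_sq (𝕜 := 𝕜)
  have h2 : algebraMap 𝕜 (Smooth 𝕜) 2 = 2 := map_ofNat _ 2
  have hs : algebraMap 𝕜 (Smooth 𝕜) (invSqrtTwo 𝕜) = r 𝕜 := rfl
  rw [adInv_ofAlg a X ha]
  simp [coordXi, coordPlus, coordMinus, coordN, coordF, Ext.ofCoef, ofComp_neg,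
    OPM.ofComp_mul, ofComp_add, ofComp_sub, ofComp_smul, ofComp_inj, zeta_eq_ofComp,
    one_eq_ofComp, eta2_eq_ofComp, SFn.mul_zero, Algebra.smul_def, h2, hs]
  grind

end Coord

end RightAction

/-! ### The left action in components. -/

section LeftAction

variable {𝕜 : Type*} [RCLike 𝕜]

open SFn

open ColorSuper.Smooth (r x D)

/-- Linearity in `X`, which reduces invariance under all of `𝔤` to the basis vectors. -/
lemma leftAct_eq_sum (h f : 𝕜) (X : Gen → 𝕜) :
    leftAct h f X = ∑ Z, X Z • leftAct h f (Pi.single Z 1) := by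
  refine LinearMap.ext fun φ => ?_
  obtain ⟨a, b, c, d, e, f, g, k, rfl⟩ := eq_ofComp φ
  rw [sum_gen]
  simp only [leftAct, rightAct_apply, LinearMap.add_apply, LinearMap.smul_apply,
    coordXi_neg_adInv _ _ rfl, coordPlus_neg_adInv _ _ rfl, coordMinus_neg_adInv _ _ rfl,
    coordN_neg_adInv _ _ rfl, coordF_neg_adInv _ _ rfl]
  simp [OPM.ofComp_mul, ofComp_add, ofComp_smul, ofComp_inj, OPM.d1_ofComp, OPM.d2_ofComp,
    dx_ofComp, Algebra.smul_def]
  refine ⟨?_, ?_, ?_, ?_, ?_, ?_, ?_, ?_⟩ <;> ring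

variable (h f : 𝕜) (p000 p001 p010 p011 p100 p101 p110 p111 : Smooth 𝕜)

/-- In this lemma and its analogues, scalars of `𝕜` are collected in front of products of `x` with
derivatives of components. Intertwining can then be checked by comparing scalars. -/
lemma leftAct_Am : leftAct h f (Pi.single .Am 1)
    (ofComp p000 p001 p010 p011 p100 p101 p110 p111) = ofComp
      (-(4 : 𝕜) • (x 𝕜 * (x 𝕜 * D 𝕜 p000)) - (4 * h) • (x 𝕜 * p000))
      (-(4 : 𝕜) • (x 𝕜 * (x 𝕜 * D 𝕜 p001)) + (-4 - 4 * h) • (x 𝕜 * p001))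
      (-(4 : 𝕜) • (x 𝕜 * (x 𝕜 * D 𝕜 p010)) + (-4 - 4 * h) • (x 𝕜 * p010))
      (-(4 : 𝕜) • (x 𝕜 * (x 𝕜 * D 𝕜 p011)) + (-8 - 4 * h) • (x 𝕜 * p011) + (4 * h + 4 * f) • p000)
      (-(4 : 𝕜) • (x 𝕜 * (x 𝕜 * D 𝕜 p100)) - (4 * h) • (x 𝕜 * p100))
      (-(4 : 𝕜) • (x 𝕜 * (x 𝕜 * D 𝕜 p101)) + (-4 - 4 * h) • (x 𝕜 * p101))
      (-(4 : 𝕜) • (x 𝕜 * (x 𝕜 * D 𝕜 p110)) + (-4 - 4 * h) • (x 𝕜 * p110))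
      (-(4 : 𝕜) • (x 𝕜 * (x 𝕜 * D 𝕜 p111)) + (-8 - 4 * h) • (x 𝕜 * p111) + (4 * h
        + 4 * f) • p100) := by
  rw [leftAct, rightAct_apply, coordXi_neg_adInv _ _ rfl, coordPlus_neg_adInv _ _ rfl,
    coordMinus_neg_adInv _ _ rfl, coordN_neg_adInv _ _ rfl, coordF_neg_adInv _ _ rfl]
  have h2 : algebraMap 𝕜 (Smooth 𝕜) 2 = 2 := map_ofNat _ 2
  have h4 : algebraMap 𝕜 (Smooth 𝕜) 4 = 4 := map_ofNat _ 4
  have h8 : algebraMap 𝕜 (Smooth 𝕜) 8 = 8 := map_ofNat _ 8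
  have hs : algebraMap 𝕜 (Smooth 𝕜) (invSqrtTwo 𝕜) = r 𝕜 := rfl
  simp [OPM.ofComp_mul, ofComp_add, ofComp_smul, ofComp_inj, OPM.d1_ofComp, OPM.d2_ofComp,
    dx_ofComp, Algebra.smul_def, h2, h4, h8, hs]
  grind

lemma leftAct_Ap : leftAct h f (Pi.single .Ap 1)
    (ofComp p000 p001 p010 p011 p100 p101 p110 p111) = ofComp
      (-D 𝕜 p000)
      (-D 𝕜 p001)
      (-D 𝕜 p010)
      (-D 𝕜 p011)
      (-D 𝕜 p100)
      (-D 𝕜 p101)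
      (-D 𝕜 p110)
      (-D 𝕜 p111) := by
  rw [leftAct, rightAct_apply, coordXi_neg_adInv _ _ rfl, coordPlus_neg_adInv _ _ rfl,
    coordMinus_neg_adInv _ _ rfl, coordN_neg_adInv _ _ rfl, coordF_neg_adInv _ _ rfl]
  have h2 : algebraMap 𝕜 (Smooth 𝕜) 2 = 2 := map_ofNat _ 2
  have h4 : algebraMap 𝕜 (Smooth 𝕜) 4 = 4 := map_ofNat _ 4
  have h8 : algebraMap 𝕜 (Smooth 𝕜) 8 = 8 := map_ofNat _ 8
  have hs : algebraMap 𝕜 (Smooth 𝕜) (invSqrtTwo 𝕜) = r 𝕜 := rfl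
  simp [OPM.ofComp_mul, ofComp_add, ofComp_smul, ofComp_inj, OPM.d1_ofComp, OPM.d2_ofComp,
    dx_ofComp, Algebra.smul_def, h2, h4, h8, hs]

lemma leftAct_N : leftAct h f (Pi.single .N 1)
    (ofComp p000 p001 p010 p011 p100 p101 p110 p111) = ofComp
      (-(2 : 𝕜) • (x 𝕜 * D 𝕜 p000) - h • p000)
      (-(2 : 𝕜) • (x 𝕜 * D 𝕜 p001) + (-1 - h) • p001)
      (-(2 : 𝕜) • (x 𝕜 * D 𝕜 p010) + (-1 - h) • p010)
      (-(2 : 𝕜) • (x 𝕜 * D 𝕜 p011) + (-2 - h) • p011)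
      (-(2 : 𝕜) • (x 𝕜 * D 𝕜 p100) - h • p100)
      (-(2 : 𝕜) • (x 𝕜 * D 𝕜 p101) + (-1 - h) • p101)
      (-(2 : 𝕜) • (x 𝕜 * D 𝕜 p110) + (-1 - h) • p110)
      (-(2 : 𝕜) • (x 𝕜 * D 𝕜 p111) + (-2 - h) • p111) := by
  rw [leftAct, rightAct_apply, coordXi_neg_adInv _ _ rfl, coordPlus_neg_adInv _ _ rfl,
    coordMinus_neg_adInv _ _ rfl, coordN_neg_adInv _ _ rfl, coordF_neg_adInv _ _ rfl]
  have h2 : algebraMap 𝕜 (Smooth 𝕜) 2 = 2 := map_ofNat _ 2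
  have h4 : algebraMap 𝕜 (Smooth 𝕜) 4 = 4 := map_ofNat _ 4
  have h8 : algebraMap 𝕜 (Smooth 𝕜) 8 = 8 := map_ofNat _ 8
  have hs : algebraMap 𝕜 (Smooth 𝕜) (invSqrtTwo 𝕜) = r 𝕜 := rfl
  simp [OPM.ofComp_mul, ofComp_add, ofComp_smul, ofComp_inj, OPM.d1_ofComp, OPM.d2_ofComp,
    dx_ofComp, Algebra.smul_def, h2, h4, h8, hs]
  grind

lemma leftAct_bm : leftAct h f (Pi.single .bm 1)
    (ofComp p000 p001 p010 p011 p100 p101 p110 p111) = ofComp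
      (-(2 * invSqrtTwo 𝕜) • (x 𝕜 * p101) + (2 * invSqrtTwo 𝕜) • (x 𝕜 * p110))
      ((2 * invSqrtTwo 𝕜) • (x 𝕜 * p111) + (-2 * invSqrtTwo 𝕜 * h - 2 * invSqrtTwo 𝕜 * f) • p100)
      ((4 * invSqrtTwo 𝕜) • (x 𝕜 * D 𝕜 p100) + (2 * invSqrtTwo 𝕜) • (x 𝕜 * p111)
        + (2 * invSqrtTwo 𝕜 * h - 2 * invSqrtTwo 𝕜 * f) • p100)
      ((4 * invSqrtTwo 𝕜) • (x 𝕜 * D 𝕜 p101) + (4 * invSqrtTwo 𝕜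
        + 2 * invSqrtTwo 𝕜 * h - 2 * invSqrtTwo 𝕜 * f) • p101 + (2 * invSqrtTwo 𝕜 * h + 2 * invSqrtTwo 𝕜 *
        f) • p110)
      ((2 * invSqrtTwo 𝕜) • (x 𝕜 * p001) - (2 * invSqrtTwo 𝕜) • (x 𝕜 * p010))
      (-(2 * invSqrtTwo 𝕜) • (x 𝕜 * p011) + (2 * invSqrtTwo 𝕜 * h + 2 * invSqrtTwo 𝕜 * f) • p000)
      (-(4 * invSqrtTwo 𝕜) • (x 𝕜 * D 𝕜 p000) - (2 * invSqrtTwo 𝕜) • (x 𝕜 * p011)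
        + (-2 * invSqrtTwo 𝕜 * h + 2 * invSqrtTwo 𝕜 * f) • p000)
      (-(4 * invSqrtTwo 𝕜) • (x 𝕜 * D 𝕜 p001) + (-4 * invSqrtTwo 𝕜 - 2 * invSqrtTwo 𝕜 * h
        + 2 * invSqrtTwo 𝕜 * f) • p001 + (-2 * invSqrtTwo 𝕜 * h - 2 * invSqrtTwo 𝕜
        * f) • p010) := by
  rw [leftAct, rightAct_apply, coordXi_neg_adInv _ _ rfl, coordPlus_neg_adInv _ _ rfl,
    coordMinus_neg_adInv _ _ rfl, coordN_neg_adInv _ _ rfl, coordF_neg_adInv _ _ rfl]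
  have h2 : algebraMap 𝕜 (Smooth 𝕜) 2 = 2 := map_ofNat _ 2
  have h4 : algebraMap 𝕜 (Smooth 𝕜) 4 = 4 := map_ofNat _ 4
  have h8 : algebraMap 𝕜 (Smooth 𝕜) 8 = 8 := map_ofNat _ 8
  have hs : algebraMap 𝕜 (Smooth 𝕜) (invSqrtTwo 𝕜) = r 𝕜 := rfl
  simp [OPM.ofComp_mul, ofComp_add, ofComp_smul, ofComp_inj, OPM.d1_ofComp, OPM.d2_ofComp,
    dx_ofComp, Algebra.smul_def, h2, h4, h8, hs]
  grind

lemma leftAct_bp : leftAct h f (Pi.single .bp 1)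
    (ofComp p000 p001 p010 p011 p100 p101 p110 p111) = ofComp
      (-invSqrtTwo 𝕜 • p101 + invSqrtTwo 𝕜 • p110)
      (invSqrtTwo 𝕜 • p111)
      ((2 * invSqrtTwo 𝕜) • (D 𝕜 p100) + invSqrtTwo 𝕜 • p111)
      ((2 * invSqrtTwo 𝕜) • (D 𝕜 p101))
      (invSqrtTwo 𝕜 • p001 - invSqrtTwo 𝕜 • p010)
      (-invSqrtTwo 𝕜 • p011)
      (-(2 * invSqrtTwo 𝕜) • (D 𝕜 p000) - invSqrtTwo 𝕜 • p011)
      (-(2 * invSqrtTwo 𝕜) • (D 𝕜 p001)) := by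
  rw [leftAct, rightAct_apply, coordXi_neg_adInv _ _ rfl, coordPlus_neg_adInv _ _ rfl,
    coordMinus_neg_adInv _ _ rfl, coordN_neg_adInv _ _ rfl, coordF_neg_adInv _ _ rfl]
  have h2 : algebraMap 𝕜 (Smooth 𝕜) 2 = 2 := map_ofNat _ 2
  have h4 : algebraMap 𝕜 (Smooth 𝕜) 4 = 4 := map_ofNat _ 4
  have h8 : algebraMap 𝕜 (Smooth 𝕜) 8 = 8 := map_ofNat _ 8
  have hs : algebraMap 𝕜 (Smooth 𝕜) (invSqrtTwo 𝕜) = r 𝕜 := rfl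
  simp [OPM.ofComp_mul, ofComp_add, ofComp_smul, ofComp_inj, OPM.d1_ofComp, OPM.d2_ofComp,
    dx_ofComp, Algebra.smul_def, h2, h4, h8, hs]
  grind

lemma leftAct_am : leftAct h f (Pi.single .am 1)
    (ofComp p000 p001 p010 p011 p100 p101 p110 p111) = ofComp
      (-(2 * invSqrtTwo 𝕜) • (x 𝕜 * p001) - (2 * invSqrtTwo 𝕜) • (x 𝕜 * p010))
      (-(2 * invSqrtTwo 𝕜) • (x 𝕜 * p011) + (2 * invSqrtTwo 𝕜 * h + 2 * invSqrtTwo 𝕜 * f) • p000)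
      ((4 * invSqrtTwo 𝕜) • (x 𝕜 * D 𝕜 p000) + (2 * invSqrtTwo 𝕜) • (x 𝕜 * p011)
        + (2 * invSqrtTwo 𝕜 * h - 2 * invSqrtTwo 𝕜 * f) • p000)
      ((4 * invSqrtTwo 𝕜) • (x 𝕜 * D 𝕜 p001) + (4 * invSqrtTwo 𝕜
        + 2 * invSqrtTwo 𝕜 * h - 2 * invSqrtTwo 𝕜 * f) • p001 + (-2 * invSqrtTwo 𝕜 * h - 2 * invSqrtTwo 𝕜 *
        f) • p010)
      ((2 * invSqrtTwo 𝕜) • (x 𝕜 * p101) + (2 * invSqrtTwo 𝕜) • (x 𝕜 * p110))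
      ((2 * invSqrtTwo 𝕜) • (x 𝕜 * p111) + (-2 * invSqrtTwo 𝕜 * h - 2 * invSqrtTwo 𝕜 * f) • p100)
      (-(4 * invSqrtTwo 𝕜) • (x 𝕜 * D 𝕜 p100) - (2 * invSqrtTwo 𝕜) • (x 𝕜 * p111)
        + (-2 * invSqrtTwo 𝕜 * h + 2 * invSqrtTwo 𝕜 * f) • p100)
      (-(4 * invSqrtTwo 𝕜) • (x 𝕜 * D 𝕜 p101) + (-4 * invSqrtTwo 𝕜 - 2 * invSqrtTwo 𝕜 * h
        + 2 * invSqrtTwo 𝕜 * f) • p101 + (2 * invSqrtTwo 𝕜 * h + 2 * invSqrtTwo 𝕜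
        * f) • p110) := by
  rw [leftAct, rightAct_apply, coordXi_neg_adInv _ _ rfl, coordPlus_neg_adInv _ _ rfl,
    coordMinus_neg_adInv _ _ rfl, coordN_neg_adInv _ _ rfl, coordF_neg_adInv _ _ rfl]
  have h2 : algebraMap 𝕜 (Smooth 𝕜) 2 = 2 := map_ofNat _ 2
  have h4 : algebraMap 𝕜 (Smooth 𝕜) 4 = 4 := map_ofNat _ 4
  have h8 : algebraMap 𝕜 (Smooth 𝕜) 8 = 8 := map_ofNat _ 8
  have hs : algebraMap 𝕜 (Smooth 𝕜) (invSqrtTwo 𝕜) = r 𝕜 := rfl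
  simp [OPM.ofComp_mul, ofComp_add, ofComp_smul, ofComp_inj, OPM.d1_ofComp, OPM.d2_ofComp,
    dx_ofComp, Algebra.smul_def, h2, h4, h8, hs]
  grind

lemma leftAct_ap : leftAct h f (Pi.single .ap 1)
    (ofComp p000 p001 p010 p011 p100 p101 p110 p111) = ofComp
      (-invSqrtTwo 𝕜 • p001 - invSqrtTwo 𝕜 • p010)
      (-invSqrtTwo 𝕜 • p011)
      ((2 * invSqrtTwo 𝕜) • (D 𝕜 p000) + invSqrtTwo 𝕜 • p011)
      ((2 * invSqrtTwo 𝕜) • (D 𝕜 p001))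
      (invSqrtTwo 𝕜 • p101 + invSqrtTwo 𝕜 • p110)
      (invSqrtTwo 𝕜 • p111)
      (-(2 * invSqrtTwo 𝕜) • (D 𝕜 p100) - invSqrtTwo 𝕜 • p111)
      (-(2 * invSqrtTwo 𝕜) • (D 𝕜 p101)) := by
  rw [leftAct, rightAct_apply, coordXi_neg_adInv _ _ rfl, coordPlus_neg_adInv _ _ rfl,
    coordMinus_neg_adInv _ _ rfl, coordN_neg_adInv _ _ rfl, coordF_neg_adInv _ _ rfl]
  have h2 : algebraMap 𝕜 (Smooth 𝕜) 2 = 2 := map_ofNat _ 2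
  have h4 : algebraMap 𝕜 (Smooth 𝕜) 4 = 4 := map_ofNat _ 4
  have h8 : algebraMap 𝕜 (Smooth 𝕜) 8 = 8 := map_ofNat _ 8
  have hs : algebraMap 𝕜 (Smooth 𝕜) (invSqrtTwo 𝕜) = r 𝕜 := rfl
  simp [OPM.ofComp_mul, ofComp_add, ofComp_smul, ofComp_inj, OPM.d1_ofComp, OPM.d2_ofComp,
    dx_ofComp, Algebra.smul_def, h2, h4, h8, hs]
  grind

lemma leftAct_F : leftAct h f (Pi.single .F 1)
    (ofComp p000 p001 p010 p011 p100 p101 p110 p111) = ofComp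
      (-(2 * f) • p100)
      ((2 - 2 * f) • p101)
      ((-2 - 2 * f) • p110)
      (-(2 * f) • p111)
      (-(2 * f) • p000)
      ((2 - 2 * f) • p001)
      ((-2 - 2 * f) • p010)
      (-(2 * f) • p011) := by
  rw [leftAct, rightAct_apply, coordXi_neg_adInv _ _ rfl, coordPlus_neg_adInv _ _ rfl,
    coordMinus_neg_adInv _ _ rfl, coordN_neg_adInv _ _ rfl, coordF_neg_adInv _ _ rfl]
  have h2 : algebraMap 𝕜 (Smooth 𝕜) 2 = 2 := map_ofNat _ 2
  have h4 : algebraMap 𝕜 (Smooth 𝕜) 4 = 4 := map_ofNat _ 4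
  have h8 : algebraMap 𝕜 (Smooth 𝕜) 8 = 8 := map_ofNat _ 8
  have hs : algebraMap 𝕜 (Smooth 𝕜) (invSqrtTwo 𝕜) = r 𝕜 := rfl
  simp [OPM.ofComp_mul, ofComp_add, ofComp_smul, ofComp_inj, OPM.d1_ofComp, OPM.d2_ofComp,
    dx_ofComp, Algebra.smul_def, h2, h4, h8, hs]
  grind

end LeftAction

/-! ### The intertwining relations. -/

section Intertwine

variable {𝕜 : Type*} [RCLike 𝕜]

open SFn

open ColorSuper.Smooth (r x D)

/-- `∂/∂ψ₋` sees only the components containing `ψ₋`. The operators `π_L(X)` feed `ψ₋`-free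
components into these only with the factor `h + f`, which vanishes here. -/
lemma intertwines_d2 (h f : 𝕜) (hf : h = -f) :
    Intertwines (0, 1) (d2 : Module.End 𝕜 (OPM 𝕜)) h f (h + 1) (f - 1) := by
  subst hf
  intro X φ
  obtain ⟨a, b, c, d, e, g, k, l, rfl⟩ := eq_ofComp φ
  cases X <;> simp only [Gen.deg, csign, val_one2, ZMod.val_zero, mul_zero, mul_one, add_zero,
    zero_add, pow_zero, pow_one, Int.cast_neg, Int.cast_one, OPM.d2_ofComp, leftAct_Am,
    leftAct_Ap, leftAct_N, leftAct_bm, leftAct_bp, leftAct_am, leftAct_ap, leftAct_F, ofComp_smul,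
    ofComp_inj, map_add, map_sub, map_neg, map_smul, map_zero, mul_add, mul_sub, mul_neg,
    mul_smul_comm] <;>
  exact ⟨by module, by module, by module, by module, by module, by module, by module, by module⟩

lemma intertwines_nabla (h f : 𝕜) (hf : h = f) :
    Intertwines (0, 1) (nabla : Module.End 𝕜 (OPM 𝕜)) h f (h + 1) (f + 1) := by
  subst hf
  intro X φ
  obtain ⟨a, b, c, d, e, g, k, l, rfl⟩ := eq_ofComp φ
  cases X <;> simp only [Gen.deg, csign, val_one2, ZMod.val_zero, mul_zero, mul_one, add_zero,
    zero_add, pow_zero, pow_one, Int.cast_neg, Int.cast_one, OPM.nabla_ofComp, leftAct_Am,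
    leftAct_Ap, leftAct_N, leftAct_bm, leftAct_bp, leftAct_am, leftAct_ap, leftAct_F, ofComp_smul,
    ofComp_inj, map_add, map_sub, map_neg, map_smul, map_zero, mul_add, mul_sub, mul_neg,
    mul_smul_comm, Smooth.D_mul, Smooth.D_x, one_mul] <;>
  exact ⟨by module, by module, by module, by module, by module, by module, by module, by module⟩

lemma Smooth.D_pow_comm (m : ℕ) (p : Smooth 𝕜) : D 𝕜 ((D 𝕜 ^ m) p) = (D 𝕜 ^ m) (D 𝕜 p) := by
  rw [← Module.End.mul_apply, ← Module.End.mul_apply, ← pow_succ', pow_succ]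

/-- Leibniz rule with `x'' = 0`. At `m = 0` the truncated exponent `m - 1` is harmless because its
coefficient is zero. -/
lemma Smooth.D_pow_x_mul (m : ℕ) (p : Smooth 𝕜) :
    (D 𝕜 ^ m) (x 𝕜 * p) = x 𝕜 * (D 𝕜 ^ m) p + (m : 𝕜) • (D 𝕜 ^ (m - 1)) p := by
  induction m with
  | zero => simp
  | succ m ih =>
    rw [pow_succ', Module.End.mul_apply, ih, map_add, map_smul, D_mul, D_x, Module.End.mul_apply]
    rcases m with _ | m
    · simp [add_comm]
    · simp only [Nat.add_sub_cancel, pow_succ, Module.End.mul_apply, D_pow_comm, one_mul]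
      push_cast
      module

lemma Smooth.D_pow_x_mul_D (m : ℕ) (p : Smooth 𝕜) :
    (D 𝕜 ^ m) (x 𝕜 * D 𝕜 p) = x 𝕜 * (D 𝕜 ^ m) (D 𝕜 p) + (m : 𝕜) • (D 𝕜 ^ m) p := by
  rw [D_pow_x_mul]
  rcases m with _ | m
  · simp
  · rw [Nat.add_sub_cancel, ← Module.End.mul_apply (D 𝕜 ^ m), ← pow_succ]

lemma Smooth.D_pow_x_mul_x_mul_D (m : ℕ) (p : Smooth 𝕜) :
    (D 𝕜 ^ m) (x 𝕜 * (x 𝕜 * D 𝕜 p)) = x 𝕜 * (x 𝕜 * (D 𝕜 ^ m) (D 𝕜 p)) +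
      (2 * m : 𝕜) • (x 𝕜 * (D 𝕜 ^ m) p) + (m * m - m : 𝕜) • (D 𝕜 ^ (m - 1)) p := by
  rcases m with _ | m
  · simp
  · rw [D_pow_x_mul, Nat.add_sub_cancel, D_pow_x_mul_D, D_pow_x_mul_D, mul_add, mul_smul_comm,
      smul_add, ← Module.End.mul_apply (D 𝕜 ^ m), ← pow_succ]
    push_cast
    module

/-- The coefficient `m² - m` is needed at `m = 0`, where `m - 1` truncates to `0` and the two
derivatives differ. -/
lemma Smooth.smul_D_pow_pred_D (m : ℕ) (p : Smooth 𝕜) :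
    (m * m - m : 𝕜) • (D 𝕜 ^ (m - 1)) (D 𝕜 p) = (m * m - m : 𝕜) • (D 𝕜 ^ m) p := by
  rcases m with _ | m
  · simp
  · rw [Nat.add_sub_cancel, ← Module.End.mul_apply (D 𝕜 ^ m), ← pow_succ]

lemma dx_pow_ofComp {α β : Grade} (m : ℕ) (a b c d e f g k : Smooth 𝕜) :
    (dx ^ m) (ofComp a b c d e f g k : SFn 𝕜 α β) =
      ofComp ((D 𝕜 ^ m) a) ((D 𝕜 ^ m) b) ((D 𝕜 ^ m) c) ((D 𝕜 ^ m) d) ((D 𝕜 ^ m) e)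
        ((D 𝕜 ^ m) f) ((D 𝕜 ^ m) g) ((D 𝕜 ^ m) k) := by
  induction m with
  | zero => rfl
  | succ m ih =>
    rw [pow_succ', Module.End.mul_apply, ih, dx_ofComp]
    simp only [pow_succ', Module.End.mul_apply]

/-- Stated for any scalar `q` and with all derivatives moved next to the components, so that the
Leibniz formulas above apply directly. -/
lemma levelOp_succ_ofComp (m : ℕ) (a b c d e f g k : Smooth 𝕜) (q : 𝕜) :
    (dx + q • (nabla * d2) : Module.End 𝕜 (OPM 𝕜)) ((dx ^ m) (ofComp a b c d e f g k : OPM 𝕜)) = ofComp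
      ((D 𝕜 ^ m) (D 𝕜 a) - q • (D 𝕜 ^ m) d)
      ((D 𝕜 ^ m) (D 𝕜 b) + (2 * q) • (D 𝕜 ^ m) (D 𝕜 b))
      ((D 𝕜 ^ m) (D 𝕜 c))
      ((D 𝕜 ^ m) (D 𝕜 d) + (2 * q) • (D 𝕜 ^ m) (D 𝕜 d))
      ((D 𝕜 ^ m) (D 𝕜 e) - q • (D 𝕜 ^ m) k)
      ((D 𝕜 ^ m) (D 𝕜 f) + (2 * q) • (D 𝕜 ^ m) (D 𝕜 f))
      ((D 𝕜 ^ m) (D 𝕜 g))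
      ((D 𝕜 ^ m) (D 𝕜 k) + (2 * q) • (D 𝕜 ^ m) (D 𝕜 k)) := by
  rw [dx_pow_ofComp, LinearMap.add_apply, LinearMap.smul_apply, Module.End.mul_apply,
    OPM.d2_ofComp, OPM.nabla_ofComp, dx_ofComp, ofComp_smul, ofComp_add, ofComp_inj]
  simp only [map_neg, map_zero, Smooth.D_pow_comm]
  exact ⟨by module, by module, by module, by module, by module, by module, by module, by module⟩

lemma intertwines_levelOp (n : ℕ) (h f : 𝕜) (hn : 1 ≤ n) (hh : h = -(n : 𝕜)) (hf : f ≠ n) :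
    Intertwines (0, 0) (levelOp n f) h f (h + 2 * n) f := by
  obtain ⟨m, rfl⟩ := Nat.exists_eq_add_of_le' hn
  have hq : ((m + 1 : ℕ) : 𝕜) / (f - (m + 1 : ℕ)) * (f - (m + 1 : ℕ)) = (m + 1 : ℕ) :=
    div_mul_cancel₀ _ (sub_ne_zero.2 hf)
  subst hh
  intro X φ
  obtain ⟨a, b, c, d, e, g, k, l, rfl⟩ := eq_ofComp φ
  rw [levelOp, Module.End.mul_apply, Module.End.mul_apply, Nat.add_sub_cancel]
  -- From here the fraction is known only through `q (f - (m + 1)) = m + 1`, so no division remains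
  -- in the scalar identities.
  generalize ((m + 1 : ℕ) : 𝕜) / (f - (m + 1 : ℕ)) = q at hq ⊢
  push_cast at hq ⊢
  cases X <;> simp only [Gen.deg, csign, val_one2, ZMod.val_zero, mul_zero, mul_one, add_zero,
    zero_add, pow_zero, pow_one, Int.cast_neg, Int.cast_one, levelOp_succ_ofComp, leftAct_Am,
    leftAct_Ap, leftAct_N, leftAct_bm, leftAct_bp, leftAct_am, leftAct_ap, leftAct_F, ofComp_smul,
    ofComp_inj, map_add, map_sub, map_neg, map_smul, map_zero, mul_add, mul_sub, mul_neg,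
    mul_smul_comm, Smooth.D_mul, Smooth.D_x, one_mul, Smooth.D_pow_comm, Smooth.D_pow_x_mul_D,
    Smooth.D_pow_x_mul_x_mul_D,
    Smooth.smul_D_pow_pred_D] <;>
  -- Delayed on purpose: the general rule also matches `x * D p` and would leave `D^(m-1) (D p)`
  -- instead of `D^m p`.
  (try simp only [Smooth.D_pow_x_mul]) <;>
  refine ⟨?_, ?_, ?_, ?_, ?_, ?_, ?_, ?_⟩ <;> match_scalars <;> grind

end Intertwine

/-! ### Invariance of the kernels. -/

section Invariance

variable {𝕜 : Type*} [RCLike 𝕜]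

open SFn

open ColorSuper.Smooth (r x D)

/-- The operators that preserve `ker E` form a subalgebra, so the generators suffice. For `π_L(X)`
this is the intertwining relation; for `ζ` it is enough that `E` commutes with it up to sign. -/
lemma isInvariantEquation_of_intertwines {δ : Grade} {E : Module.End 𝕜 (OPM 𝕜)} {h f h' f' : 𝕜}
    (hE : Intertwines δ E h f h' f') (hz : ∀ φ, E (mulL zeta φ) = -mulL zeta (E φ) ∨
      E (mulL zeta φ) = mulL zeta (E φ)) : IsInvariantEquation h f E := by
  intro T hT
  induction hT using Algebra.adjoin_induction with
  | mem T hT =>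
    intro φ hφ
    rcases hT with rfl | ⟨X, rfl⟩
    · rcases hz φ with h | h <;> rw [h, hφ, map_zero]
      rw [neg_zero]
    · rw [leftAct_eq_sum, LinearMap.sum_apply, map_sum]
      refine Finset.sum_eq_zero fun Z _ => ?_
      rw [LinearMap.smul_apply, map_smul, hE, hφ, map_zero, smul_zero, smul_zero]
  | algebraMap c =>
    intro φ hφ
    rw [Module.algebraMap_end_apply, map_smul, hφ, smul_zero]
  | add S T _ _ hS hT =>
    intro φ hφ
    rw [LinearMap.add_apply, map_add, hS φ hφ, hT φ hφ, add_zero]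
  | mul S T _ _ hS hT =>
    intro φ hφ
    exact hS _ (hT φ hφ)

lemma OPM.mulL_zeta_ofComp (a b c d e f g k : Smooth 𝕜) :
    mulL zeta (ofComp a b c d e f g k : OPM 𝕜) = ofComp e f g k a b c d := by
  change zeta * _ = _
  rw [zeta_eq_ofComp, OPM.ofComp_mul, ofComp_inj]
  simp

lemma d2_mulL_zeta (φ : OPM 𝕜) : d2 (mulL zeta φ) = -mulL zeta (d2 φ) := by
  obtain ⟨a, b, c, d, e, f, g, k, rfl⟩ := eq_ofComp φ
  simp [OPM.mulL_zeta_ofComp, OPM.d2_ofComp, ofComp_neg]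

lemma nabla_mulL_zeta (φ : OPM 𝕜) : nabla (mulL zeta φ) = -mulL zeta (nabla φ) := by
  obtain ⟨a, b, c, d, e, f, g, k, rfl⟩ := eq_ofComp φ
  simp [OPM.mulL_zeta_ofComp, OPM.nabla_ofComp, ofComp_neg, ofComp_inj, add_comm, ← sub_eq_add_neg]

lemma dx_pow_mulL_zeta (m : ℕ) (φ : OPM 𝕜) : (dx ^ m) (mulL zeta φ) = mulL zeta ((dx ^ m) φ) := by
  obtain ⟨a, b, c, d, e, f, g, k, rfl⟩ := eq_ofComp φ
  simp only [OPM.mulL_zeta_ofComp, dx_pow_ofComp]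

lemma levelOp_mulL_zeta (n : ℕ) (f : 𝕜) (φ : OPM 𝕜) :
    levelOp n f (mulL zeta φ) = mulL zeta (levelOp n f φ) := by
  have h := dx_pow_mulL_zeta (𝕜 := 𝕜) 1
  rw [pow_one] at h
  simp only [levelOp, Module.End.mul_apply, dx_pow_mulL_zeta, LinearMap.add_apply,
    LinearMap.smul_apply, d2_mulL_zeta, map_neg, nabla_mulL_zeta, neg_neg, h, map_add, map_smul]

end Invariance

/-! ### The variables `ψ` and `θ`. -/

section ChangeVars

variable {𝕜 : Type*} [RCLike 𝕜]

open SFn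

open ColorSuper.Smooth (r x D)

/-- Since `ψ₊ ψ₋ = ζ ψ θ`, the coefficients of `ψ₊ ψ₋` and `ζ ψ₊ ψ₋` move to `ζ ψ θ` and `ψ θ`. The
terms linear in `ψ₊, ψ₋` are mixed in pairs by rotations and reflections through 45°. -/
lemma changeVars_ofComp (a b c d e f g k : Smooth 𝕜) :
    changeVars (ofComp a b c d e f g k : OPM 𝕜) = ofComp a
      (invSqrtTwo 𝕜 • (g - f)) (invSqrtTwo 𝕜 • (c + b)) k e
      (invSqrtTwo 𝕜 • (c - b)) (invSqrtTwo 𝕜 • (g + f)) d := by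
  have hr := Smooth.two_mul_r_sq (𝕜 := 𝕜)
  have hs : algebraMap 𝕜 (Smooth 𝕜) (invSqrtTwo 𝕜) = r 𝕜 := rfl
  have h0 : (ofComp a b c d e f g k : OPM 𝕜) (0, 0, 0) = a := rfl
  have h1 : (ofComp a b c d e f g k : OPM 𝕜) (0, 0, 1) = b := rfl
  have h2 : (ofComp a b c d e f g k : OPM 𝕜) (0, 1, 0) = c := rfl
  have h3 : (ofComp a b c d e f g k : OPM 𝕜) (0, 1, 1) = d := rfl
  have h4 : (ofComp a b c d e f g k : OPM 𝕜) (1, 0, 0) = e := rfl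
  have h5 : (ofComp a b c d e f g k : OPM 𝕜) (1, 0, 1) = f := rfl
  have h6 : (ofComp a b c d e f g k : OPM 𝕜) (1, 1, 0) = g := rfl
  have h7 : (ofComp a b c d e f g k : OPM 𝕜) (1, 1, 1) = k := rfl
  simp only [changeVars, Fintype.sum_prod_type, Fin.sum_univ_two, h0, h1, h2, h3, h4, h5, h6, h7,
    psiPlusT, psiMinusT, if_true, one_ne_zero, if_false, zeta_eq_ofComp, one_eq_ofComp,
    eta1_eq_ofComp, eta2_eq_ofComp]
  simp [OPT.ofComp_mul, ofComp_add, ofComp_sub, ofComp_smul, ofComp_inj, smooth_smul_ofComp,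
    Algebra.smul_def, hs]
  grind

lemma two_invSqrtTwo_ne_zero : (2 * invSqrtTwo 𝕜 : 𝕜) ≠ 0 := by
  intro h
  have h' := invSqrtTwo_sq (𝕜 := 𝕜)
  rw [(mul_eq_zero.1 h).resolve_left two_ne_zero, mul_zero] at h'
  exact inv_ne_zero two_ne_zero h'.symm

lemma changeVars_bijective : Function.Bijective (changeVars : OPM 𝕜 → OPT 𝕜) := by
  have hr := Smooth.two_mul_r_sq (𝕜 := 𝕜)
  have hs : algebraMap 𝕜 (Smooth 𝕜) (invSqrtTwo 𝕜) = r 𝕜 := rfl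
  constructor
  · intro φ φ' h
    obtain ⟨a, b, c, d, e, f, g, k, rfl⟩ := eq_ofComp φ
    obtain ⟨a', b', c', d', e', f', g', k', rfl⟩ := eq_ofComp φ'
    simp only [changeVars_ofComp, ofComp_inj, Algebra.smul_def, hs] at h ⊢
    obtain ⟨h0, h1, h2, h3, h4, h5, h6, h7⟩ := h
    refine ⟨h0, ?_, ?_, h7, h4, ?_, ?_, h3⟩ <;> grind
  · intro u
    obtain ⟨a, b, c, d, e, f, g, k, rfl⟩ := eq_ofComp u
    -- Each `2 × 2` block of the substitution is orthogonal up to reordering of components, so these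
    -- components are read off from its transpose.
    refine ⟨ofComp a (invSqrtTwo 𝕜 • (c - f)) (invSqrtTwo 𝕜 • (c + f)) k e
      (invSqrtTwo 𝕜 • (g - b)) (invSqrtTwo 𝕜 • (g + b)) d, ?_⟩
    simp only [changeVars_ofComp, ofComp_inj, Algebra.smul_def, hs]
    refine ⟨trivial, ?_, ?_, trivial, trivial, ?_, ?_, trivial⟩ <;> grind

lemma changeVars_eq_zero {φ : OPM 𝕜} : changeVars φ = 0 ↔ φ = 0 := by
  have h0 : changeVars (0 : OPM 𝕜) = 0 := by
    rw [zero_eq_ofComp, changeVars_ofComp, zero_eq_ofComp]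
    simp
  rw [← h0]
  exact changeVars_bijective.1.eq_iff

/-- Chain rule: `∂_θ (ζ θ) = -ζ` makes `ζ ∂_θ` act as `(∂_{ψ₋} - ∂_{ψ₊})/√2`, and `∂_ψ` acts as the
corresponding sum. The scalar `2/√2` is `√2`. -/
lemma minusOpT_changeVars (φ : OPM 𝕜) :
    minusOpT (changeVars φ) = (2 * invSqrtTwo 𝕜) • changeVars (d2 φ) := by
  have hr := Smooth.two_mul_r_sq (𝕜 := 𝕜)
  have h2 : algebraMap 𝕜 (Smooth 𝕜) 2 = 2 := map_ofNat _ 2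
  have hs : algebraMap 𝕜 (Smooth 𝕜) (invSqrtTwo 𝕜) = r 𝕜 := rfl
  obtain ⟨a, b, c, d, e, f, g, k, rfl⟩ := eq_ofComp φ
  simp only [minusOpT, mulL, LinearMap.add_apply, Module.End.mul_apply, LinearMap.coe_mk,
    AddHom.coe_mk, changeVars_ofComp, OPT.d1_ofComp, OPT.d2_ofComp, OPM.d2_ofComp, zeta_eq_ofComp,
    OPT.ofComp_mul, ofComp_add, ofComp_smul, ofComp_inj, Algebra.smul_def, hs, h2, map_mul]
  refine ⟨?_, ?_, ?_, ?_, ?_, ?_, ?_, ?_⟩ <;> grind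

/-- The same chain rule gives `∂_ψ - ζ ∂_θ = √2 ∂_{ψ₊}`, and `ψ - ζ θ = √2 ψ₋` supplies the same
factor in the last term. -/
lemma plusOpT_changeVars (φ : OPM 𝕜) :
    plusOpT (changeVars φ) = (2 * invSqrtTwo 𝕜) • changeVars (nabla φ) := by
  have hr := Smooth.two_mul_r_sq (𝕜 := 𝕜)
  have h2 : algebraMap 𝕜 (Smooth 𝕜) 2 = 2 := map_ofNat _ 2
  have hs : algebraMap 𝕜 (Smooth 𝕜) (invSqrtTwo 𝕜) = r 𝕜 := rfl
  obtain ⟨a, b, c, d, e, f, g, k, rfl⟩ := eq_ofComp φ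
  simp only [plusOpT, mulL, LinearMap.add_apply, LinearMap.sub_apply, LinearMap.smul_apply,
    Module.End.mul_apply, LinearMap.coe_mk, eta1_eq_ofComp, eta2_eq_ofComp,
    AddHom.coe_mk, changeVars_ofComp, OPT.d1_ofComp, OPT.d2_ofComp, OPM.nabla_ofComp,
    zeta_eq_ofComp, dx_ofComp, map_smul, map_add, map_sub,
    OPT.ofComp_mul, ofComp_add, ofComp_sub, ofComp_smul, ofComp_inj]
  simp only [Algebra.smul_def, hs, h2, map_mul]
  refine ⟨?_, ?_, ?_, ?_, ?_, ?_, ?_, ?_⟩ <;> grind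

lemma dx_changeVars (φ : OPM 𝕜) : dx (changeVars φ) = changeVars (dx φ) := by
  obtain ⟨a, b, c, d, e, f, g, k, rfl⟩ := eq_ofComp φ
  simp only [changeVars_ofComp, dx_ofComp, map_smul, map_add, map_sub]

lemma dx_pow_changeVars (m : ℕ) (φ : OPM 𝕜) :
    (dx ^ m) (changeVars φ) = changeVars ((dx ^ m) φ) := by
  induction m with
  | zero => rfl
  | succ m ih => rw [pow_succ', pow_succ', Module.End.mul_apply, Module.End.mul_apply, ih,
      dx_changeVars]

lemma levelOpT_changeVars (n : ℕ) (f : 𝕜) (φ : OPM 𝕜) :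
    levelOpT n f (changeVars φ) = changeVars (levelOp n f φ) := by
  have hr := Smooth.two_mul_r_sq (𝕜 := 𝕜)
  have h2 : algebraMap 𝕜 (Smooth 𝕜) 2 = 2 := map_ofNat _ 2
  have hs : algebraMap 𝕜 (Smooth 𝕜) (invSqrtTwo 𝕜) = r 𝕜 := rfl
  rw [levelOp, levelOpT, Module.End.mul_apply, Module.End.mul_apply, dx_pow_changeVars]
  -- The transported operator agrees for every scalar in place of the fraction; its value plays no
  -- role.
  generalize (n : 𝕜) / (f - n) = q
  obtain ⟨a, b, c, d, e, f, g, k, h⟩ := eq_ofComp ((dx ^ (n - 1)) φ)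
  rw [h]
  simp only [mulL, LinearMap.add_apply, LinearMap.sub_apply, LinearMap.smul_apply,
    Module.End.mul_apply, LinearMap.coe_mk, eta1_eq_ofComp, eta2_eq_ofComp,
    AddHom.coe_mk, changeVars_ofComp, OPT.d1_ofComp, OPT.d2_ofComp, OPM.nabla_ofComp,
    OPM.d2_ofComp, zeta_eq_ofComp, dx_ofComp, map_smul, map_add, map_sub, map_neg, map_zero,
    OPT.ofComp_mul, ofComp_add, ofComp_sub, ofComp_smul, ofComp_inj]
  simp only [Algebra.smul_def, hs, h2, map_mul]
  refine ⟨?_, ?_, ?_, ?_, ?_, ?_, ?_, ?_⟩ <;> grind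

lemma d2_eq_zero_iff (φ : OPM 𝕜) : SFn.d2 φ = 0 ↔ minusOpT (changeVars φ) = 0 := by
  rw [minusOpT_changeVars, smul_eq_zero_iff_right two_invSqrtTwo_ne_zero, changeVars_eq_zero]

lemma nabla_eq_zero_iff (φ : OPM 𝕜) : nabla φ = 0 ↔ plusOpT (changeVars φ) = 0 := by
  rw [plusOpT_changeVars, smul_eq_zero_iff_right two_invSqrtTwo_ne_zero, changeVars_eq_zero]

lemma levelOp_eq_zero_iff (n : ℕ) (f : 𝕜) (φ : OPM 𝕜) :
    levelOp n f φ = 0 ↔ levelOpT n f (changeVars φ) = 0 := by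
  rw [levelOpT_changeVars, changeVars_eq_zero]

end ChangeVars

/-! ### A polynomial model of the Verma module. -/

section VermaModel

open Polynomial

variable {𝕜 : Type*} [RCLike 𝕜]

variable (𝕜) in
/-- The space of a polynomial model of the Verma module: `(p, q, s, t)` stands for
`(p(A₊) + q(A₊) d₊ + s(A₊) d₋ + t(A₊) d₊ d₋) |h, f⟩`. -/
abbrev VermaModel : Type _ := 𝕜[X] × 𝕜[X] × 𝕜[X] × 𝕜[X]

/-- The action of the basis vectors on the polynomial model, as maps. -/
def VermaModel.actFun (h f : 𝕜) : SGen → VermaModel 𝕜 → VermaModel 𝕜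
  | .Ap, (p, q, s, t) => (X * p, X * q, X * s, X * t)
  | .dp, (p, _, s, _) => (0, p, 0, s)
  | .dm, (p, q, _, t) => (2 * X * q, 0, p + 2 * X * t, -q)
  | .N, (p, q, s, t) => (C h * p + 2 * X * derivative p, C (h + 1) * q + 2 * X * derivative q,
      C (h + 1) * s + 2 * X * derivative s, C (h + 2) * t + 2 * X * derivative t)
  | .Ft, (p, q, s, t) => (C f * p, C (f + 1) * q, C (f - 1) * s, C f * t)
  | .Am, (p, q, s, t) =>
      (C (4 * h) * derivative p + 4 * X * derivative (derivative p) + C (4 * (h + f)) * t,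
        C (4 * (h + 1)) * derivative q + 4 * X * derivative (derivative q),
        C (4 * (h + 1)) * derivative s + 4 * X * derivative (derivative s),
        C (4 * (h + 2)) * derivative t + 4 * X * derivative (derivative t))
  | .cp, (p, q, _, t) => (C (2 * (h - f)) * q + 4 * X * derivative q, 0,
      C (2 * (h - f + 2)) * t + 2 * derivative p + 4 * X * derivative t, -2 * derivative q)
  | .cm, (p, _, s, t) => (C (2 * (h + f)) * s, -(C (2 * (h + f)) * t) + 2 * derivative p, 0,
      2 * derivative s)

/-- The action of the basis vectors on the polynomial model. -/
def VermaModel.act (h f : 𝕜) (Y : SGen) : Module.End 𝕜 (VermaModel 𝕜) where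
  toFun := actFun h f Y
  map_add' u v := by
    obtain ⟨p, q, s, t⟩ := u
    obtain ⟨p', q', s', t'⟩ := v
    cases Y <;> simp only [actFun, Prod.mk_add_mk, derivative_add, Prod.mk.injEq] <;>
    refine ⟨?_, ?_, ?_, ?_⟩ <;> first | trivial | ring
  map_smul' c u := by
    obtain ⟨p, q, s, t⟩ := u
    cases Y <;> simp only [actFun, Prod.smul_mk, derivative_smul, Prod.mk.injEq, smul_eq_C_mul,
      RingHom.id_apply, derivative_C_mul] <;>
    refine ⟨?_, ?_, ?_, ?_⟩ <;> first | trivial | ring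

lemma VermaModel.act_apply (h f : 𝕜) (Y : SGen) (u : VermaModel 𝕜) :
    act h f Y u = actFun h f Y u := rfl

/-- Expands the sum over the basis once, with unspecified integers `c`, so that each pair of
generators only has to insert its structure constants. -/
lemma VermaModel.sum_smul_act (h f : 𝕜) (c : SGen → ℤ) (p q s t : 𝕜[X]) :
    ∑ W, (c W : 𝕜) • act h f W (p, q, s, t) =
      (c .Ap • (X * p) + c .dm • (2 * X * q) + c .N • (C h * p + 2 * X * derivative p)
          + c .Ft • (C f * p) + c .Am • (C (4 * h) * derivative p
            + 4 * X * derivative (derivative p) + C (4 * (h + f)) * t)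
          + c .cp • (C (2 * (h - f)) * q + 4 * X * derivative q) + c .cm • (C (2 * (h + f)) * s),
        c .Ap • (X * q) + c .dp • p
          + c .N • (C (h + 1) * q + 2 * X * derivative q) + c .Ft • (C (f + 1) * q)
          + c .Am • (C (4 * (h + 1)) * derivative q + 4 * X * derivative (derivative q))
          + c .cm • (-(C (2 * (h + f)) * t) + 2 * derivative p),
        c .Ap • (X * s) + c .dm • (p + 2 * X * t) + c .N • (C (h + 1) * s + 2 * X * derivative s)
          + c .Ft • (C (f - 1) * s)
          + c .Am • (C (4 * (h + 1)) * derivative s + 4 * X * derivative (derivative s))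
          + c .cp • (C (2 * (h - f + 2)) * t + 2 * derivative p + 4 * X * derivative t),
        c .Ap • (X * t) + c .dp • s - c .dm • q
          + c .N • (C (h + 2) * t + 2 * X * derivative t) + c .Ft • (C f * t)
          + c .Am • (C (4 * (h + 2)) * derivative t + 4 * X * derivative (derivative t))
          - c .cp • (2 * derivative q) + c .cm • (2 * derivative s)) := by
  rw [sum_sgen]
  simp only [act_apply, actFun, Prod.smul_mk, Prod.mk_add_mk, Prod.mk.injEq, smul_eq_C_mul,
    zsmul_eq_mul, map_intCast]
  refine ⟨?_, ?_, ?_, ?_⟩ <;> ring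

-- The model formulas arise by moving a generator to the right past powers of `A₊` and past `d₊, d₋`
-- until it meets `|h,f⟩`; each commutator with `A₊^k` becomes a derivative in `X`. That they
-- satisfy the relations is checked here for every pair, so linear independence in the Verma module
-- need not be known beforehand.
set_option maxHeartbeats 4000000 in
lemma VermaModel.act_mul_act (h f : 𝕜) (Y Z : SGen) : act h f Y * act h f Z =
    (csign Y.deg Z.deg : 𝕜) • (act h f Z * act h f Y) + ∑ W, (SGen.sc Y Z W : 𝕜) • act h f W := by
  have h2 : (C 2 : 𝕜[X]) = 2 := C_ofNat 2
  have h4 : (C 4 : 𝕜[X]) = 4 := C_ofNat 4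
  refine LinearMap.ext fun u => ?_
  obtain ⟨p, q, s, t⟩ := u
  simp only [LinearMap.add_apply, LinearMap.smul_apply, Module.End.mul_apply, LinearMap.sum_apply,
    sum_smul_act h f (SGen.sc Y Z)]
  cases Y <;> cases Z <;> simp only [act_apply, actFun, Prod.smul_mk, Prod.mk_add_mk,
    Prod.mk.injEq] <;>
  simp [SGen.sc, completeTable, SGen.table, SGen.deg, csign, val_one2, derivative_mul,
    smul_eq_C_mul, h2, h4] <;>
  grind

end VermaModel

/-! ### Commutation relations and lowest weight vectors in an arbitrary representation. -/

section Representation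

variable {𝕜 V : Type*} [RCLike 𝕜] [AddCommGroup V] [Module 𝕜 V]

/-- The operators `T X` represent the superalgebra with basis `SGen`. -/
def SGen.IsRep (T : SGen → Module.End 𝕜 V) : Prop :=
  ∀ X Y u, T X (T Y u) =
    (csign X.deg Y.deg : 𝕜) • T Y (T X u) + ∑ Z, (SGen.sc X Y Z : 𝕜) • T Z u

/-- The vector `v` is a lowest weight vector of weight `(h, f)` for the operators `T X`. -/
structure SGen.IsLowest (T : SGen → Module.End 𝕜 V) (h f : 𝕜) (v : V) : Prop where
  cp : T .cp v = 0
  cm : T .cm v = 0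
  N : T .N v = h • v
  Ft : T .Ft v = f • v

namespace SGen.IsRep

variable {T : SGen → Module.End 𝕜 V} (hT : SGen.IsRep T)

include hT

lemma N_Ap (u : V) : T .N (T .Ap u) = T .Ap (T .N u) + (2 : 𝕜) • T .Ap u := by
  rw [hT, sum_sgen]
  simp [SGen.sc, completeTable, SGen.table, SGen.deg, csign, val_one2]

lemma Ft_Ap (u : V) : T .Ft (T .Ap u) = T .Ap (T .Ft u) := by
  rw [hT, sum_sgen]
  simp [SGen.sc, completeTable, SGen.table, SGen.deg, csign, val_one2]

lemma cp_Ap (u : V) : T .cp (T .Ap u) = T .Ap (T .cp u) + (2 : 𝕜) • T .dm u := by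
  rw [hT, sum_sgen]
  simp [SGen.sc, completeTable, SGen.table, SGen.deg, csign, val_one2]

lemma cm_Ap (u : V) : T .cm (T .Ap u) = T .Ap (T .cm u) + (2 : 𝕜) • T .dp u := by
  rw [hT, sum_sgen]
  simp [SGen.sc, completeTable, SGen.table, SGen.deg, csign, val_one2]

lemma dp_Ap (u : V) : T .dp (T .Ap u) = T .Ap (T .dp u) := by
  rw [hT, sum_sgen]
  simp [SGen.sc, completeTable, SGen.table, SGen.deg, csign, val_one2]

lemma dm_Ap (u : V) : T .dm (T .Ap u) = T .Ap (T .dm u) := by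
  rw [hT, sum_sgen]
  simp [SGen.sc, completeTable, SGen.table, SGen.deg, csign, val_one2]

lemma N_dp (u : V) : T .N (T .dp u) = T .dp (T .N u) + T .dp u := by
  rw [hT, sum_sgen]
  simp [SGen.sc, completeTable, SGen.table, SGen.deg, csign, val_one2]

lemma N_dm (u : V) : T .N (T .dm u) = T .dm (T .N u) + T .dm u := by
  rw [hT, sum_sgen]
  simp [SGen.sc, completeTable, SGen.table, SGen.deg, csign, val_one2]

lemma Ft_dp (u : V) : T .Ft (T .dp u) = T .dp (T .Ft u) + T .dp u := by
  rw [hT, sum_sgen]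
  simp [SGen.sc, completeTable, SGen.table, SGen.deg, csign, val_one2]

lemma Ft_dm (u : V) : T .Ft (T .dm u) = T .dm (T .Ft u) - T .dm u := by
  rw [hT, sum_sgen]
  simp [SGen.sc, completeTable, SGen.table, SGen.deg, csign, val_one2, sub_eq_add_neg]

lemma cp_dp (u : V) : T .cp (T .dp u) =
    -T .dp (T .cp u) + (2 : 𝕜) • (T .N u - T .Ft u) := by
  rw [hT, sum_sgen]
  simp [SGen.sc, completeTable, SGen.table, SGen.deg, csign, val_one2]
  module

lemma cp_dm (u : V) : T .cp (T .dm u) = -T .dm (T .cp u) := by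
  rw [hT, sum_sgen]
  simp [SGen.sc, completeTable, SGen.table, SGen.deg, csign, val_one2]

lemma cm_dp (u : V) : T .cm (T .dp u) = -T .dp (T .cm u) := by
  rw [hT, sum_sgen]
  simp [SGen.sc, completeTable, SGen.table, SGen.deg, csign, val_one2]

lemma cm_dm (u : V) : T .cm (T .dm u) =
    -T .dm (T .cm u) + (2 : 𝕜) • (T .N u + T .Ft u) := by
  rw [hT, sum_sgen]
  simp [SGen.sc, completeTable, SGen.table, SGen.deg, csign, val_one2]

lemma dm_dp (u : V) : T .dm (T .dp u) = -T .dp (T .dm u) + (2 : 𝕜) • T .Ap u := by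
  rw [hT, sum_sgen]
  simp [SGen.sc, completeTable, SGen.table, SGen.deg, csign, val_one2]

lemma cp_cm (u : V) : T .cp (T .cm u) = -T .cm (T .cp u) + (2 : 𝕜) • T .Am u := by
  rw [hT, sum_sgen]
  simp [SGen.sc, completeTable, SGen.table, SGen.deg, csign, val_one2]

/-- For equal odd generators the relation reads `d₊² = -d₊²`, and 2 is invertible. -/
lemma dp_dp (u : V) : T .dp (T .dp u) = 0 := by
  have h := hT .dp .dp u
  rw [sum_sgen] at h
  simp [SGen.sc, completeTable, SGen.table, SGen.deg, csign, val_one2] at h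
  have h2 : (2 : 𝕜) • T .dp (T .dp u) = 0 := by
    rw [two_smul]
    nth_rw 1 [h]
    exact neg_add_cancel _
  exact (smul_eq_zero.1 h2).resolve_left two_ne_zero

lemma dm_dm (u : V) : T .dm (T .dm u) = 0 := by
  have h := hT .dm .dm u
  rw [sum_sgen] at h
  simp [SGen.sc, completeTable, SGen.table, SGen.deg, csign, val_one2] at h
  have h2 : (2 : 𝕜) • T .dm (T .dm u) = 0 := by
    rw [two_smul]
    nth_rw 1 [h]
    exact neg_add_cancel _
  exact (smul_eq_zero.1 h2).resolve_left two_ne_zero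

lemma N_Ap_pow (k : ℕ) (u : V) : T .N ((T .Ap ^ k) u) =
    (T .Ap ^ k) (T .N u) + (2 * k : 𝕜) • (T .Ap ^ k) u := by
  induction k with
  | zero => simp
  | succ k ih =>
    rw [pow_succ', Module.End.mul_apply, N_Ap hT, ih, map_add, map_smul, Module.End.mul_apply]
    push_cast
    module

lemma Ft_Ap_pow (k : ℕ) (u : V) : T .Ft ((T .Ap ^ k) u) = (T .Ap ^ k) (T .Ft u) := by
  induction k with
  | zero => simp
  | succ k ih => rw [pow_succ', Module.End.mul_apply, Ft_Ap hT, ih, Module.End.mul_apply]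

lemma dp_Ap_pow (k : ℕ) (u : V) : T .dp ((T .Ap ^ k) u) = (T .Ap ^ k) (T .dp u) := by
  induction k with
  | zero => simp
  | succ k ih => rw [pow_succ', Module.End.mul_apply, dp_Ap hT, ih, Module.End.mul_apply]

lemma dm_Ap_pow (k : ℕ) (u : V) : T .dm ((T .Ap ^ k) u) = (T .Ap ^ k) (T .dm u) := by
  induction k with
  | zero => simp
  | succ k ih => rw [pow_succ', Module.End.mul_apply, dm_Ap hT, ih, Module.End.mul_apply]

/-- `[c₊, A₊] = 2 d₋` and `d₋` commutes with `A₊`, so each of the `k + 1` factors contributes the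
same term. -/
lemma cp_Ap_pow_succ (k : ℕ) (u : V) : T .cp ((T .Ap ^ (k + 1)) u) =
    (T .Ap ^ (k + 1)) (T .cp u) + (2 * (k + 1) : 𝕜) • (T .Ap ^ k) (T .dm u) := by
  induction k with
  | zero => simp [cp_Ap hT]
  | succ k ih =>
    rw [pow_succ', Module.End.mul_apply, cp_Ap hT, ih, dm_Ap_pow hT]
    simp only [map_add, map_smul, pow_succ', Module.End.mul_apply]
    push_cast
    module

lemma cm_Ap_pow_succ (k : ℕ) (u : V) : T .cm ((T .Ap ^ (k + 1)) u) =
    (T .Ap ^ (k + 1)) (T .cm u) + (2 * (k + 1) : 𝕜) • (T .Ap ^ k) (T .dp u) := by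
  induction k with
  | zero => simp [cm_Ap hT]
  | succ k ih =>
    rw [pow_succ', Module.End.mul_apply, cm_Ap hT, ih, dp_Ap_pow hT]
    simp only [map_add, map_smul, pow_succ', Module.End.mul_apply]
    push_cast
    module

variable {h f : 𝕜} {v : V} (hv : SGen.IsLowest T h f v)

include hv

/-- `2 A₋ = {c₊, c₋}`, which is why `SGen.IsLowest` does not list `A₋`. -/
lemma Am_eq_zero : T .Am v = 0 := by
  have h := cp_cm hT v
  rw [hv.cp, hv.cm, map_zero, map_zero, neg_zero, zero_add] at h
  exact (smul_eq_zero.1 h.symm).resolve_left two_ne_zero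

lemma isLowest_dm (hf : h = -f) : SGen.IsLowest T (h + 1) (f - 1) (T .dm v) where
  cp := by rw [cp_dm hT, hv.cp, map_zero, neg_zero]
  cm := by
    rw [cm_dm hT, hv.cm, hv.N, hv.Ft, hf, map_zero]
    module
  N := by
    rw [N_dm hT, hv.N, map_smul]
    module
  Ft := by
    rw [Ft_dm hT, hv.Ft, map_smul]
    module

lemma isLowest_dp (hf : h = f) : SGen.IsLowest T (h + 1) (f + 1) (T .dp v) where
  cp := by
    rw [cp_dp hT, hv.cp, hv.N, hv.Ft, hf, map_zero]
    module
  cm := by rw [cm_dp hT, hv.cm, map_zero, neg_zero]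
  N := by
    rw [N_dp hT, hv.N, map_smul]
    module
  Ft := by
    rw [Ft_dp hT, hv.Ft, map_smul]
    module

/-- Write `n = m + 1`. On `A₊^n v + q A₊^(n-1) d₊ d₋ v`, for general `h`, `c₊` gives `2n + q (4n +
2h - 2f)` times `A₊^(n-1) d₋ v`, and `c₋` gives `2n - 2q (h + f)` times `A₊^(n-1) d₊ v`. For `h =
-n` both conditions become `q (f - n) = n`. -/
lemma isLowest_level (m : ℕ) (hh : h = -(m + 1 : 𝕜)) {q : 𝕜} (hq : q * (f - (m + 1)) = m + 1) :
    SGen.IsLowest T (h + 2 * (m + 1)) f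
      ((T .Ap ^ (m + 1)) v + q • (T .Ap ^ m) (T .dp (T .dm v))) := by
  subst hh
  have hcp : T .cp (T .dp (T .dm v)) = (2 * (1 - m - f) : 𝕜) • T .dm v := by
    rw [cp_dp hT, cp_dm hT, hv.cp, N_dm hT, Ft_dm hT, hv.N, hv.Ft]
    simp only [map_smul, map_zero, map_neg]
    module
  have hcm : T .cm (T .dp (T .dm v)) = (2 * (m + 1 - f) : 𝕜) • T .dp v := by
    rw [cm_dp hT, cm_dm hT, hv.cm, hv.N, hv.Ft]
    simp only [map_smul, map_zero, map_neg, map_add]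
    module
  constructor
  · rw [map_add, map_smul, cp_Ap_pow_succ hT, hv.cp, map_zero, zero_add]
    -- For `m = 0` there is no power of `A₊` in front of `d₊ d₋ v` to commute past; otherwise it
    -- contributes through `d₋ d₊ d₋ v = 2 A₊ d₋ v`.
    rcases m with _ | m
    · simp only [pow_zero, Module.End.one_apply, hcp]
      match_scalars
      grind
    · have hd : T .dm (T .dp (T .dm v)) = (2 : 𝕜) • T .Ap (T .dm v) := by
        rw [dm_dp hT, dm_dm hT, map_zero, neg_zero, zero_add]
      rw [cp_Ap_pow_succ hT, hcp, hd, map_smul, map_smul, ← Module.End.mul_apply (T .Ap ^ m),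
        ← pow_succ]
      match_scalars
      push_cast at hq ⊢
      grind
  · rw [map_add, map_smul, cm_Ap_pow_succ hT, hv.cm, map_zero, zero_add]
    rcases m with _ | m
    · simp only [pow_zero, Module.End.one_apply, hcm]
      match_scalars
      grind
    · rw [cm_Ap_pow_succ hT, hcm, dp_dp hT, map_zero, smul_zero, add_zero, map_smul]
      match_scalars
      push_cast at hq ⊢
      grind
  · simp only [map_add, map_smul, N_Ap_pow hT, N_dp hT, N_dm hT, hv.N]
    push_cast
    module
  · simp only [map_add, map_sub, map_smul, Ft_Ap_pow hT, Ft_dp hT, Ft_dm hT, hv.Ft]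
    module

end SGen.IsRep

end Representation

/-! ### Singular vectors of the Verma module. -/

section Verma

variable {𝕜 : Type*} [RCLike 𝕜]

/-- The representation of `USuper` on the polynomial model. -/
def VermaModel.rep (h f : 𝕜) : USuper 𝕜 →ₐ[𝕜] Module.End 𝕜 (VermaModel 𝕜) :=
  Env.lift (act h f) (act_mul_act h f)

lemma VermaModel.rep_sgen (h f : 𝕜) (Y : SGen) : rep h f (sgen 𝕜 Y) = act h f Y :=
  Env.lift_gen _ _ Y

lemma VermaModel.rep_eq_zero {h f : 𝕜} {u : USuper 𝕜} (hu : u ∈ vermaIdeal h f) :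
    rep h f u (1, 0, 0, 0) = 0 := by
  induction hu using Submodule.span_induction with
  | mem u hu =>
    rcases hu with rfl | rfl | rfl | rfl <;>
    simp [rep_sgen, act_apply, actFun, Polynomial.smul_eq_C_mul, Module.algebraMap_end_apply]
  | zero => rw [map_zero, LinearMap.zero_apply]
  | add u w _ _ hu hw => rw [map_add, LinearMap.add_apply, hu, hw, add_zero]
  | smul c u _ hu => rw [smul_eq_mul, map_mul, Module.End.mul_apply, hu, map_zero]

/-- The model vector `(1, 0, 0, 0)` is killed by the defining left ideal, so an equality in the
quotient passes to the model. Only this direction is needed; no isomorphism with the model is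
required. -/
lemma VermaModel.rep_of_smul_vac_eq {h f a : 𝕜} {u : USuper 𝕜}
    (hu : u • Verma.vac h f = algebraMap 𝕜 (USuper 𝕜) a • Verma.vac h f) :
    rep h f u (1, 0, 0, 0) = a • (1, 0, 0, 0) := by
  rw [Verma.vac, ← Submodule.Quotient.mk_smul, ← Submodule.Quotient.mk_smul,
    Submodule.Quotient.eq, smul_eq_mul, smul_eq_mul, mul_one, mul_one] at hu
  have h0 := rep_eq_zero hu
  rwa [map_sub, AlgHom.commutes, LinearMap.sub_apply, sub_eq_zero,
    Module.algebraMap_end_apply] at h0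

/-- The action of the basis vectors on the Verma module. -/
def Verma.op (h f : 𝕜) (X : SGen) : Module.End 𝕜 (Verma h f) :=
  Algebra.lsmul 𝕜 𝕜 (Verma h f) (sgen 𝕜 X)

lemma Verma.isRep_op (h f : 𝕜) : SGen.IsRep (Verma.op h f) := by
  intro X Y u
  have e := congrArg (fun w => Algebra.lsmul 𝕜 𝕜 (Verma h f) w u)
    (Env.gen_mul_gen 𝕜 SGen.deg SGen.sc X Y)
  simp only [map_mul, map_add, map_smul, map_sum, LinearMap.add_apply, LinearMap.smul_apply,
    LinearMap.sum_apply, Module.End.mul_apply] at e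
  exact e

lemma Verma.isLowest_vac (h f : 𝕜) : SGen.IsLowest (Verma.op h f) h f (Verma.vac h f) := by
  have key : ∀ u ∈ vermaIdeal h f, u • Verma.vac h f = 0 := by
    intro u hu
    rw [Verma.vac, ← Submodule.Quotient.mk_smul, smul_eq_mul, mul_one]
    exact (Submodule.Quotient.mk_eq_zero _).2 hu
  have hs := Submodule.subset_span (R := USuper 𝕜) (s := {sgen 𝕜 .cp, sgen 𝕜 .cm,
    sgen 𝕜 .N - algebraMap 𝕜 _ h, sgen 𝕜 .Ft - algebraMap 𝕜 _ f})
  constructor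
  · exact key _ (hs (by simp))
  · exact key _ (hs (by simp))
  · have e := key _ (hs (show sgen 𝕜 .N - algebraMap 𝕜 _ h ∈ _ by simp))
    rwa [sub_smul, sub_eq_zero, algebraMap_smul] at e
  · have e := key _ (hs (show sgen 𝕜 .Ft - algebraMap 𝕜 _ f ∈ _ by simp))
    rwa [sub_smul, sub_eq_zero, algebraMap_smul] at e

lemma isSingularVector_of_isLowest {h f h' f' : 𝕜} {u : USuper 𝕜} {v : Verma h f}
    (huv : u • Verma.vac h f = v)
    (hv : SGen.IsLowest (Verma.op h f) h' f' v)
    (hu : ∀ a : 𝕜, VermaModel.rep h f u (1, 0, 0, 0) ≠ a • (1, 0, 0, 0)) :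
    IsSingularVector h f h' f' (u • Verma.vac h f) := by
  refine ⟨fun a ha => hu a (VermaModel.rep_of_smul_vac_eq ha), ?_, ?_, ?_, ?_, ?_⟩ <;> rw [huv]
  · rw [algebraMap_smul]
    exact hv.N
  · rw [algebraMap_smul]
    exact hv.Ft
  · exact (Verma.isRep_op h f).Am_eq_zero hv
  · exact hv.cp
  · exact hv.cm

lemma UPlus.incl_pgen (X : PGen) : UPlus.incl 𝕜 (pgen 𝕜 X) = sgen 𝕜 X.toS := Env.lift_gen _ _ X

lemma isSingularVector_dm (h f : 𝕜) (hf : h = -f) :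
    IsSingularVector h f (h + 1) (f - 1) (UPlus.incl 𝕜 (pgen 𝕜 .dm) • Verma.vac h f) := by
  rw [UPlus.incl_pgen]
  refine isSingularVector_of_isLowest rfl
    ((Verma.isRep_op h f).isLowest_dm (Verma.isLowest_vac h f) hf) fun a ha => ?_
  -- The `d₋` component of `d₋ |h,f⟩` is 1, while multiples of the vacuum have none.
  have e := congrArg (fun w => w.2.2.1) ha
  simp [PGen.toS, VermaModel.rep_sgen, VermaModel.act_apply, VermaModel.actFun] at e

lemma isSingularVector_dp (h f : 𝕜) (hf : h = f) :
    IsSingularVector h f (h + 1) (f + 1) (UPlus.incl 𝕜 (pgen 𝕜 .dp) • Verma.vac h f) := by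
  rw [UPlus.incl_pgen]
  refine isSingularVector_of_isLowest rfl
    ((Verma.isRep_op h f).isLowest_dp (Verma.isLowest_vac h f) hf) fun a ha => ?_
  have e := congrArg (fun w => w.2.1) ha
  simp [PGen.toS, VermaModel.rep_sgen, VermaModel.act_apply, VermaModel.actFun] at e

lemma VermaModel.act_Ap_pow (h f : 𝕜) (k : ℕ) (p q s t : Polynomial 𝕜) :
    (act h f .Ap ^ k) (p, q, s, t) =
      (Polynomial.X ^ k * p, Polynomial.X ^ k * q, Polynomial.X ^ k * s, Polynomial.X ^ k * t) := by
  induction k with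
  | zero => simp
  | succ k ih =>
    rw [pow_succ', Module.End.mul_apply, ih, act_apply]
    simp only [actFun, pow_succ', mul_assoc]

lemma isSingularVector_levelElt (n : ℕ) (h f : 𝕜) (hn : 1 ≤ n) (hh : h = -(n : 𝕜)) (hf : f ≠ n) :
    IsSingularVector h f (h + 2 * n) f (UPlus.incl 𝕜 (levelElt n f) • Verma.vac h f) := by
  obtain ⟨m, rfl⟩ := Nat.exists_eq_add_of_le' hn
  have hq : ((m + 1 : ℕ) : 𝕜) / (f - (m + 1 : ℕ)) * (f - (m + 1 : ℕ)) = (m + 1 : ℕ) :=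
    div_mul_cancel₀ _ (sub_ne_zero.2 hf)
  rw [levelElt, Nat.add_sub_cancel]
  generalize ((m + 1 : ℕ) : 𝕜) / (f - (m + 1 : ℕ)) = q at hq ⊢
  push_cast at hq hh ⊢
  simp only [map_add, map_smul, map_mul, map_pow, UPlus.incl_pgen, PGen.toS]
  refine isSingularVector_of_isLowest ?_
    ((Verma.isRep_op h f).isLowest_level (Verma.isLowest_vac h f) m hh hq) fun a ha => ?_
  -- Rewriting the action as an algebra homomorphism into endomorphisms turns the products and
  -- powers of generators into those of `Verma.op`.
  · have e : ∀ w : USuper 𝕜, w • Verma.vac h f =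
      Algebra.lsmul 𝕜 𝕜 (Verma h f) w (Verma.vac h f) := fun _ => rfl
    rw [e]
    simp only [map_add, map_smul, map_mul, map_pow]
    rfl
  -- The term with `d₊ d₋` lies in the fourth component, so the first is exactly `X^(m+1)`, whereas
  -- a multiple of the vacuum has a constant there.
  · have e := congrArg (fun w => w.1.coeff (m + 1)) ha
    simp [VermaModel.rep_sgen, VermaModel.act_Ap_pow, VermaModel.act_apply, VermaModel.actFun,
      Polynomial.coeff_one] at e

end Verma

/-! ### The right action of the singular elements. -/

section PiR

variable {𝕜 : Type*} [RCLike 𝕜]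

open SFn

lemma piR_pgen (X : PGen) : piR 𝕜 (pgen 𝕜 X) = PGen.op X := Env.lift_gen _ _ X

/-- `∂ₓ` commutes with `nabla` and `∂/∂ψ₋`, so the power on the left in `𝒫` may be written on the
right in `E`. -/
lemma piR_levelElt (n : ℕ) (f : 𝕜) (hn : 1 ≤ n) : piR 𝕜 (levelElt n f) = levelOp n f := by
  obtain ⟨m, rfl⟩ := Nat.exists_eq_add_of_le' hn
  have h1 : Commute (dx : Module.End 𝕜 (OPM 𝕜)) nabla :=
    LinearMap.ext fun u => (nabla_dx u).symm
  have h2 : Commute (dx : Module.End 𝕜 (OPM 𝕜)) d2 := LinearMap.ext fun u => (d2_dx u).symm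
  have h := ((h1.mul_right h2).pow_left m).eq
  rw [levelElt, levelOp, map_add, map_smul, map_mul, map_mul, map_pow, map_pow, piR_pgen, piR_pgen,
    piR_pgen, Nat.add_sub_cancel, add_mul, smul_mul_assoc, ← h, pow_succ', mul_assoc]
  rfl

end PiR

end ColorSuper

end

open ColorSuper

theorem mainTheorem3 (𝕜 : Type*) [RCLike 𝕜] :
    -- the brackets of the new basis are those induced by the brackets of `𝔤`
    (∀ X Y : SGen, Ext.bracket (X.toExt : Ext 𝕜) Y.toExt =
      ∑ Z, (SGen.sc X Y Z : 𝕜) • (Z.toExt : Ext 𝕜)) ∧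
    -- the first order coordinates that define the right action
    (∀ (V : Ext 𝕜) (X : Gen), X ≠ .Am → X ≠ .am → X ≠ .bm →
      V X = (Ext.lmul (coordXi V) mcX + Ext.lmul (coordPlus V) mcPlus
        + Ext.lmul (coordMinus V) mcMinus + Ext.lmul (coordN V) (Ext.mk 1 .N)
        + Ext.lmul (coordF V) Ftilde) X) ∧
    -- the right action
    (∀ h f : 𝕜, rightAct h f (Ext.mk 1 .Ap) = SFn.dx ∧ rightAct h f dPlus = nabla ∧
      rightAct h f dMinus = SFn.d2 ∧
      rightAct h f (Ext.mk 1 .N) = h • (1 : Module.End 𝕜 (OPM 𝕜)) ∧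
      rightAct h f Ftilde = f • (1 : Module.End 𝕜 (OPM 𝕜)) ∧
      rightAct h f (Ext.mk 1 .Am) = 0 ∧ rightAct h f cPlus = 0 ∧ rightAct h f cMinus = 0) ∧
    -- the equation `∂φ/∂ψ₋ = 0`
    (∀ h f : 𝕜, h = -f →
      IsSingularVector h f (h + 1) (f - 1) (UPlus.incl 𝕜 (pgen 𝕜 .dm) • Verma.vac h f) ∧
      piR 𝕜 (pgen 𝕜 .dm) = SFn.d2 ∧
      Intertwines (0, 1) SFn.d2 h f (h + 1) (f - 1) ∧
      IsInvariantEquation h f SFn.d2) ∧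
    -- the equation `(∂/∂ψ₊ + 2 ψ₋ ∂/∂x) φ = 0`
    (∀ h f : 𝕜, h = f →
      IsSingularVector h f (h + 1) (f + 1) (UPlus.incl 𝕜 (pgen 𝕜 .dp) • Verma.vac h f) ∧
      piR 𝕜 (pgen 𝕜 .dp) = nabla ∧
      Intertwines (0, 1) nabla h f (h + 1) (f + 1) ∧
      IsInvariantEquation h f nabla) ∧
    -- the equation of level `2n`
    (∀ (n : ℕ) (h f : 𝕜), 1 ≤ n → h = -(n : 𝕜) → f ≠ n →
      IsSingularVector h f (h + 2 * n) f (UPlus.incl 𝕜 (levelElt n f) • Verma.vac h f) ∧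
      piR 𝕜 (levelElt n f) = levelOp n f ∧
      Intertwines (0, 0) (levelOp n f) h f (h + 2 * n) f ∧
      IsInvariantEquation h f (levelOp n f)) ∧
    -- the equations in the variables `x, ψ, θ`
    Function.Bijective (changeVars : OPM 𝕜 → OPT 𝕜) ∧
    (∀ φ : OPM 𝕜, SFn.d2 φ = 0 ↔ minusOpT (changeVars φ) = 0) ∧
    (∀ φ : OPM 𝕜, nabla φ = 0 ↔ plusOpT (changeVars φ) = 0) ∧
    (∀ (n : ℕ) (f : 𝕜), 1 ≤ n → f ≠ n →
      ∀ φ : OPM 𝕜, levelOp n f φ = 0 ↔ levelOpT n f (changeVars φ) = 0) := by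
  refine ⟨bracket_toExt, eq_add_of_coord, rightAct_basis, fun h f hf => ?_, fun h f hf => ?_,
    fun n h f hn hh hf => ?_, changeVars_bijective, d2_eq_zero_iff, nabla_eq_zero_iff,
    fun n f _ _ φ => levelOp_eq_zero_iff n f φ⟩
  · exact ⟨isSingularVector_dm h f hf, piR_pgen .dm, intertwines_d2 h f hf,
      isInvariantEquation_of_intertwines (intertwines_d2 h f hf) fun φ => Or.inl (d2_mulL_zeta φ)⟩
  · exact ⟨isSingularVector_dp h f hf, piR_pgen .dp, intertwines_nabla h f hf,
      isInvariantEquation_of_intertwines (intertwines_nabla h f hf)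
        fun φ => Or.inl (nabla_mulL_zeta φ)⟩
  · exact ⟨isSingularVector_levelElt n h f hn hh hf, piR_levelElt n f hn,
      intertwines_levelOp n h f hn hh hf,
      isInvariantEquation_of_intertwines (intertwines_levelOp n h f hn hh hf)
        fun φ => Or.inr (levelOp_mulL_zeta n f φ)⟩
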